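/- **Setting.** Let $\mathsf X,\mathsf Y,\mathsf U$ be measurable spaces, $\lambda_{\mathsf X},\lambda_{\mathsf Y}$ finite reference measures on $\mathsf X,\mathsf Y$, $\nu$ a probability measure on $\mathsf U$, and $\Theta\subseteq\mathbb R^p$ a set which near each of its points is convex with non-empty interior (e.g. $\Theta$ open, or $\Theta$ convex with non-empty interior); $\nabla_\theta$ denotes the gradient relative to $\Theta$, and $\|\cdot\|$ the maximum norm on $\mathbb R^p$. Write $dx$ for $\lambda_{\mathsf X}(dx)$. Let $m_0$ be a probability density on $\mathsf X$ and, for $\theta\in\Theta$, let $m_\theta(x,x')$ (on $\mathsf X$), $g_\theta(x,y)$ (on $\mathsf Y$) and $r_\theta(x,y,x')$ (on $\mathsf X$, in $x'$) be transition densities with respect to the reference measures, and let $\rho_\theta:\mathsf X\times\mathsf Y\times\mathsf U\to\mathsf X$ be measurable and such that $\rho_\theta(x,y,\cdot)$ pushes $\nu$ forward to $r_\theta(x,y,x')\,dx'$ for all $(x,y)$. Fix $\epsilon\in(0,1)$ and $\kappa\in[1,\infty)$ and assume that for all $\theta\in\Theta$, $x,x'\in\mathsf X$, $y\in\mathsf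 Y$, $u\in\mathsf U$: the numbers $m_\theta(x,x')$, $g_\theta(x,y)$, $r_\theta(x,y,x')$ lie in $[\epsilon,\epsilon^{-1}]$; the functions $\theta\mapsto m_\theta(x,x')$, $g_\theta(x,y)$, $m_\theta(x,\rho_\theta(x,y,u))$, $g_\theta(\rho_\theta(x,y,u),y)$, $r_\theta(x,y,\rho_\theta(x,y,u))$ are differentiable on $\Theta$ with gradients of norm at most $\kappa$. For a sequence $(y_t)_{t\ge0}$ in $\mathsf Y$ let the filter density be $$\phi_t^\theta(x_t)=\frac{\int\cdots\int m_0(x_0)g_\theta(x_0,y_0)\prod_{s=1}^t m_\theta(x_{s-1},x_s)g_\theta(x_s,y_s)\,dx_0\cdots dx_{t-1}}{\int\cdots\int m_0(x_0)g_\theta(x_0,y_0)\prod_{s=1}^t m_\theta(x_{s-1},x_s)g_\theta(x_s,y_s)\,dx_0\cdots dx_t}$$ and let $\tilde\phi_t^\theta(x)=\nabla_\theta\phi_t^\theta(x)$ be the tangent-filter density. Put $$w_\theta(x,y,u)=\frac{m_\theta(x,\rho_\theta(x,y,u))\,g_\theta(\rho_\theta(x,y,u),y)}{r_\theta(x,y,\rho_\theta(x,y,u))},\qquad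 L_\theta(y,\phi)=\log\iint g_\theta(x',y)m_\theta(x,x')\,dx'\,\phi(x)\,dx,$$ $$L^M_\theta(y,\phi)=\mathbb E\Big[\log\frac1M\sum_{i=1}^M w_\theta(X^i,y,U^i)\Big],$$ $$h_\theta(y,\phi,\tilde\phi)=\frac{\iint g_\theta(x',y)m_\theta(x,x')\,dx'\,\tilde\phi(x)\,dx+\iint\nabla_\theta\{g_\theta(x',y)m_\theta(x,x')\}\,dx'\,\phi(x)\,dx}{\iint g_\theta(x',y)m_\theta(x,x')\,dx'\,\phi(x)\,dx},$$ $$H^M_\theta(y,\phi,\tilde\phi)=\mathbb E\left[\frac{\sum_{i=1}^M\nabla_\theta w_\theta(X^i,y,U^i)}{\sum_{i=1}^M w_\theta(X^i,y,U^i)}\right]+M\int\!\!\int\mathbb E\Big[\log\Big(\frac1M w_\theta(x,y,u)+\frac1M\sum_{i=1}^{M-1}w_\theta(X^i,y,U^i)\Big)\Big]\nu(du)\,\tilde\phi(x)\,dx,$$ where the $(X^i,U^i)$ are i.i.d. with law $\phi(x)\,dx\otimes\nu(du)$. **Theorem.** There is a constant $C$ depending only on $\epsilon$ and $\kappa$ (and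 not on the model) such that the following hold. 1. For every sequence $(y_t)_{t\ge0}$ in $\mathsf Y$, every $t\ge0$, $\theta\in\Theta$ and $M\ge1$, $$\big\|H^M_\theta(y_{t+1},\phi_t^\theta,\tilde\phi_t^\theta)-h_\theta(y_{t+1},\phi_t^\theta,\tilde\phi_t^\theta)\big\|\le \frac CM .$$ 2. Let $(X_t,Y_t)_{t\ge0}$ be a state-space model on a probability space $(\Omega,\mathcal F,\mathbb P)$ with initial state density $m_0$, some state transition density $m(x,x')\in[\epsilon,\epsilon^{-1}]$ and some emission density $g(x,y)$ with respect to $\lambda_{\mathsf X},\lambda_{\mathsf Y}$ (not necessarily in the parametric family). Then there are functions $\ell$ and $\ell^M$, $M\ge1$, differentiable on $\Theta$, such that for every $\theta\in\Theta$, $\mathbb P$-a.s., $$\ell(\theta)=\lim_{t\to\infty}\frac1t\sum_{s=0}^{t-1}L_\theta(Y_{s+1},\phi_s^\theta),\qquad \ell^M(\theta)=\lim_{t\to\infty}\frac1t\sum_{s=0}^{t-1}L^M_\theta(Y_{s+1},\phi_s^\theta)$$ (filters computed from $Y_{0:s}$), and for all $\theta\in\Theta$ and $M\ge1$, $$\|\nabla\ell^M(\theta)-\nabla\ell(\theta)\|\le\frac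 CM .$$ -/

import Mathlib

open MeasureTheory Filter Topology
open scoped ENNReal

noncomputable section

/-- Gradient of `f` at `θ`, relative to the parameter set `Θ`, as the vector of partial derivatives.
For an open set `Θ` this is the usual gradient. The space `Fin p → ℝ` carries the maximum norm. -/
def relGrad {p : ℕ} (Θ : Set (Fin p → ℝ)) (f : (Fin p → ℝ) → ℝ) (θ : Fin p → ℝ) : Fin p → ℝ :=
  fun i => fderivWithin ℝ f Θ θ (Pi.single i 1)

/-- Parameter sets on which gradients make sense: near each of its points, the set is convex with
non-empty interior. Examples are all open sets and all convex sets with non-empty interior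
(in particular compact boxes and closed balls). -/
def IsParameterSet {p : ℕ} (Θ : Set (Fin p → ℝ)) : Prop :=
  ∀ θ ∈ Θ, ∃ r > 0, Convex ℝ (Θ ∩ Metric.ball θ r) ∧ (interior (Θ ∩ Metric.ball θ r)).Nonempty

/-- `k` is a (jointly measurable) transition density with respect to `μ`. -/
structure IsTransitionDensity {A B : Type*} [MeasurableSpace A] [MeasurableSpace B]
    (μ : Measure B) (k : A → B → ℝ) : Prop where
  measurable : Measurable (Function.uncurry k)
  nonneg : ∀ a b, 0 ≤ k a b
  integral_eq_one : ∀ a, ∫ b, k a b ∂μ = 1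

/-- The measure with density `φ` with respect to `μ`. -/
def measureOfDensity {A : Type*} [MeasurableSpace A] (μ : Measure A) (φ : A → ℝ) : Measure A :=
  μ.withDensity fun a => ENNReal.ofReal (φ a)

/-- The joint density of states `x_0, …, x_T` and observations `y_0, …, y_T` in a state-space model:
`m0(x_0) g(x_0, y_0) ∏_{t=1}^T m(x_{t-1}, x_t) g(x_t, y_t)`. -/
def ssmDensity {X Y : Type*} (m0 : X → ℝ) (m : X → X → ℝ) (g : X → Y → ℝ) (T : ℕ)
    (x : Fin (T + 1) → X) (y : Fin (T + 1) → Y) : ℝ :=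
  m0 (x 0) * g (x 0) (y 0) *
    ∏ t : Fin T, m (x t.castSucc) (x t.succ) * g (x t.succ) (y t.succ)

/-- `(Xs t, Ys t)`, `t = 0, 1, 2, …`, is a state-space model with initial density `m0`, state
transition density `m` and emission density `g` with respect to `lamX` and `lamY`. -/
structure IsSSM {X Y Ω : Type*} [MeasurableSpace X] [MeasurableSpace Y] [MeasurableSpace Ω]
    (lamX : Measure X) (lamY : Measure Y) (m0 : X → ℝ) (m : X → X → ℝ) (g : X → Y → ℝ)
    (P : Measure Ω) (Xs : ℕ → Ω → X) (Ys : ℕ → Ω → Y) : Prop where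
  measurable_state : ∀ t, Measurable (Xs t)
  measurable_obs : ∀ t, Measurable (Ys t)
  law : ∀ T : ℕ,
    P.map (fun ω => ((fun t : Fin (T + 1) => Xs t ω), (fun t : Fin (T + 1) => Ys t ω))) =
      ((Measure.pi fun _ : Fin (T + 1) => lamX).prod
        (Measure.pi fun _ : Fin (T + 1) => lamY)).withDensity
          fun z => ENNReal.ofReal (ssmDensity m0 m g T z.1 z.2)

/-- A parametric family of state-space models together with a reparameterised proposal. -/
structure ParamSSM (p : ℕ) (X Y U : Type*)
    [MeasurableSpace X] [MeasurableSpace Y] [MeasurableSpace U] where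
  /-- the parameter space -/
  Θ : Set (Fin p → ℝ)
  /-- the reference measure on the state space -/
  lamX : Measure X
  /-- the reference measure on the observation space -/
  lamY : Measure Y
  /-- the law of the auxiliary variable of the reparameterisation -/
  nu : Measure U
  /-- the initial density of the state process -/
  m0 : X → ℝ
  /-- the state transition density `m_θ(x, x')` -/
  m : (Fin p → ℝ) → X → X → ℝ
  /-- the emission density `g_θ(x, y)` -/
  g : (Fin p → ℝ) → X → Y → ℝ
  /-- the proposal density `r_θ(x, y, x')` of a new state given previous state and observation -/
  r : (Fin p → ℝ) → X → Y → X → ℝ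
  /-- the reparameterisation function -/
  rep : (Fin p → ℝ) → X → Y → U → X

namespace ParamSSM

variable {p : ℕ} {X Y U : Type*} [MeasurableSpace X] [MeasurableSpace Y] [MeasurableSpace U]

/-- The setting and the strong mixing assumptions, with constants `ε` and `κ`. -/
structure Assumptions (S : ParamSSM p X Y U) (ε κ : ℝ) : Prop where
  isParameterSet : IsParameterSet S.Θ
  finite_lamX : IsFiniteMeasure S.lamX
  finite_lamY : IsFiniteMeasure S.lamY
  prob_nu : IsProbabilityMeasure S.nu
  measurable_m0 : Measurable S.m0
  nonneg_m0 : ∀ x, 0 ≤ S.m0 x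
  integral_m0 : ∫ x, S.m0 x ∂S.lamX = 1
  density_m : ∀ θ ∈ S.Θ, IsTransitionDensity S.lamX (S.m θ)
  density_g : ∀ θ ∈ S.Θ, IsTransitionDensity S.lamY (S.g θ)
  density_r : ∀ θ ∈ S.Θ, IsTransitionDensity S.lamX fun xy : X × Y => S.r θ xy.1 xy.2
  measurable_rep : ∀ θ ∈ S.Θ, Measurable fun z : X × Y × U => S.rep θ z.1 z.2.1 z.2.2
  /-- the reparameterisation function pushes `nu` forward to the proposal law -/
  map_rep : ∀ θ ∈ S.Θ, ∀ x y, S.nu.map (S.rep θ x y) = measureOfDensity S.lamX (S.r θ x y)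
  bounds_m : ∀ θ ∈ S.Θ, ∀ x x', ε ≤ S.m θ x x' ∧ S.m θ x x' ≤ ε⁻¹
  bounds_g : ∀ θ ∈ S.Θ, ∀ x y, ε ≤ S.g θ x y ∧ S.g θ x y ≤ ε⁻¹
  bounds_r : ∀ θ ∈ S.Θ, ∀ x y x', ε ≤ S.r θ x y x' ∧ S.r θ x y x' ≤ ε⁻¹
  diff_m : ∀ x x', DifferentiableOn ℝ (fun θ => S.m θ x x') S.Θ
  diff_g : ∀ x y, DifferentiableOn ℝ (fun θ => S.g θ x y) S.Θ
  diff_m_rep : ∀ x y u, DifferentiableOn ℝ (fun θ => S.m θ x (S.rep θ x y u)) S.Θ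
  diff_g_rep : ∀ x y u, DifferentiableOn ℝ (fun θ => S.g θ (S.rep θ x y u) y) S.Θ
  diff_r_rep : ∀ x y u, DifferentiableOn ℝ (fun θ => S.r θ x y (S.rep θ x y u)) S.Θ
  grad_m : ∀ θ ∈ S.Θ, ∀ x x', ‖relGrad S.Θ (fun θ => S.m θ x x') θ‖ ≤ κ
  grad_g : ∀ θ ∈ S.Θ, ∀ x y, ‖relGrad S.Θ (fun θ => S.g θ x y) θ‖ ≤ κ
  grad_m_rep : ∀ θ ∈ S.Θ, ∀ x y u, ‖relGrad S.Θ (fun θ => S.m θ x (S.rep θ x y u)) θ‖ ≤ κ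
  grad_g_rep : ∀ θ ∈ S.Θ, ∀ x y u, ‖relGrad S.Θ (fun θ => S.g θ (S.rep θ x y u) y) θ‖ ≤ κ
  grad_r_rep : ∀ θ ∈ S.Θ, ∀ x y u, ‖relGrad S.Θ (fun θ => S.r θ x y (S.rep θ x y u)) θ‖ ≤ κ

/-- The importance weight `w_θ(x, y, u)`. -/
def weight (S : ParamSSM p X Y U) (θ : Fin p → ℝ) (x : X) (y : Y) (u : U) : ℝ :=
  S.m θ x (S.rep θ x y u) * S.g θ (S.rep θ x y u) y / S.r θ x y (S.rep θ x y u)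

/-- The filter density at time `t`: the conditional density of `x_t` given `y_0, …, y_t`,
obtained from the joint density by integrating out `x_0, …, x_{t-1}` and normalising. -/
def filterDensity (S : ParamSSM p X Y U) (θ : Fin p → ℝ) (y : ℕ → Y) (t : ℕ) (x : X) : ℝ :=
  (∫ x' : Fin t → X,
      ssmDensity S.m0 (S.m θ) (S.g θ) t (Fin.snoc (α := fun _ => X) x' x) (fun s => y s)
        ∂(Measure.pi fun _ => S.lamX)) /
    ∫ x' : Fin (t + 1) → X, ssmDensity S.m0 (S.m θ) (S.g θ) t x' (fun s => y s)
      ∂(Measure.pi fun _ => S.lamX)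

/-- The tangent-filter density at time `t`: the gradient in `θ` of the filter density. -/
def tangentDensity (S : ParamSSM p X Y U) (θ : Fin p → ℝ) (y : ℕ → Y) (t : ℕ) (x : X) :
    Fin p → ℝ :=
  relGrad S.Θ (fun θ => S.filterDensity θ y t x) θ

/-- The predictive likelihood `∬ g_θ(x', y) m_θ(x, x') dx' φ(x) dx`. -/
def predLik (S : ParamSSM p X Y U) (θ : Fin p → ℝ) (y : Y) (φ : X → ℝ) : ℝ :=
  ∫ x, (∫ x', S.g θ x' y * S.m θ x x' ∂S.lamX) * φ x ∂S.lamX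

/-- The summand of the contrast function: the logarithm of the predictive likelihood. -/
def logPredLik (S : ParamSSM p X Y U) (θ : Fin p → ℝ) (y : Y) (φ : X → ℝ) : ℝ :=
  Real.log (S.predLik θ y φ)

/-- The law of one pair `(X, U)` with independent `X ∼ φ` and `U ∼ nu`. -/
def sampleLaw (S : ParamSSM p X Y U) (φ : X → ℝ) : Measure (X × U) :=
  (measureOfDensity S.lamX φ).prod S.nu

/-- The importance-weighted variational objective with `M` samples. -/
def iwObjective (S : ParamSSM p X Y U) (M : ℕ) (θ : Fin p → ℝ) (y : Y) (φ : X → ℝ) : ℝ :=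
  ∫ z : Fin M → X × U,
    Real.log ((M : ℝ)⁻¹ * ∑ i, S.weight θ (z i).1 y (z i).2)
      ∂(Measure.pi fun _ => S.sampleLaw φ)

/-- The stochastic gradient of recursive maximum likelihood, as a function of an observation, a
state density and a tangent density. -/
def rmlGrad (S : ParamSSM p X Y U) (θ : Fin p → ℝ) (y : Y) (φ : X → ℝ) (φt : X → Fin p → ℝ) :
    Fin p → ℝ :=
  (S.predLik θ y φ)⁻¹ •
    ((∫ x, (∫ x', S.g θ x' y * S.m θ x x' ∂S.lamX) • φt x ∂S.lamX) +
      ∫ x, φ x • (∫ x', relGrad S.Θ (fun θ => S.g θ x' y * S.m θ x x') θ ∂S.lamX) ∂S.lamX)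

/-- The stochastic gradient of the online sequential importance-weighted autoencoder with `M`
samples. -/
def osiwaeGrad (S : ParamSSM p X Y U) (M : ℕ) (θ : Fin p → ℝ) (y : Y) (φ : X → ℝ)
    (φt : X → Fin p → ℝ) : Fin p → ℝ :=
  (∫ z : Fin M → X × U,
      (∑ i, S.weight θ (z i).1 y (z i).2)⁻¹ •
        ∑ i, relGrad S.Θ (fun θ => S.weight θ (z i).1 y (z i).2) θ
      ∂(Measure.pi fun _ => S.sampleLaw φ)) +
    (M : ℝ) • ∫ x,
      (∫ u, ∫ z : Fin (M - 1) → X × U,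
        Real.log ((M : ℝ)⁻¹ * S.weight θ x y u +
          (M : ℝ)⁻¹ * ∑ i, S.weight θ (z i).1 y (z i).2)
        ∂(Measure.pi fun _ => S.sampleLaw φ) ∂S.nu) • φt x ∂S.lamX

/-- `ℓ` is the asymptotic contrast function for the observation process `Ys` under `P`. -/
def IsContrast {Ω : Type*} [MeasurableSpace Ω] (S : ParamSSM p X Y U) (P : Measure Ω)
    (Ys : ℕ → Ω → Y) (ℓ : (Fin p → ℝ) → ℝ) : Prop :=
  ∀ θ ∈ S.Θ, ∀ᵐ ω ∂P, Tendsto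
    (fun t : ℕ => (t : ℝ)⁻¹ * ∑ s ∈ Finset.range t,
      S.logPredLik θ (Ys (s + 1) ω) (S.filterDensity θ (fun n => Ys n ω) s))
    atTop (𝓝 (ℓ θ))

/-- `ℓM` is the contrast lower bound with `M` samples for the observation process `Ys`
under `P`. -/
def IsContrastLowerBound {Ω : Type*} [MeasurableSpace Ω] (S : ParamSSM p X Y U) (M : ℕ)
    (P : Measure Ω) (Ys : ℕ → Ω → Y) (ℓM : (Fin p → ℝ) → ℝ) : Prop :=
  ∀ θ ∈ S.Θ, ∀ᵐ ω ∂P, Tendsto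
    (fun t : ℕ => (t : ℝ)⁻¹ * ∑ s ∈ Finset.range t,
      S.iwObjective M θ (Ys (s + 1) ω) (S.filterDensity θ (fun n => Ys n ω) s))
    atTop (𝓝 (ℓM θ))

end ParamSSM

end

/-! Both conclusions rest on one estimate, valid for every observation sequence. Let f be the filter
density on pairs (x, u), w the importance weight and c = ∫ w f. The weights are unbiased, so c is
the predictive likelihood and h = ∇ log c. Likewise H^M is the gradient of E log(average weight),
where θ enters through the weights and through the sampling law. The weight part is the
self-normalised ratio E[∑∇w / ∑w]. It differs from ∫ ∇w f / c by O(1/M), because its first-order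
fluctuations have mean zero (`abs_integral_ratio_sub_le`). By exchangeability the law part is M ∫ E
log(average with one weight held fixed) ∇f. Replacing the fixed weight w by c changes M times the
expected logarithm by (w - c)/c + O(1/M) (`abs_integral_log_sub_le`). Since ∫ ∇f = 0, terms not
depending on the fixed sample disappear and c⁻¹ ∫ w ∇f remains. The error is O(1/M) ∫ |∇f|, so it is
enough that |∇f| ≤ K f with K independent of time. This gives `abs_famGrad_iwBound_sub_le` and the
first conclusion.

The bound K comes from the oscillation of the score ∇f / f in the state. A filter step averages the
old score against backward kernels and adds terms of size κ/ε. All backward kernels dominate ε²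
times the old filter, so the averaging contracts oscillations by 1 - ε², and the level K = 4κ/ε³ is
preserved (`DensityFamily.filterUpdate`). The score has mean zero, so its oscillation bounds it.

For the second conclusion, compare the filter with a copy restarted from the uniform density. Their
ratio is, up to normalisation, again propagated by backward-kernel averages, so its oscillation and
that of its gradient decay geometrically (`Assumptions.exists_forgetting`). The summands and their
gradients are therefore functionals of the last few observations up to exponentially small errors.
The chain of states and observations satisfies a Doeblin condition, so expectations converge and
covariances decay exponentially. A second-moment law of large numbers gives the almost sure limits.
The expected gradients converge uniformly in θ, hence the limits are differentiable and their
gradients are the limits of the expected gradients (`exists_ergodic_limit`). The pointwise estimate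
then passes to expectations and to the limit with the same constant. -/

noncomputable section

/-! ### Differential calculus relative to a parameter set. -/

section Calculus

variable {p : ℕ} {Θ : Set (Fin p → ℝ)} {θ : Fin p → ℝ} {f g : (Fin p → ℝ) → ℝ}

theorem IsParameterSet.uniqueDiffWithinAt (hΘ : IsParameterSet Θ) (hθ : θ ∈ Θ) :
    UniqueDiffWithinAt ℝ Θ θ := by
  obtain ⟨r, hr, hc, hi⟩ := hΘ θ hθ
  exact (uniqueDiffWithinAt_convex hc hi
    (subset_closure ⟨hθ, Metric.mem_ball_self hr⟩)).mono Set.inter_subset_left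

theorem fderivWithin_eq_sum_relGrad (f : (Fin p → ℝ) → ℝ) (θ v : Fin p → ℝ) :
    fderivWithin ℝ f Θ θ v = ∑ i, v i * relGrad Θ f θ i := by
  have hv : v = ∑ i, v i • (Pi.single i (1 : ℝ) : Fin p → ℝ) := by
    ext j; simp [Finset.sum_apply, Pi.single_apply]
  conv_lhs => rw [hv]
  simp [map_sum, relGrad]

theorem norm_fderivWithin_le_of_relGrad {A : ℝ} (h : ∀ i, |relGrad Θ f θ i| ≤ A) :
    ‖fderivWithin ℝ f Θ θ‖ ≤ p * A := by
  rcases Nat.eq_zero_or_pos p with rfl | hp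
  · have : fderivWithin ℝ f Θ θ = 0 := by
      ext v; rw [fderivWithin_eq_sum_relGrad]; simp
    simp [this]
  have hA : 0 ≤ A := (abs_nonneg _).trans (h ⟨0, hp⟩)
  refine ContinuousLinearMap.opNorm_le_bound _ (by positivity) fun v => ?_
  rw [fderivWithin_eq_sum_relGrad]
  calc ‖∑ i, v i * relGrad Θ f θ i‖ ≤ ∑ i : Fin p, ‖v i * relGrad Θ f θ i‖ := norm_sum_le _ _
    _ ≤ ∑ _i : Fin p, ‖v‖ * A := by
        refine Finset.sum_le_sum fun i _ => ?_
        rw [norm_mul]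
        exact mul_le_mul (norm_le_pi_norm v i) (h i) (norm_nonneg _) (norm_nonneg _)
    _ = p * A * ‖v‖ := by simp; ring

theorem relGrad_congr (h : ∀ θ ∈ Θ, f θ = g θ) (hθ : θ ∈ Θ) : relGrad Θ f θ = relGrad Θ g θ := by
  ext i
  simp only [relGrad]
  rw [fderivWithin_congr h (h θ hθ)]

theorem relGrad_const (c : ℝ) (i : Fin p) : relGrad Θ (fun _ => c) θ i = 0 := by
  simp [relGrad]

theorem relGrad_add (hΘ : IsParameterSet Θ) (hθ : θ ∈ Θ) (hf : DifferentiableOn ℝ f Θ)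
    (hg : DifferentiableOn ℝ g Θ) (i : Fin p) :
    relGrad Θ (fun θ => f θ + g θ) θ i = relGrad Θ f θ i + relGrad Θ g θ i := by
  simp only [relGrad]
  rw [fderivWithin_fun_add (hΘ.uniqueDiffWithinAt hθ) (hf θ hθ) (hg θ hθ)]; rfl

theorem relGrad_sub (hΘ : IsParameterSet Θ) (hθ : θ ∈ Θ) (hf : DifferentiableOn ℝ f Θ)
    (hg : DifferentiableOn ℝ g Θ) (i : Fin p) :
    relGrad Θ (fun θ => f θ - g θ) θ i = relGrad Θ f θ i - relGrad Θ g θ i := by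
  simp only [relGrad]
  rw [fderivWithin_fun_sub (hΘ.uniqueDiffWithinAt hθ) (hf θ hθ) (hg θ hθ)]; rfl

theorem relGrad_mul (hΘ : IsParameterSet Θ) (hθ : θ ∈ Θ) (hf : DifferentiableOn ℝ f Θ)
    (hg : DifferentiableOn ℝ g Θ) (i : Fin p) :
    relGrad Θ (fun θ => f θ * g θ) θ i = f θ * relGrad Θ g θ i + relGrad Θ f θ i * g θ := by
  simp only [relGrad]
  rw [fderivWithin_fun_mul (hΘ.uniqueDiffWithinAt hθ) (hf θ hθ) (hg θ hθ)]
  simp [mul_comm]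

theorem relGrad_comp (hΘ : IsParameterSet Θ) (hθ : θ ∈ Θ) (hf : DifferentiableOn ℝ f Θ)
    {φ : ℝ → ℝ} {φ' : ℝ} (hφ : HasDerivAt φ φ' (f θ)) (i : Fin p) :
    relGrad Θ (fun θ => φ (f θ)) θ i = φ' * relGrad Θ f θ i := by
  have := hφ.comp_hasFDerivWithinAt θ (hf θ hθ).hasFDerivWithinAt
  simp only [relGrad]
  rw [show (fun θ => φ (f θ)) = φ ∘ f from rfl, this.fderivWithin (hΘ.uniqueDiffWithinAt hθ)]
  simp

theorem relGrad_sum (hΘ : IsParameterSet Θ) (hθ : θ ∈ Θ) {ι : Type*} (s : Finset ι)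
    {f : ι → (Fin p → ℝ) → ℝ} (hf : ∀ k ∈ s, DifferentiableOn ℝ (f k) Θ) (i : Fin p) :
    relGrad Θ (fun θ => ∑ k ∈ s, f k θ) θ i = ∑ k ∈ s, relGrad Θ (f k) θ i := by
  simp only [relGrad]
  rw [fderivWithin_fun_sum (hΘ.uniqueDiffWithinAt hθ) fun k hk => hf k hk θ hθ]
  simp

/-- The mean value inequality on the convex piece of `Θ` around `θ`. The radius is chosen before the
function, so it serves all integrands and all members of a sequence at once. The factor `p` compares
the operator norm for the maximum norm with the largest partial derivative. -/
theorem IsParameterSet.exists_lipschitz (hΘ : IsParameterSet Θ) (hθ : θ ∈ Θ) :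
    ∃ r > 0, ∀ (f : (Fin p → ℝ) → ℝ) (A : ℝ), DifferentiableOn ℝ f Θ →
      (∀ θ ∈ Θ, ∀ i, |relGrad Θ f θ i| ≤ A) →
      ∀ θ' ∈ Θ, θ' ∈ Metric.ball θ r → |f θ' - f θ| ≤ p * A * ‖θ' - θ‖ := by
  obtain ⟨r, hr, hc, -⟩ := hΘ θ hθ
  refine ⟨r, hr, fun f A hf hA θ' hθ' hr' => ?_⟩
  exact hc.norm_image_sub_le_of_norm_hasFDerivWithin_le (f := f)
    (f' := fun η => fderivWithin ℝ f Θ η)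
    (fun η hη => (hf η hη.1).hasFDerivWithinAt.mono Set.inter_subset_left)
    (fun η hη => norm_fderivWithin_le_of_relGrad (hA η hη.1))
    ⟨hθ, Metric.mem_ball_self hr⟩ ⟨hθ', hr'⟩

/-- Derivatives in directions pointing from `θ` to other points of the convex piece are limits of
difference quotients inside `Θ`, hence measurable. These directions span the space because the
convex piece has interior points. -/
theorem measurable_relGrad {Z : Type*} [MeasurableSpace Z] (hΘ : IsParameterSet Θ) (hθ : θ ∈ Θ)
    {f : (Fin p → ℝ) → Z → ℝ} (hm : ∀ θ ∈ Θ, Measurable (f θ))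
    (hd : ∀ z, DifferentiableOn ℝ (fun θ => f θ z) Θ) (i : Fin p) :
    Measurable fun z => relGrad Θ (fun θ => f θ z) θ i := by
  obtain ⟨r, hr, hc, c, hi⟩ := hΘ θ hθ
  have key : ∀ a ∈ Θ ∩ Metric.ball θ r,
      Measurable fun z => fderivWithin ℝ (fun θ => f θ z) Θ θ (a - θ) := by
    intro a ha
    have hmem : ∀ n : ℕ, θ + ((n : ℝ) + 1)⁻¹ • (a - θ) ∈ Θ := by
      intro n
      have h1 : ((n : ℝ) + 1)⁻¹ ≤ 1 := inv_le_one_of_one_le₀ (by linarith [n.cast_nonneg (α := ℝ)])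
      exact (hc.add_smul_sub_mem ⟨hθ, Metric.mem_ball_self hr⟩ ha ⟨by positivity, h1⟩).1
    refine measurable_of_tendsto_metrizable (f := fun (n : ℕ) z =>
      ((n : ℝ) + 1) • (f (θ + ((n : ℝ) + 1)⁻¹ • (a - θ)) z - f θ z)) (fun n => ?_) ?_
    · simp only [smul_eq_mul]
      exact ((hm _ (hmem n)).sub (hm _ hθ)).const_mul _
    · rw [tendsto_pi_nhds]
      intro z
      refine HasFDerivWithinAt.lim (hd z θ hθ).hasFDerivWithinAt
        (l := atTop) (c := fun n : ℕ => (n : ℝ) + 1) (d := fun n : ℕ => ((n : ℝ) + 1)⁻¹ • (a - θ))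
        ?_ (Eventually.of_forall hmem) ?_
      · have := (tendsto_one_div_add_atTop_nhds_zero_nat (𝕜 := ℝ)).smul_const (a - θ)
        simpa only [one_div, zero_smul] using this
      · refine tendsto_const_nhds.congr fun n => ?_
        rw [smul_smul, mul_inv_cancel₀ (by positivity), one_smul]
  -- A coordinate direction need not point into `Θ` from `θ`. It is the rescaled difference of the
  -- admissible directions towards `c + s • e_i` and towards the interior point `c`.
  have hci := interior_subset hi
  have hnhds : ∀ᶠ s : ℝ in 𝓝 0, c + s • (Pi.single i 1 : Fin p → ℝ) ∈ Θ ∩ Metric.ball θ r := by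
    have : Tendsto (fun s : ℝ => c + s • (Pi.single i 1 : Fin p → ℝ)) (𝓝 0) (𝓝 c) := by
      have h : Continuous fun s : ℝ => c + s • (Pi.single i 1 : Fin p → ℝ) := by fun_prop
      simpa using h.tendsto 0
    exact this (mem_interior_iff_mem_nhds.1 hi)
  obtain ⟨s, hs, hs0⟩ := ((hnhds.filter_mono nhdsWithin_le_nhds).and
    (self_mem_nhdsWithin : ∀ᶠ s : ℝ in 𝓝[>] 0, s ∈ Set.Ioi (0 : ℝ))).exists
  have hs0' : s ≠ 0 := ne_of_gt hs0
  have heq : (fun z => relGrad Θ (fun θ => f θ z) θ i) = fun z =>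
      s⁻¹ * (fderivWithin ℝ (fun θ => f θ z) Θ θ (c + s • (Pi.single i 1 : Fin p → ℝ) - θ) -
        fderivWithin ℝ (fun θ => f θ z) Θ θ (c - θ)) := by
    ext z
    rw [← map_sub, relGrad]
    have : c + s • (Pi.single i 1 : Fin p → ℝ) - θ - (c - θ) = s • (Pi.single i 1 : Fin p → ℝ) := by
      abel
    rw [this, map_smul, smul_eq_mul, inv_mul_cancel_left₀ hs0']
  rw [heq]
  exact ((key _ hs).sub (key _ hci)).const_mul _

/-- The linear functional on `Fin p → ℝ` with the given coefficients. -/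
def coordFunctional (a : Fin p → ℝ) : (Fin p → ℝ) →L[ℝ] ℝ :=
  ∑ i, a i • ContinuousLinearMap.proj i

theorem coordFunctional_apply (a v : Fin p → ℝ) : coordFunctional a v = ∑ i, v i * a i := by
  simp [coordFunctional, mul_comm]

theorem abs_coordFunctional_le {a : Fin p → ℝ} {A : ℝ} (h : ∀ i, |a i| ≤ A) (v : Fin p → ℝ) :
    |coordFunctional a v| ≤ p * A * ‖v‖ := by
  rw [coordFunctional_apply]
  calc |∑ i, v i * a i| ≤ ∑ i, |v i * a i| := Finset.abs_sum_le_sum_abs _ _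
    _ ≤ ∑ _i : Fin p, ‖v‖ * A := by
        refine Finset.sum_le_sum fun i _ => ?_
        rw [abs_mul]
        exact mul_le_mul (norm_le_pi_norm v i) (h i) (abs_nonneg _) (norm_nonneg _)
    _ = p * A * ‖v‖ := by simp; ring

theorem relGrad_of_hasFDerivWithinAt (hΘ : IsParameterSet Θ) (hθ : θ ∈ Θ) {a : Fin p → ℝ}
    (h : HasFDerivWithinAt f (coordFunctional a) Θ θ) (i : Fin p) : relGrad Θ f θ i = a i := by
  simp only [relGrad]
  rw [h.fderivWithin (hΘ.uniqueDiffWithinAt hθ), coordFunctional_apply]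
  simp [Pi.single_apply]

theorem fderivWithin_eq_coordFunctional (f : (Fin p → ℝ) → ℝ) (θ : Fin p → ℝ) :
    fderivWithin ℝ f Θ θ = coordFunctional (relGrad Θ f θ) := by
  ext v
  rw [fderivWithin_eq_sum_relGrad, coordFunctional_apply]

/-- A function is differentiable along `Θ` if it is a limit of differentiable functions whose
gradients converge uniformly on `Θ`. -/
theorem hasFDerivWithinAt_of_uniform_limit (hΘ : IsParameterSet Θ)
    {F : ℕ → (Fin p → ℝ) → ℝ} {b : ℕ → ℝ} (hb : Tendsto b atTop (𝓝 0))
    (hF : ∀ n, DifferentiableOn ℝ (F n) Θ)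
    (hlim : ∀ θ ∈ Θ, Tendsto (fun n => F n θ) atTop (𝓝 (f θ)))
    {a : (Fin p → ℝ) → Fin p → ℝ}
    (ha : ∀ θ ∈ Θ, ∀ i, ∀ n, |relGrad Θ (F n) θ i - a θ i| ≤ b n) (hθ : θ ∈ Θ) :
    HasFDerivWithinAt f (coordFunctional (a θ)) Θ θ := by
  obtain ⟨r, hr, hL⟩ := hΘ.exists_lipschitz hθ
  -- The gradient of `F n - F m` is at most `b n + b m`. Apply the mean value bound and let `m` tend
  -- to infinity.
  have hdiff : ∀ n, ∀ θ' ∈ Θ, θ' ∈ Metric.ball θ r →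
      |(F n θ' - f θ') - (F n θ - f θ)| ≤ p * b n * ‖θ' - θ‖ := by
    intro n θ' hθ' hr'
    have h1 : ∀ m, |(F n θ' - F m θ') - (F n θ - F m θ)| ≤ p * (b n + b m) * ‖θ' - θ‖ := by
      intro m
      refine hL (fun θ => F n θ - F m θ) (b n + b m) ((hF n).sub (hF m)) ?_ θ' hθ' hr'
      intro η hη i
      rw [relGrad_sub hΘ hη (hF n) (hF m)]
      calc _ = |(relGrad Θ (F n) η i - a η i) - (relGrad Θ (F m) η i - a η i)| := by congr 1; ring
        _ ≤ _ := (abs_sub _ _).trans (add_le_add (ha η hη i n) (ha η hη i m))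
    refine le_of_tendsto_of_tendsto (b := atTop) (f := fun m =>
      |(F n θ' - F m θ') - (F n θ - F m θ)|) (g := fun m => p * (b n + b m) * ‖θ' - θ‖) ?_ ?_
      (Eventually.of_forall h1)
    · exact ((tendsto_const_nhds.sub (hlim θ' hθ')).sub
        (tendsto_const_nhds.sub (hlim θ hθ))).abs
    · have := ((tendsto_const_nhds (x := b n)).add hb).const_mul (p : ℝ)
      simpa using this.mul_const ‖θ' - θ‖
  rw [hasFDerivWithinAt_iff_isLittleO, Asymptotics.isLittleO_iff]
  intro c hc
  -- The remainder of `f` is split into the increment of `F n - f`, the remainder of `F n`, and the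
  -- linear part of the gradient error. For this `n` each costs at most a third of `c`.
  have hpb : Tendsto (fun n => (p : ℝ) * b n) atTop (𝓝 0) := by simpa using hb.const_mul (p : ℝ)
  obtain ⟨n, hn⟩ := (hpb.eventually (gt_mem_nhds (show (0 : ℝ) < c / 3 by positivity))).exists
  have hFn := (hF n θ hθ).hasFDerivWithinAt
  rw [hasFDerivWithinAt_iff_isLittleO, Asymptotics.isLittleO_iff] at hFn
  have hball : ∀ᶠ θ' in 𝓝[Θ] θ, θ' ∈ Metric.ball θ r :=
    nhdsWithin_le_nhds (Metric.ball_mem_nhds θ hr)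
  filter_upwards [hFn (show (0 : ℝ) < c / 3 by positivity), hball, self_mem_nhdsWithin]
    with θ' h1 h2 h3
  have h4 := hdiff n θ' h3 h2
  have h5 : |fderivWithin ℝ (F n) Θ θ (θ' - θ) - coordFunctional (a θ) (θ' - θ)| ≤
      p * b n * ‖θ' - θ‖ := by
    rw [fderivWithin_eq_coordFunctional, coordFunctional_apply, coordFunctional_apply,
      ← Finset.sum_sub_distrib]
    have := abs_coordFunctional_le (a := fun i => relGrad Θ (F n) θ i - a θ i)
      (fun i => ha θ hθ i n) (θ' - θ)
    rw [coordFunctional_apply] at this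
    simpa only [mul_sub] using this
  have h6 : p * b n * ‖θ' - θ‖ ≤ c / 3 * ‖θ' - θ‖ :=
    mul_le_mul_of_nonneg_right hn.le (norm_nonneg _)
  rw [Real.norm_eq_abs] at h1 ⊢
  rw [abs_le] at *
  constructor <;> linarith [h1.1, h1.2, h4.1, h4.2, h5.1, h5.2]

end Calculus

/-! ### Uniformly bounded differentiable families and their stability properties. -/

section Families

variable {p : ℕ} {Z W : Type*} [MeasurableSpace Z] [MeasurableSpace W]

/-- The `i`-th partial derivative in the parameter of a family of functions. -/
def famGrad (Θ : Set (Fin p → ℝ)) (i : Fin p) (f : (Fin p → ℝ) → Z → ℝ) :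
    (Fin p → ℝ) → Z → ℝ :=
  fun θ z => relGrad Θ (fun θ => f θ z) θ i

/-- A family of measurable functions, differentiable in the parameter, such that values and partial
derivatives are bounded by `A`. -/
structure C1Family (Θ : Set (Fin p → ℝ)) (A : ℝ) (f : (Fin p → ℝ) → Z → ℝ) : Prop where
  measurable : ∀ θ ∈ Θ, Measurable (f θ)
  diff : ∀ z, DifferentiableOn ℝ (fun θ => f θ z) Θ
  bound : ∀ θ ∈ Θ, ∀ z, |f θ z| ≤ A
  grad : ∀ θ ∈ Θ, ∀ z i, |famGrad Θ i f θ z| ≤ A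

variable {Θ : Set (Fin p → ℝ)} {A B : ℝ} {f g : (Fin p → ℝ) → Z → ℝ}

namespace C1Family

theorem mono (h : C1Family Θ A f) (hAB : A ≤ B) : C1Family Θ B f :=
  ⟨h.measurable, h.diff, fun θ hθ z => (h.bound θ hθ z).trans hAB,
    fun θ hθ z i => (h.grad θ hθ z i).trans hAB⟩

theorem congr (h : C1Family Θ A f) (hfg : ∀ θ ∈ Θ, ∀ z, f θ z = g θ z) : C1Family Θ A g := by
  refine ⟨fun θ hθ => ?_, fun z => ?_, fun θ hθ z => ?_, fun θ hθ z i => ?_⟩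
  · rw [← funext (hfg θ hθ)]; exact h.measurable θ hθ
  · exact (h.diff z).congr fun θ hθ => (hfg θ hθ z).symm
  · rw [← hfg θ hθ]; exact h.bound θ hθ z
  · have := h.grad θ hθ z i
    simp only [famGrad] at this ⊢
    rwa [← relGrad_congr (fun θ hθ => hfg θ hθ z) hθ]

theorem const {h : Z → ℝ} (hm : Measurable h) (hA : ∀ z, |h z| ≤ A) :
    C1Family Θ A (fun _ z => h z) :=
  ⟨fun _ _ => hm, fun _ => differentiableOn_const _, fun _ _ z => hA z, fun θ _ z i => by
    simp only [famGrad, relGrad_const, abs_zero]; exact (abs_nonneg _).trans (hA z)⟩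

theorem comp (h : C1Family Θ A f) {ζ : W → Z} (hζ : Measurable ζ) :
    C1Family Θ A (fun θ w => f θ (ζ w)) :=
  ⟨fun θ hθ => (h.measurable θ hθ).comp hζ, fun w => h.diff (ζ w), fun θ hθ w => h.bound θ hθ (ζ w),
    fun θ hθ w i => h.grad θ hθ (ζ w) i⟩

theorem measurable_famGrad (h : C1Family Θ A f) (hΘ : IsParameterSet Θ) {θ : Fin p → ℝ}
    (hθ : θ ∈ Θ) (i : Fin p) : Measurable (famGrad Θ i f θ) :=
  measurable_relGrad hΘ hθ h.measurable h.diff i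

theorem famGrad_add (hf : C1Family Θ A f) (hg : C1Family Θ B g) (hΘ : IsParameterSet Θ)
    {θ : Fin p → ℝ} (hθ : θ ∈ Θ) (z : Z) (i : Fin p) :
    famGrad Θ i (fun θ z => f θ z + g θ z) θ z = famGrad Θ i f θ z + famGrad Θ i g θ z :=
  relGrad_add hΘ hθ (hf.diff z) (hg.diff z) i

theorem famGrad_sub (hf : C1Family Θ A f) (hg : C1Family Θ B g) (hΘ : IsParameterSet Θ)
    {θ : Fin p → ℝ} (hθ : θ ∈ Θ) (z : Z) (i : Fin p) :
    famGrad Θ i (fun θ z => f θ z - g θ z) θ z = famGrad Θ i f θ z - famGrad Θ i g θ z :=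
  relGrad_sub hΘ hθ (hf.diff z) (hg.diff z) i

theorem famGrad_mul (hf : C1Family Θ A f) (hg : C1Family Θ B g) (hΘ : IsParameterSet Θ)
    {θ : Fin p → ℝ} (hθ : θ ∈ Θ) (z : Z) (i : Fin p) :
    famGrad Θ i (fun θ z => f θ z * g θ z) θ z =
      f θ z * famGrad Θ i g θ z + famGrad Θ i f θ z * g θ z :=
  relGrad_mul hΘ hθ (hf.diff z) (hg.diff z) i

theorem add (hf : C1Family Θ A f) (hg : C1Family Θ B g) (hΘ : IsParameterSet Θ) :
    C1Family Θ (A + B) (fun θ z => f θ z + g θ z) :=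
  ⟨fun θ hθ => (hf.measurable θ hθ).add (hg.measurable θ hθ), fun z => (hf.diff z).add (hg.diff z),
    fun θ hθ z => (abs_add_le _ _).trans (add_le_add (hf.bound θ hθ z) (hg.bound θ hθ z)),
    fun θ hθ z i => by
      rw [hf.famGrad_add hg hΘ hθ]
      exact (abs_add_le _ _).trans (add_le_add (hf.grad θ hθ z i) (hg.grad θ hθ z i))⟩

theorem sub (hf : C1Family Θ A f) (hg : C1Family Θ B g) (hΘ : IsParameterSet Θ) :
    C1Family Θ (A + B) (fun θ z => f θ z - g θ z) :=
  ⟨fun θ hθ => (hf.measurable θ hθ).sub (hg.measurable θ hθ), fun z => (hf.diff z).sub (hg.diff z),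
    fun θ hθ z => (abs_sub _ _).trans (add_le_add (hf.bound θ hθ z) (hg.bound θ hθ z)),
    fun θ hθ z i => by
      rw [hf.famGrad_sub hg hΘ hθ]
      exact (abs_sub _ _).trans (add_le_add (hf.grad θ hθ z i) (hg.grad θ hθ z i))⟩

theorem mul (hf : C1Family Θ A f) (hg : C1Family Θ B g) (hΘ : IsParameterSet Θ) :
    C1Family Θ (2 * (A * B)) (fun θ z => f θ z * g θ z) := by
  refine ⟨fun θ hθ => (hf.measurable θ hθ).mul (hg.measurable θ hθ),
    fun z => (hf.diff z).mul (hg.diff z), fun θ hθ z => ?_, fun θ hθ z i => ?_⟩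
  · have hA := hf.bound θ hθ z
    have hB := hg.bound θ hθ z
    have h0 := mul_le_mul hA hB (abs_nonneg _) ((abs_nonneg _).trans hA)
    rw [abs_mul]
    nlinarith [mul_nonneg ((abs_nonneg _).trans hA) ((abs_nonneg _).trans hB)]
  · rw [hf.famGrad_mul hg hΘ hθ]
    have hA := hf.bound θ hθ z
    have hB := hg.bound θ hθ z
    have h0 := mul_le_mul hA (hg.grad θ hθ z i) (abs_nonneg _) ((abs_nonneg _).trans hA)
    have h1 := mul_le_mul (hf.grad θ hθ z i) hB (abs_nonneg _) ((abs_nonneg _).trans hA)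
    refine (abs_add_le _ _).trans ?_
    rw [abs_mul, abs_mul]
    linarith

theorem sum (hΘ : IsParameterSet Θ) {ι : Type*} (s : Finset ι) {f : ι → (Fin p → ℝ) → Z → ℝ}
    (hf : ∀ k ∈ s, C1Family Θ A (f k)) : C1Family Θ (s.card * A) (fun θ z => ∑ k ∈ s, f k θ z) := by
  refine ⟨fun θ hθ => Finset.measurable_sum _ fun k hk => (hf k hk).measurable θ hθ,
    fun z => DifferentiableOn.fun_sum fun k hk => (hf k hk).diff z, fun θ hθ z => ?_,
    fun θ hθ z i => ?_⟩
  · refine (Finset.abs_sum_le_sum_abs _ _).trans ?_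
    simpa using Finset.sum_le_card_nsmul s _ A fun k hk => (hf k hk).bound θ hθ z
  · have : famGrad Θ i (fun θ z => ∑ k ∈ s, f k θ z) θ z = ∑ k ∈ s, famGrad Θ i (f k) θ z :=
      relGrad_sum hΘ hθ s (fun k hk => (hf k hk).diff z) i
    rw [this]
    refine (Finset.abs_sum_le_sum_abs _ _).trans ?_
    simpa using Finset.sum_le_card_nsmul s _ A fun k hk => (hf k hk).grad θ hθ z i

theorem famGrad_inv (hf : C1Family Θ A f) (hΘ : IsParameterSet Θ) {a : ℝ} (ha : 0 < a)
    (hfa : ∀ θ ∈ Θ, ∀ z, a ≤ f θ z) {θ : Fin p → ℝ} (hθ : θ ∈ Θ) (z : Z) (i : Fin p) :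
    famGrad Θ i (fun θ z => (f θ z)⁻¹) θ z = -famGrad Θ i f θ z / f θ z ^ 2 := by
  have := relGrad_comp hΘ hθ (hf.diff z) (hasDerivAt_inv (ha.trans_le (hfa θ hθ z)).ne') i
  simp only [famGrad]
  rw [this]; ring

theorem inv (hf : C1Family Θ A f) (hΘ : IsParameterSet Θ) {a : ℝ} (ha : 0 < a)
    (hfa : ∀ θ ∈ Θ, ∀ z, a ≤ f θ z) : C1Family Θ (a⁻¹ + A / a ^ 2) (fun θ z => (f θ z)⁻¹) := by
  refine ⟨fun θ hθ => (hf.measurable θ hθ).inv,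
    fun z => (hf.diff z).fun_inv fun θ hθ => (ha.trans_le (hfa θ hθ z)).ne', fun θ hθ z => ?_,
    fun θ hθ z i => ?_⟩
  · have h1 : 0 < f θ z := ha.trans_le (hfa θ hθ z)
    rw [abs_of_pos (inv_pos.2 h1)]
    have hA : 0 ≤ A := (abs_nonneg _).trans (hf.bound θ hθ z)
    have := inv_anti₀ ha (hfa θ hθ z)
    have : 0 ≤ A / a ^ 2 := by positivity
    linarith
  · have h1 : 0 < f θ z := ha.trans_le (hfa θ hθ z)
    have hA : 0 ≤ A := (abs_nonneg _).trans (hf.bound θ hθ z)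
    rw [hf.famGrad_inv hΘ ha hfa hθ, abs_div, abs_neg, abs_of_pos (pow_pos h1 2)]
    have : |famGrad Θ i f θ z| / f θ z ^ 2 ≤ A / a ^ 2 :=
      div_le_div₀ hA (hf.grad θ hθ z i) (by positivity)
        (pow_le_pow_left₀ ha.le (hfa θ hθ z) 2)
    have : 0 ≤ a⁻¹ := by positivity
    linarith

theorem famGrad_log (hf : C1Family Θ A f) (hΘ : IsParameterSet Θ) {a : ℝ} (ha : 0 < a)
    (hfa : ∀ θ ∈ Θ, ∀ z, a ≤ f θ z) {θ : Fin p → ℝ} (hθ : θ ∈ Θ) (z : Z) (i : Fin p) :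
    famGrad Θ i (fun θ z => Real.log (f θ z)) θ z = (f θ z)⁻¹ * famGrad Θ i f θ z :=
  relGrad_comp hΘ hθ (hf.diff z) (Real.hasDerivAt_log (ha.trans_le (hfa θ hθ z)).ne') i

theorem log (hf : C1Family Θ A f) (hΘ : IsParameterSet Θ) {a : ℝ} (ha : 0 < a)
    (hfa : ∀ θ ∈ Θ, ∀ z, a ≤ f θ z) :
    C1Family Θ (|Real.log a| + |Real.log A| + A / a) (fun θ z => Real.log (f θ z)) := by
  refine ⟨fun θ hθ => (hf.measurable θ hθ).log,
    fun z => (hf.diff z).log fun θ hθ => (ha.trans_le (hfa θ hθ z)).ne', fun θ hθ z => ?_,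
    fun θ hθ z i => ?_⟩
  · have h1 : 0 < f θ z := ha.trans_le (hfa θ hθ z)
    have hA : 0 ≤ A := (abs_nonneg _).trans (hf.bound θ hθ z)
    have h2 := Real.log_le_log ha (hfa θ hθ z)
    have h3 := Real.log_le_log h1 ((le_abs_self _).trans (hf.bound θ hθ z))
    have : 0 ≤ A / a := by positivity
    rw [abs_le]
    constructor
    · linarith [neg_abs_le (Real.log a), abs_nonneg (Real.log A)]
    · linarith [le_abs_self (Real.log A), abs_nonneg (Real.log a)]
  · have h1 : 0 < f θ z := ha.trans_le (hfa θ hθ z)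
    have hA : 0 ≤ A := (abs_nonneg _).trans (hf.bound θ hθ z)
    rw [hf.famGrad_log hΘ ha hfa hθ, abs_mul, abs_of_pos (inv_pos.2 h1), inv_mul_eq_div]
    have : |famGrad Θ i f θ z| / f θ z ≤ A / a :=
      div_le_div₀ hA (hf.grad θ hθ z i) ha (hfa θ hθ z)
    linarith [abs_nonneg (Real.log a), abs_nonneg (Real.log A)]

theorem integrable (hf : C1Family Θ A f) {θ : Fin p → ℝ} (hθ : θ ∈ Θ) (μ : Measure Z)
    [IsFiniteMeasure μ] : Integrable (f θ) μ :=
  .of_bound (hf.measurable θ hθ).aestronglyMeasurable A (.of_forall fun z => hf.bound θ hθ z)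

theorem integrable_famGrad (hf : C1Family Θ A f) (hΘ : IsParameterSet Θ) {θ : Fin p → ℝ}
    (hθ : θ ∈ Θ) (μ : Measure Z) [IsFiniteMeasure μ] (i : Fin p) :
    Integrable (famGrad Θ i f θ) μ :=
  .of_bound (hf.measurable_famGrad hΘ hθ i).aestronglyMeasurable A
    (.of_forall fun z => hf.grad θ hθ z i)

/-- Differentiation under the integral sign: the mean value bound dominates the difference
quotients, uniformly in the integration variable. -/
theorem hasFDerivWithinAt_integral (hf : C1Family Θ A f) (hΘ : IsParameterSet Θ)
    {θ : Fin p → ℝ} (hθ : θ ∈ Θ) (μ : Measure Z) [IsFiniteMeasure μ] :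
    HasFDerivWithinAt (fun θ => ∫ z, f θ z ∂μ)
      (coordFunctional fun i => ∫ z, famGrad Θ i f θ z ∂μ) Θ θ := by
  obtain ⟨r, hr, hL⟩ := hΘ.exists_lipschitz hθ
  have hint : ∀ v : Fin p → ℝ, Integrable (fun z => coordFunctional (relGrad Θ (fun θ => f θ z) θ) v) μ ∧
      coordFunctional (fun i => ∫ z, famGrad Θ i f θ z ∂μ) v =
        ∫ z, coordFunctional (relGrad Θ (fun θ => f θ z) θ) v ∂μ := by
    intro v
    simp only [coordFunctional_apply]
    have : ∀ i ∈ Finset.univ, Integrable (fun z => v i * relGrad Θ (fun θ => f θ z) θ i) μ :=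
      fun i _ => (hf.integrable_famGrad hΘ hθ μ i).const_mul _
    refine ⟨integrable_finsetSum _ this, ?_⟩
    rw [integral_finsetSum _ this]
    exact Finset.sum_congr rfl fun i _ => (integral_const_mul _ _).symm
  rw [hasFDerivWithinAt_iff_tendsto]
  set q : (Fin p → ℝ) → Z → ℝ := fun θ' z =>
    ‖θ' - θ‖⁻¹ * ‖f θ' z - f θ z - coordFunctional (relGrad Θ (fun θ => f θ z) θ) (θ' - θ)‖ with hq
  have hball : ∀ᶠ θ' in 𝓝[Θ] θ, θ' ∈ Metric.ball θ r :=
    nhdsWithin_le_nhds (Metric.ball_mem_nhds θ hr)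
  -- The dominating constant has one `p * A` for the increment of the integrand and one for its
  -- linear part.
  have hqint : Tendsto (fun θ' => ∫ z, q θ' z ∂μ) (𝓝[Θ] θ) (𝓝 (∫ _z, (0 : ℝ) ∂μ)) := by
    refine tendsto_integral_filter_of_dominated_convergence (fun _ => p * A + p * A) ?_ ?_
      (integrable_const _) ?_
    · filter_upwards [self_mem_nhdsWithin] with θ' hθ'
      exact ((((hf.integrable hθ' μ).sub (hf.integrable hθ μ)).sub (hint _).1).norm.const_mul _).1
    · filter_upwards [self_mem_nhdsWithin, hball] with θ' hθ' hb
      refine .of_forall fun z => ?_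
      have h1 := hL (fun θ => f θ z) A (hf.diff z) (fun θ hθ i => hf.grad θ hθ z i) θ' hθ' hb
      have h2 := abs_coordFunctional_le (a := relGrad Θ (fun θ => f θ z) θ)
        (fun i => hf.grad θ hθ z i) (θ' - θ)
      have h3 : ‖f θ' z - f θ z - coordFunctional (relGrad Θ (fun θ => f θ z) θ) (θ' - θ)‖ ≤
          (p * A + p * A) * ‖θ' - θ‖ := by
        refine (norm_sub_le _ _).trans ?_
        rw [Real.norm_eq_abs, Real.norm_eq_abs]; linarith
      simp only [hq]
      rw [norm_mul, norm_inv, norm_norm, norm_norm]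
      -- At `θ' = θ` the inverse norm is zero by convention and only nonnegativity of the bound is
      -- needed. It follows from any partial derivative, and for `p = 0` the bound vanishes.
      rcases (norm_nonneg (θ' - θ)).eq_or_lt with h0 | h0
      · rw [← h0] at h3 ⊢
        simp only [inv_zero, zero_mul]
        rcases p.eq_zero_or_pos with hp | hp
        · subst hp; simp
        · have : 0 ≤ A := (abs_nonneg _).trans (hf.grad θ hθ z ⟨0, hp⟩)
          positivity
      · rw [inv_mul_le_iff₀ h0]; linarith
    · refine .of_forall fun z => ?_
      have := hasFDerivWithinAt_iff_tendsto.1 (hf.diff z θ hθ).hasFDerivWithinAt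
      simpa only [fderivWithin_eq_coordFunctional] using this
  rw [integral_zero] at hqint
  refine squeeze_zero' (.of_forall fun _ => by positivity) ?_ hqint
  filter_upwards [self_mem_nhdsWithin] with θ' hθ'
  rw [(hint _).2, ← integral_sub (hf.integrable hθ' μ) (hf.integrable hθ μ),
    ← integral_sub (f := fun z => f θ' z - f θ z)
      ((hf.integrable hθ' μ).sub (hf.integrable hθ μ)) (hint _).1]
  simp only [hq]
  rw [integral_const_mul]
  exact mul_le_mul_of_nonneg_left (norm_integral_le_integral_norm _) (by positivity)

theorem famGrad_integral {f : (Fin p → ℝ) → Z × W → ℝ} (hf : C1Family Θ A f)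
    (hΘ : IsParameterSet Θ) {θ : Fin p → ℝ} (hθ : θ ∈ Θ) (μ : Measure Z) [IsFiniteMeasure μ]
    (w : W) (i : Fin p) :
    famGrad Θ i (fun θ w => ∫ z, f θ (z, w) ∂μ) θ w = ∫ z, famGrad Θ i f θ (z, w) ∂μ :=
  relGrad_of_hasFDerivWithinAt hΘ hθ
    ((hf.comp (measurable_id.prodMk measurable_const : Measurable fun z => (z, w))).hasFDerivWithinAt_integral
      hΘ hθ μ) i

theorem integral {f : (Fin p → ℝ) → Z × W → ℝ} (hf : C1Family Θ A f)
    (hΘ : IsParameterSet Θ) (μ : Measure Z) [IsFiniteMeasure μ] :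
    C1Family Θ (A * μ.real Set.univ) (fun θ w => ∫ z, f θ (z, w) ∂μ) := by
  refine ⟨fun θ hθ => ?_, fun w => fun θ hθ => ?_, fun θ hθ w => ?_, fun θ hθ w i => ?_⟩
  · exact ((hf.measurable θ hθ).stronglyMeasurable.integral_prod_left').measurable
  · exact ((hf.comp (measurable_id.prodMk measurable_const :
      Measurable fun z => (z, w))).hasFDerivWithinAt_integral hΘ hθ μ).differentiableWithinAt
  · exact norm_integral_le_of_norm_le_const (f := fun z => f θ (z, w)) (C := A)
      (.of_forall fun z => hf.bound θ hθ (z, w))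
  · rw [hf.famGrad_integral hΘ hθ]
    exact norm_integral_le_of_norm_le_const (f := fun z => famGrad Θ i f θ (z, w)) (C := A)
      (.of_forall fun z => hf.grad θ hθ (z, w) i)

/-- Closeness of two families passes to their logarithms. -/
theorem log_sub_log {η a : ℝ} (hf : C1Family Θ A f) (hg : C1Family Θ A g) (hΘ : IsParameterSet Θ)
    (ha : 0 < a) (hfa : ∀ θ ∈ Θ, ∀ z, a ≤ f θ z) (hga : ∀ θ ∈ Θ, ∀ z, a ≤ g θ z)
    (hfg : C1Family Θ η (fun θ z => f θ z - g θ z)) :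
    C1Family Θ ((a⁻¹ + A / a ^ 2) * η) (fun θ z => Real.log (f θ z) - Real.log (g θ z)) := by
  have hlf := hf.log hΘ ha hfa
  have hlg := hg.log hΘ ha hga
  have h0 := hlf.sub hlg hΘ
  refine ⟨h0.measurable, h0.diff, fun θ hθ z => ?_, fun θ hθ z i => ?_⟩
  · have hf1 : 0 < f θ z := ha.trans_le (hfa θ hθ z)
    have hg1 : 0 < g θ z := ha.trans_le (hga θ hθ z)
    have hη := hfg.bound θ hθ z
    have hA : 0 ≤ A := (abs_nonneg _).trans (hf.bound θ hθ z)
    have hη0 : 0 ≤ η := (abs_nonneg _).trans hη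
    have key : ∀ u v : ℝ, 0 < v → a ≤ u → |u - v| ≤ η → Real.log v - Real.log u ≤ a⁻¹ * η := by
      intro u v hv hu huv
      have hu0 := ha.trans_le hu
      rw [← Real.log_div hv.ne' hu0.ne']
      refine (Real.log_le_sub_one_of_pos (by positivity)).trans ?_
      have : v / u - 1 = (v - u) / u := by field_simp
      rw [this, inv_mul_eq_div]
      calc (v - u) / u ≤ η / u := by gcongr; linarith [(abs_le.1 huv).1]
        _ ≤ η / a := by gcongr
    have h1 := key (g θ z) (f θ z) hf1 (hga θ hθ z) (by rwa [abs_sub_comm])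
    have h2 := key (f θ z) (g θ z) hg1 (hfa θ hθ z) hη
    have h3 : a⁻¹ * η ≤ (a⁻¹ + A / a ^ 2) * η := by
      have : 0 ≤ A / a ^ 2 * η := by positivity
      linarith [add_mul a⁻¹ (A / a ^ 2) η]
    rw [abs_le]; constructor <;> linarith
  · have hf1 : 0 < f θ z := ha.trans_le (hfa θ hθ z)
    have hg1 : 0 < g θ z := ha.trans_le (hga θ hθ z)
    have hA : 0 ≤ A := (abs_nonneg _).trans (hf.bound θ hθ z)
    have hη := hfg.bound θ hθ z
    have hη0 : 0 ≤ η := (abs_nonneg _).trans hη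
    rw [hlf.famGrad_sub hlg hΘ hθ, hf.famGrad_log hΘ ha hfa hθ, hg.famGrad_log hΘ ha hga hθ]
    have hg' := hfg.grad θ hθ z i
    rw [hf.famGrad_sub hg hΘ hθ] at hg'
    set Df := famGrad Θ i f θ z
    set Dg := famGrad Θ i g θ z
    have e : (f θ z)⁻¹ * Df - (g θ z)⁻¹ * Dg =
        (f θ z)⁻¹ * (Df - Dg) - Dg * (f θ z - g θ z) * ((f θ z)⁻¹ * (g θ z)⁻¹) := by
      field_simp; ring
    have hfi := inv_anti₀ ha (hfa θ hθ z)
    have hgi := inv_anti₀ ha (hga θ hθ z)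
    rw [e]
    refine (abs_sub _ _).trans ?_
    rw [abs_mul, abs_mul, abs_mul, abs_mul, abs_of_pos (inv_pos.2 hf1), abs_of_pos (inv_pos.2 hg1)]
    calc _ ≤ a⁻¹ * η + A * η * (a⁻¹ * a⁻¹) := by
          gcongr
          exact hg.grad θ hθ z i
      _ = _ := by rw [add_mul]; congr 1; field_simp

/-- Products of uniformly bounded families are bounded, and closeness of families passes to
products. -/
theorem exists_prod_bound (A : ℝ) (n : ℕ) : ∃ C : ℝ, ∀ {p : ℕ} {Θ : Set (Fin p → ℝ)} {Z : Type*}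
    [MeasurableSpace Z], IsParameterSet Θ → ∀ (f : Fin n → (Fin p → ℝ) → Z → ℝ),
    (∀ k, C1Family Θ A (f k)) → C1Family Θ C (fun θ z => ∏ k, f k θ z) := by
  induction n with
  | zero =>
    refine ⟨1, fun hΘ f hf => ?_⟩
    simpa using C1Family.const measurable_const (fun _ => by simp)
  | succ n ih =>
    obtain ⟨C, hC⟩ := ih
    refine ⟨2 * (A * C), fun hΘ f hf => ?_⟩
    simp only [Fin.prod_univ_succ]
    exact (hf 0).mul (hC hΘ (fun k => f k.succ) fun k => hf k.succ) hΘ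

theorem exists_prod_sub_prod_bound (A : ℝ) (n : ℕ) : ∃ C : ℝ, ∀ {p : ℕ} {Θ : Set (Fin p → ℝ)}
    {Z : Type*} [MeasurableSpace Z], IsParameterSet Θ → ∀ (η : ℝ)
    (f g : Fin n → (Fin p → ℝ) → Z → ℝ),
    (∀ k, C1Family Θ A (f k)) → (∀ k, C1Family Θ A (g k)) →
    (∀ k, C1Family Θ η (fun θ z => f k θ z - g k θ z)) →
    C1Family Θ (C * η) (fun θ z => ∏ k, f k θ z - ∏ k, g k θ z) := by
  induction n with
  | zero =>
    refine ⟨0, fun hΘ η f g hf hg hfg => ?_⟩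
    simpa using C1Family.const measurable_const (fun _ => by simp)
  | succ n ih =>
    obtain ⟨C, hC⟩ := ih
    obtain ⟨B, hB⟩ := exists_prod_bound A n
    refine ⟨2 * B + 2 * (A * C), fun hΘ η f g hf hg hfg => ?_⟩
    -- Telescoping: f₀∏f - g₀∏g = (f₀ - g₀)∏f + g₀(∏f - ∏g).
    have h1 := (hfg 0).mul (hB hΘ (fun k => f k.succ) fun k => hf k.succ) hΘ
    have h2 := (hg 0).mul (hC hΘ η (fun k => f k.succ) (fun k => g k.succ) (fun k => hf k.succ)
      (fun k => hg k.succ) fun k => hfg k.succ) hΘ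
    refine ((h1.add h2 hΘ).congr fun θ _ z => ?_).mono (le_of_eq ?_)
    · simp only [Fin.prod_univ_succ]; ring
    · ring

end C1Family

end Families

/-! ### Contraction of oscillations under a Doeblin minorisation. -/

section Oscillation

variable {X : Type*} [MeasurableSpace X]

/-- Removing the common part `δ * q` leaves two nonnegative weights of mass `1 - δ`. After
subtracting its infimum, `h` takes values in `[0, A]`, so one remaining integral is at most `(1 - δ)
* A` and the other is nonnegative. -/
theorem integral_sub_integral_le_of_minorized {μ : Measure X} {h k₁ k₂ q : X → ℝ} {A δ : ℝ}
    (hm : Measurable h) (hA : ∀ x x', |h x - h x'| ≤ A) (hk₁ : Integrable k₁ μ)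
    (hk₂ : Integrable k₂ μ) (hq : Integrable q μ) (h₁ : ∫ x, k₁ x ∂μ = 1) (h₂ : ∫ x, k₂ x ∂μ = 1)
    (hq1 : ∫ x, q x ∂μ = 1) (hδ₁ : ∀ x, δ * q x ≤ k₁ x) (hδ₂ : ∀ x, δ * q x ≤ k₂ x) :
    ∫ x, h x * k₁ x ∂μ - ∫ x, h x * k₂ x ∂μ ≤ (1 - δ) * A := by
  rcases isEmpty_or_nonempty X with hX | ⟨⟨x₀⟩⟩
  · simp [integral_of_isEmpty] at h₁
  have hbdd : BddBelow (Set.range h) :=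
    ⟨h x₀ - A, by rintro _ ⟨x, rfl⟩; linarith [(abs_le.1 (hA x₀ x)).2]⟩
  have : Nonempty X := ⟨x₀⟩
  set a := ⨅ x, h x with ha
  have hlow : ∀ x, a ≤ h x := fun x => ciInf_le hbdd x
  have hup : ∀ x, h x ≤ a + A := by
    intro x
    have : h x - A ≤ a := le_ciInf fun x' => by linarith [(abs_le.1 (hA x x')).2]
    linarith
  have hint : ∀ {k : X → ℝ}, Integrable k μ → Integrable (fun x => h x * k x) μ := by
    intro k hk
    refine hk.bdd_mul (c := |a| + |a + A|) hm.aestronglyMeasurable (.of_forall fun x => ?_)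
    rw [Real.norm_eq_abs, abs_le]
    constructor
    · linarith [hlow x, neg_abs_le a, abs_nonneg (a + A)]
    · linarith [hup x, le_abs_self (a + A), abs_nonneg a]
  have e : ∀ {k : X → ℝ}, Integrable k μ → ∫ x, k x ∂μ = 1 →
      ∫ x, (h x - a) * (k x - δ * q x) ∂μ =
        ∫ x, h x * k x ∂μ - a - δ * (∫ x, h x * q x ∂μ - a) := by
    intro k hk hk1
    have : (fun x => (h x - a) * (k x - δ * q x)) =
        fun x => (h x * k x - a * k x) - δ * (h x * q x - a * q x) := by ext x; ring
    rw [this, integral_sub, integral_sub (hint hk) (hk.const_mul _), integral_const_mul,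
      integral_const_mul, integral_sub (hint hq) (hq.const_mul _), integral_const_mul, hk1, hq1,
      mul_one]
    · exact (hint hk).sub (hk.const_mul _)
    · exact ((hint hq).sub (hq.const_mul _)).const_mul _
  have e₁ := e hk₁ h₁
  have e₂ := e hk₂ h₂
  have p₂ : 0 ≤ ∫ x, (h x - a) * (k₂ x - δ * q x) ∂μ :=
    integral_nonneg fun x => mul_nonneg (by linarith [hlow x]) (by linarith [hδ₂ x])
  have p₁ : ∫ x, (h x - a) * (k₁ x - δ * q x) ∂μ ≤ ∫ x, A * (k₁ x - δ * q x) ∂μ := by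
    refine integral_mono_of_nonneg (.of_forall fun x => mul_nonneg (by linarith [hlow x])
      (by linarith [hδ₁ x])) ((hk₁.sub (hq.const_mul δ)).const_mul A) (.of_forall fun x => ?_)
    exact mul_le_mul_of_nonneg_right (by linarith [hup x]) (by linarith [hδ₁ x])
  have p₃ : ∫ x, A * (k₁ x - δ * q x) ∂μ = A * (1 - δ) := by
    rw [integral_const_mul, integral_sub hk₁ (hq.const_mul _), integral_const_mul, h₁, hq1, mul_one]
  linarith

theorem abs_integral_sub_integral_le_of_minorized {μ : Measure X} {h k₁ k₂ q : X → ℝ} {A δ : ℝ}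
    (hm : Measurable h) (hA : ∀ x x', |h x - h x'| ≤ A) (hk₁ : Integrable k₁ μ)
    (hk₂ : Integrable k₂ μ) (hq : Integrable q μ) (h₁ : ∫ x, k₁ x ∂μ = 1) (h₂ : ∫ x, k₂ x ∂μ = 1)
    (hq1 : ∫ x, q x ∂μ = 1) (hδ₁ : ∀ x, δ * q x ≤ k₁ x) (hδ₂ : ∀ x, δ * q x ≤ k₂ x) :
    |∫ x, h x * k₁ x ∂μ - ∫ x, h x * k₂ x ∂μ| ≤ (1 - δ) * A :=
  abs_sub_le_iff.2 ⟨integral_sub_integral_le_of_minorized hm hA hk₁ hk₂ hq h₁ h₂ hq1 hδ₁ hδ₂,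
    integral_sub_integral_le_of_minorized hm hA hk₂ hk₁ hq h₂ h₁ hq1 hδ₂ hδ₁⟩

/-- Integrals of a function against a signed weight of total mass zero are controlled by its
oscillation. -/
theorem abs_integral_mul_le_of_integral_eq_zero {μ : Measure X} [IsFiniteMeasure μ] {h k : X → ℝ}
    {A B : ℝ} (hm : Measurable h) (hA : ∀ x x', |h x - h x'| ≤ A) (hk : Measurable k)
    (hB : ∀ x, |k x| ≤ B) (h0 : ∫ x, k x ∂μ = 0) :
    |∫ x, h x * k x ∂μ| ≤ A * B * μ.real Set.univ := by
  rcases isEmpty_or_nonempty X with hX | ⟨⟨x₀⟩⟩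
  · simp [integral_of_isEmpty, Measure.eq_zero_of_isEmpty]
  have hki : Integrable k μ := .of_bound hk.aestronglyMeasurable B (.of_forall hB)
  have hint : Integrable (fun x => (h x - h x₀) * k x) μ :=
    hki.bdd_mul (c := A) (hm.sub_const _).aestronglyMeasurable (.of_forall fun x => hA x x₀)
  have e : ∫ x, h x * k x ∂μ = ∫ x, (h x - h x₀) * k x ∂μ := by
    have : (fun x => h x * k x) = fun x => (h x - h x₀) * k x + h x₀ * k x := by ext x; ring
    rw [this, integral_add hint (hki.const_mul _), integral_const_mul, h0, mul_zero, add_zero]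
  rw [e]
  refine norm_integral_le_of_norm_le_const (f := fun x => (h x - h x₀) * k x) (.of_forall fun x => ?_)
  rw [norm_mul]
  exact mul_le_mul (hA x x₀) (hB x) (norm_nonneg _) ((abs_nonneg _).trans (hA x x₀))

end Oscillation

/-! ### Integrals of functions with values in an interval. -/

section Bounds

variable {X : Type*} [MeasurableSpace X]

theorem integral_mul_mem_of_density {μ : Measure X} {k h : X → ℝ} {a b : ℝ} (hk : Integrable k μ)
    (hk0 : ∀ x, 0 ≤ k x) (hk1 : ∫ x, k x ∂μ = 1) (hm : Measurable h) (ha : ∀ x, a ≤ h x)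
    (hb : ∀ x, h x ≤ b) : a ≤ ∫ x, h x * k x ∂μ ∧ ∫ x, h x * k x ∂μ ≤ b := by
  have hint : Integrable (fun x => h x * k x) μ := by
    refine hk.bdd_mul (c := |a| + |b|) hm.aestronglyMeasurable (.of_forall fun x => ?_)
    rw [Real.norm_eq_abs, abs_le]
    constructor
    · linarith [ha x, neg_abs_le a, abs_nonneg b]
    · linarith [hb x, le_abs_self b, abs_nonneg a]
  constructor
  · calc a = ∫ x, a * k x ∂μ := by rw [integral_const_mul, hk1, mul_one]
      _ ≤ _ := integral_mono (hk.const_mul _) hint fun x =>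
        mul_le_mul_of_nonneg_right (ha x) (hk0 x)
  · calc ∫ x, h x * k x ∂μ ≤ ∫ x, b * k x ∂μ := integral_mono hint (hk.const_mul _) fun x =>
        mul_le_mul_of_nonneg_right (hb x) (hk0 x)
      _ = b := by rw [integral_const_mul, hk1, mul_one]

theorem integral_mem_of_mem {μ : Measure X} [IsFiniteMeasure μ] {h : X → ℝ} {a b : ℝ}
    (hm : Measurable h) (ha : ∀ x, a ≤ h x) (hb : ∀ x, h x ≤ b) :
    a * μ.real Set.univ ≤ ∫ x, h x ∂μ ∧ ∫ x, h x ∂μ ≤ b * μ.real Set.univ := by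
  have hint : Integrable h μ := by
    refine .of_bound hm.aestronglyMeasurable (|a| + |b|) (.of_forall fun x => ?_)
    rw [Real.norm_eq_abs, abs_le]
    constructor
    · linarith [ha x, neg_abs_le a, abs_nonneg b]
    · linarith [hb x, le_abs_self b, abs_nonneg a]
  constructor
  · calc a * μ.real Set.univ = ∫ _x, a ∂μ := by simp [mul_comm]
      _ ≤ _ := integral_mono (integrable_const _) hint ha
  · calc ∫ x, h x ∂μ ≤ ∫ _x, b ∂μ := integral_mono hint (integrable_const _) hb
      _ = _ := by simp [mul_comm]

end Bounds

/-! ### Immediate consequences of the mixing assumptions. -/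

namespace ParamSSM

variable {p : ℕ} {X Y U W : Type*} [MeasurableSpace X] [MeasurableSpace Y] [MeasurableSpace U]
  [MeasurableSpace W] {S : ParamSSM p X Y U} {ε κ : ℝ}

namespace Assumptions

theorem c1Family_m (hS : S.Assumptions ε κ) (hε : 0 < ε) (hκ : 0 ≤ κ) :
    C1Family S.Θ (ε⁻¹ + κ) (fun θ (z : X × X) => S.m θ z.1 z.2) :=
  ⟨fun θ hθ => (hS.density_m θ hθ).measurable, fun z => hS.diff_m z.1 z.2, fun θ hθ z => by
    have := hS.bounds_m θ hθ z.1 z.2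
    rw [abs_of_pos (hε.trans_le this.1)]; linarith, fun θ hθ z i => by
    have := (norm_le_pi_norm _ i).trans (hS.grad_m θ hθ z.1 z.2)
    have h0 : 0 < ε⁻¹ := inv_pos.2 hε
    simp only [famGrad]
    rw [Real.norm_eq_abs] at this; linarith⟩

theorem c1Family_g (hS : S.Assumptions ε κ) (hε : 0 < ε) (hκ : 0 ≤ κ) :
    C1Family S.Θ (ε⁻¹ + κ) (fun θ (z : X × Y) => S.g θ z.1 z.2) :=
  ⟨fun θ hθ => (hS.density_g θ hθ).measurable, fun z => hS.diff_g z.1 z.2, fun θ hθ z => by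
    have := hS.bounds_g θ hθ z.1 z.2
    rw [abs_of_pos (hε.trans_le this.1)]; linarith, fun θ hθ z i => by
    have := (norm_le_pi_norm _ i).trans (hS.grad_g θ hθ z.1 z.2)
    have h0 : 0 < ε⁻¹ := inv_pos.2 hε
    simp only [famGrad]
    rw [Real.norm_eq_abs] at this; linarith⟩

theorem nonempty_state (hS : S.Assumptions ε κ) : Nonempty X := by
  by_contra h
  rw [not_nonempty_iff] at h
  have := hS.integral_m0
  simp [integral_of_isEmpty] at this

theorem integrable_m0 (hS : S.Assumptions ε κ) : Integrable S.m0 S.lamX := by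
  by_contra h
  have := hS.integral_m0
  rw [integral_undef h] at this
  exact zero_ne_one this

/-- A transition density with values in [ε, ε⁻¹] integrates to one, which confines the total mass.
This is what makes later constants depend on ε and κ only. -/
theorem mass_lamX (hS : S.Assumptions ε κ) (hε : 0 < ε) (hne : S.Θ.Nonempty) :
    ε ≤ S.lamX.real Set.univ ∧ S.lamX.real Set.univ ≤ ε⁻¹ := by
  obtain ⟨θ, hθ⟩ := hne
  obtain ⟨x⟩ := hS.nonempty_state
  have := hS.finite_lamX
  have hm := (hS.density_m θ hθ).measurable.comp (measurable_prodMk_left (x := x))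
  have := integral_mem_of_mem (μ := S.lamX) hm (fun x' => (hS.bounds_m θ hθ x x').1)
    (fun x' => (hS.bounds_m θ hθ x x').2)
  have h1 := (hS.density_m θ hθ).integral_eq_one x
  simp only [Function.comp_def, Function.uncurry] at this
  rw [h1] at this
  have hε' : 0 < ε⁻¹ := inv_pos.2 hε
  constructor
  · have := this.2
    calc ε = ε * 1 := by ring
      _ ≤ ε * (ε⁻¹ * S.lamX.real Set.univ) := by gcongr
      _ = _ := by field_simp
  · have := this.1
    rw [← one_div, le_div_iff₀ hε]; linarith

end Assumptions

end ParamSSM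

/-! ### Time-uniform score bounds for the filter. -/

namespace ParamSSM

variable {p : ℕ} {X Y U W : Type*} [MeasurableSpace X] [MeasurableSpace Y] [MeasurableSpace U]
  [MeasurableSpace W] {S : ParamSSM p X Y U} {ε κ : ℝ}

/-- The one-step predictive density of a family of densities `f` relative to `μ`. -/
def predDensity (S : ParamSSM p X Y U) (μ : Measure X) (f : (Fin p → ℝ) → X × W → ℝ) :
    (Fin p → ℝ) → X × W → ℝ :=
  fun θ z => ∫ x, f θ (x, z.2) * S.m θ x z.1 ∂μ

/-- The normalising constant of the filter update. -/
def updateNorm (S : ParamSSM p X Y U) (μ : Measure X) (Yo : W → Y)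
    (f : (Fin p → ℝ) → X × W → ℝ) : (Fin p → ℝ) → W → ℝ :=
  fun θ w => ∫ x, S.g θ x (Yo w) * S.predDensity μ f θ (x, w) ∂S.lamX

/-- One prediction-correction step of the filter. -/
def filterUpdate (S : ParamSSM p X Y U) (μ : Measure X) (Yo : W → Y)
    (f : (Fin p → ℝ) → X × W → ℝ) : (Fin p → ℝ) → X × W → ℝ :=
  fun θ z => S.g θ z.1 (Yo z.2) * S.predDensity μ f θ z * (S.updateNorm μ Yo f θ z.2)⁻¹

/-- A family of probability densities with uniformly bounded values and logarithmic gradients of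
uniformly bounded oscillation. -/
structure DensityFamily (S : ParamSSM p X Y U) (ε K : ℝ) (μ : Measure X)
    (f : (Fin p → ℝ) → X × W → ℝ) : Prop where
  exists_c1 : ∃ A, C1Family S.Θ A f
  lower : ∀ θ ∈ S.Θ, ∀ z, ε ^ 5 ≤ f θ z
  upper : ∀ θ ∈ S.Θ, ∀ z, f θ z ≤ ε⁻¹ ^ 5
  integral_eq_one : ∀ θ ∈ S.Θ, ∀ w, ∫ x, f θ (x, w) ∂μ = 1
  osc : ∀ θ ∈ S.Θ, ∀ w x x' i, |famGrad S.Θ i f θ (x, w) / f θ (x, w) -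
    famGrad S.Θ i f θ (x', w) / f θ (x', w)| ≤ K

theorem C1Family.predDensity (hS : S.Assumptions ε κ) (hε : 0 < ε) (hκ : 0 ≤ κ)
    {μ : Measure X} [IsFiniteMeasure μ] {A : ℝ} {f : (Fin p → ℝ) → X × W → ℝ}
    (hf : C1Family S.Θ A f) :
    C1Family S.Θ (2 * (A * (ε⁻¹ + κ)) * μ.real Set.univ) (S.predDensity μ f) := by
  have h1 : C1Family S.Θ (2 * (A * (ε⁻¹ + κ)))
      (fun θ (z : X × (X × W)) => f θ (z.1, z.2.2) * S.m θ z.1 z.2.1) :=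
    (hf.comp (ζ := fun z : X × (X × W) => (z.1, z.2.2)) (by fun_prop)).mul
      ((hS.c1Family_m hε hκ).comp (ζ := fun z : X × (X × W) => (z.1, z.2.1)) (by fun_prop))
      hS.isParameterSet
  exact h1.integral hS.isParameterSet μ

namespace DensityFamily

variable {K : ℝ} {μ : Measure X} {Yo : W → Y} {f : (Fin p → ℝ) → X × W → ℝ}

theorem integrable [IsFiniteMeasure μ] (hf : S.DensityFamily ε K μ f) {θ : Fin p → ℝ} (hθ : θ ∈ S.Θ) (w : W) :
    Integrable (fun x => f θ (x, w)) μ := by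
  obtain ⟨A, hA⟩ := hf.exists_c1
  exact (hA.comp measurable_prodMk_right).integrable hθ μ

theorem pos (hf : S.DensityFamily ε K μ f) (hε : 0 < ε) {θ : Fin p → ℝ} (hθ : θ ∈ S.Θ)
    (z : X × W) : 0 < f θ z :=
  (pow_pos hε 5).trans_le (hf.lower θ hθ z)

variable [IsFiniteMeasure μ]

theorem integral_famGrad_eq_zero (hf : S.DensityFamily ε K μ f) (hΘ : IsParameterSet S.Θ)
    {θ : Fin p → ℝ} (hθ : θ ∈ S.Θ) (w : W) (i : Fin p) :
    ∫ x, famGrad S.Θ i f θ (x, w) ∂μ = 0 := by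
  obtain ⟨A, hA⟩ := hf.exists_c1
  rw [← hA.famGrad_integral hΘ hθ μ w i]
  simp only [famGrad]
  rw [relGrad_congr (g := fun _ => (1 : ℝ)) (fun θ hθ => hf.integral_eq_one θ hθ w) hθ,
    relGrad_const]

/-- The score has mean zero under `f` itself, so no value of it exceeds its oscillation. -/
theorem abs_famGrad_le (hf : S.DensityFamily ε K μ f) (hΘ : IsParameterSet S.Θ) (hε : 0 < ε)
    {θ : Fin p → ℝ} (hθ : θ ∈ S.Θ) (z : X × W) (i : Fin p) :
    |famGrad S.Θ i f θ z| ≤ K * f θ z := by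
  obtain ⟨A, hA⟩ := hf.exists_c1
  obtain ⟨x, w⟩ := z
  set ψ : X → ℝ := fun x => famGrad S.Θ i f θ (x, w) / f θ (x, w) with hψ
  have hmul : ∀ x, ψ x * f θ (x, w) = famGrad S.Θ i f θ (x, w) := fun x =>
    div_mul_cancel₀ _ (hf.pos hε hθ _).ne'
  have h0 : ∫ x, ψ x * f θ (x, w) ∂μ = 0 := by
    simp only [hmul]; exact hf.integral_famGrad_eq_zero hΘ hθ w i
  have hm : Measurable ψ := ((hA.measurable_famGrad hΘ hθ i).comp measurable_prodMk_right).div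
    ((hA.measurable θ hθ).comp measurable_prodMk_right)
  have hb := integral_mul_mem_of_density (hf.integrable hθ w) (fun x => (hf.pos hε hθ _).le)
    (hf.integral_eq_one θ hθ w) hm (a := ψ x - K) (b := ψ x + K)
    (fun x' => by linarith [(abs_le.1 (hf.osc θ hθ w x x' i)).2])
    (fun x' => by linarith [(abs_le.1 (hf.osc θ hθ w x x' i)).1])
  rw [h0] at hb
  have : |ψ x| ≤ K := abs_le.2 ⟨by linarith [hb.2], by linarith [hb.1]⟩
  rw [← hmul x, abs_mul, abs_of_pos (hf.pos hε hθ _)]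
  exact mul_le_mul_of_nonneg_right this (hf.pos hε hθ _).le

/-- The constant in `exists_c1` is only qualitative and may grow along the filter recursion. The
oscillation bound restores a constant that does not depend on time. -/
theorem c1Family (hf : S.DensityFamily ε K μ f) (hΘ : IsParameterSet S.Θ) (hε : 0 < ε)
    (hK : 1 ≤ K) : C1Family S.Θ (K * ε⁻¹ ^ 5) f := by
  obtain ⟨A, hA⟩ := hf.exists_c1
  refine ⟨hA.measurable, hA.diff, fun θ hθ z => ?_, fun θ hθ z i => ?_⟩
  · rw [abs_of_pos (hf.pos hε hθ z)]
    have : (0 : ℝ) ≤ ε⁻¹ ^ 5 := by positivity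
    nlinarith [hf.upper θ hθ z]
  · exact (hf.abs_famGrad_le hΘ hε hθ z i).trans
      (mul_le_mul_of_nonneg_left (hf.upper θ hθ z) (by linarith))

theorem predDensity_mem (hS : S.Assumptions ε κ) (hf : S.DensityFamily ε K μ f) (hε : 0 < ε)
    {θ : Fin p → ℝ} (hθ : θ ∈ S.Θ) (z : X × W) :
    ε ≤ S.predDensity μ f θ z ∧ S.predDensity μ f θ z ≤ ε⁻¹ := by
  have hm : Measurable fun x => S.m θ x z.1 :=
    (hS.density_m θ hθ).measurable.comp measurable_prodMk_right
  have := integral_mul_mem_of_density (hf.integrable hθ z.2) (fun x => (hf.pos hε hθ _).le)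
    (hf.integral_eq_one θ hθ z.2) hm (fun x => (hS.bounds_m θ hθ x z.1).1)
    (fun x => (hS.bounds_m θ hθ x z.1).2)
  simpa only [ParamSSM.predDensity, mul_comm] using this

theorem updateNumerator_mem (hS : S.Assumptions ε κ) (hf : S.DensityFamily ε K μ f) (hε : 0 < ε)
    {θ : Fin p → ℝ} (hθ : θ ∈ S.Θ) (y : Y) (z : X × W) :
    ε ^ 2 ≤ S.g θ z.1 y * S.predDensity μ f θ z ∧
      S.g θ z.1 y * S.predDensity μ f θ z ≤ ε⁻¹ ^ 2 := by
  have h1 := hS.bounds_g θ hθ z.1 y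
  have h2 := hf.predDensity_mem hS hε hθ z
  have hi : 0 < ε⁻¹ := inv_pos.2 hε
  constructor
  · rw [sq]; exact mul_le_mul h1.1 h2.1 hε.le (hε.le.trans h1.1)
  · rw [sq]; exact mul_le_mul h1.2 h2.2 (hε.le.trans h2.1) hi.le

theorem measurable_predDensity (hS : S.Assumptions ε κ) (hf : S.DensityFamily ε K μ f) (hε : 0 < ε)
    (hκ : 0 ≤ κ) {θ : Fin p → ℝ} (hθ : θ ∈ S.Θ) : Measurable (S.predDensity μ f θ) := by
  obtain ⟨A, hA⟩ := hf.exists_c1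
  exact (C1Family.predDensity hS hε hκ hA).measurable θ hθ

theorem updateNorm_mem (hS : S.Assumptions ε κ) (hf : S.DensityFamily ε K μ f) (hε : 0 < ε)
    (hκ : 0 ≤ κ) {θ : Fin p → ℝ} (hθ : θ ∈ S.Θ) (w : W) :
    ε ^ 3 ≤ S.updateNorm μ Yo f θ w ∧ S.updateNorm μ Yo f θ w ≤ ε⁻¹ ^ 3 := by
  have := hS.finite_lamX
  have hm : Measurable fun x => S.g θ x (Yo w) * S.predDensity μ f θ (x, w) :=
    ((hS.density_g θ hθ).measurable.comp measurable_prodMk_right).mul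
      ((hf.measurable_predDensity hS hε hκ hθ).comp measurable_prodMk_right)
  have h := integral_mem_of_mem (μ := S.lamX) hm
    (fun x => (hf.updateNumerator_mem hS hε hθ (Yo w) (x, w)).1)
    (fun x => (hf.updateNumerator_mem hS hε hθ (Yo w) (x, w)).2)
  have hΛ := hS.mass_lamX hε ⟨θ, hθ⟩
  constructor
  · refine le_trans ?_ h.1
    rw [pow_succ]; exact mul_le_mul_of_nonneg_left hΛ.1 (by positivity)
  · refine h.2.trans ?_
    rw [pow_succ ε⁻¹ 2]; exact mul_le_mul_of_nonneg_left hΛ.2 (by positivity)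

/-- Fisher's identity: with the derivative of f·m written as its logarithmic derivative times f·m,
division by the prediction turns it into a backward-kernel average of scores. -/
theorem famGrad_predDensity (hS : S.Assumptions ε κ) (hf : S.DensityFamily ε K μ f) (hε : 0 < ε)
    (hκ : 0 ≤ κ) {θ : Fin p → ℝ} (hθ : θ ∈ S.Θ) (z : X × W) (i : Fin p) :
    famGrad S.Θ i (S.predDensity μ f) θ z =
      ∫ x, (famGrad S.Θ i f θ (x, z.2) / f θ (x, z.2) +
        relGrad S.Θ (fun θ => S.m θ x z.1) θ i / S.m θ x z.1) *
          (f θ (x, z.2) * S.m θ x z.1) ∂μ := by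
  obtain ⟨A, hA⟩ := hf.exists_c1
  have hf' := hA.comp (ζ := fun z : X × (X × W) => (z.1, z.2.2)) (by fun_prop)
  have hm' := (hS.c1Family_m hε hκ).comp (ζ := fun z : X × (X × W) => (z.1, z.2.1)) (by fun_prop)
  have h1 := hf'.mul hm' hS.isParameterSet
  have := h1.famGrad_integral hS.isParameterSet hθ μ z i
  rw [show famGrad S.Θ i (S.predDensity μ f) θ z = _ from this]
  refine integral_congr_ae (.of_forall fun x => ?_)
  simp only
  rw [hf'.famGrad_mul hm' hS.isParameterSet hθ]
  have h2 := (hf.pos hε hθ (x, z.2)).ne'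
  have h3 := (hε.trans_le (hS.bounds_m θ hθ x z.1).1).ne'
  simp only [famGrad] at h2 h3 ⊢
  field_simp
  ring

/-- Up to a term free of the state, the new score is ∂g/g plus the backward average of the old score
and of ∂m/m. The backward densities dominate ε² times the old filter, so the oscillation K becomes
at most (1 - ε²)K + 4κ/ε. -/
theorem filterUpdate (hS : S.Assumptions ε κ) (hf : S.DensityFamily ε (4 * κ / ε ^ 3) μ f)
    (hε : 0 < ε) (hκ : 0 ≤ κ) (hY : Measurable Yo) :
    S.DensityFamily ε (4 * κ / ε ^ 3) S.lamX (S.filterUpdate μ Yo f) := by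
  have := hS.finite_lamX
  have hΘ := hS.isParameterSet
  obtain ⟨A, hA⟩ := hf.exists_c1
  have hpr := C1Family.predDensity hS hε hκ (μ := μ) hA
  have hg : C1Family S.Θ (ε⁻¹ + κ) (fun θ (z : X × W) => S.g θ z.1 (Yo z.2)) :=
    (hS.c1Family_g hε hκ).comp (ζ := fun z : X × W => (z.1, Yo z.2)) (by fun_prop)
  have hN := hg.mul hpr hΘ
  have hc : C1Family S.Θ _ (S.updateNorm μ Yo f) := hN.integral hΘ S.lamX
  have hc0 : ∀ θ ∈ S.Θ, ∀ w, ε ^ 3 ≤ S.updateNorm μ Yo f θ w := fun θ hθ w =>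
    (hf.updateNorm_mem hS hε hκ hθ w).1
  have hcc := hc.comp (ζ := fun z : X × W => z.2) measurable_snd
  have hci := hcc.inv hΘ (pow_pos hε 3) (fun θ hθ z => hc0 θ hθ z.2)
  have hfu := hN.mul hci hΘ
  refine ⟨⟨_, hfu⟩, fun θ hθ z => ?_, fun θ hθ z => ?_, fun θ hθ w => ?_, fun θ hθ w x₁ x₂ i => ?_⟩
  · have h1 := (hf.updateNumerator_mem hS hε hθ (Yo z.2) z).1
    have h2 := (hf.updateNorm_mem hS hε hκ hθ (Yo := Yo) z.2)
    have h3 : ε ^ 3 ≤ (S.updateNorm μ Yo f θ z.2)⁻¹ := by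
      rw [le_inv_comm₀ (pow_pos hε 3) ((pow_pos hε 3).trans_le h2.1), ← inv_pow]; exact h2.2
    -- Two powers come from g and the prediction, three from the normaliser, whose integral adds the
    -- mass of `S.lamX`.
    rw [show ε ^ 5 = ε ^ 2 * ε ^ 3 by ring]
    exact mul_le_mul h1 h3 (by positivity) ((pow_pos hε 2).le.trans h1)
  · have h1 := (hf.updateNumerator_mem hS hε hθ (Yo z.2) z)
    have h2 := (hf.updateNorm_mem hS hε hκ hθ (Yo := Yo) z.2)
    have h3 : (S.updateNorm μ Yo f θ z.2)⁻¹ ≤ ε⁻¹ ^ 3 := by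
      rw [inv_pow]; exact inv_anti₀ (pow_pos hε 3) h2.1
    rw [show ε⁻¹ ^ 5 = ε⁻¹ ^ 2 * ε⁻¹ ^ 3 by ring]
    exact mul_le_mul h1.2 h3 (inv_nonneg.2 ((pow_pos hε 3).le.trans h2.1)) (by positivity)
  · simp only [ParamSSM.filterUpdate]
    rw [integral_mul_const]
    exact mul_inv_cancel₀ ((pow_pos hε 3).trans_le (hc0 θ hθ w)).ne'
  -- The last term comes from the normaliser. It does not involve `x` and cancels in the
  -- oscillation.
  · have hgrad : ∀ x, famGrad S.Θ i (S.filterUpdate μ Yo f) θ (x, w) /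
        S.filterUpdate μ Yo f θ (x, w) =
        relGrad S.Θ (fun θ => S.g θ x (Yo w)) θ i / S.g θ x (Yo w) +
        famGrad S.Θ i (S.predDensity μ f) θ (x, w) / S.predDensity μ f θ (x, w) -
        famGrad S.Θ i (S.updateNorm μ Yo f) θ w / S.updateNorm μ Yo f θ w := by
      intro x
      have e := hN.famGrad_mul hci hΘ hθ (x, w) i
      rw [hcc.famGrad_inv hΘ (pow_pos hε 3) (fun θ hθ z => hc0 θ hθ z.2) hθ,
        hg.famGrad_mul hpr hΘ hθ] at e
      have e' : famGrad S.Θ i (S.filterUpdate μ Yo f) θ (x, w) = _ := e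
      rw [e']
      have h1 := (hε.trans_le (hS.bounds_g θ hθ x (Yo w)).1).ne'
      have h2 := (hε.trans_le (hf.predDensity_mem hS hε hθ (x, w)).1).ne'
      have h3 := ((pow_pos hε 3).trans_le (hc0 θ hθ w)).ne'
      have e2 : famGrad S.Θ i (fun θ (z : X × W) => S.updateNorm μ Yo f θ z.2) θ (x, w) =
        famGrad S.Θ i (S.updateNorm μ Yo f) θ w := rfl
      rw [e2]
      have e3 : famGrad S.Θ i (fun θ (w : X × W) => S.g θ w.1 (Yo w.2)) θ (x, w) =
        relGrad S.Θ (fun θ => S.g θ x (Yo w)) θ i := rfl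
      rw [e3]
      simp only [ParamSSM.filterUpdate]
      field_simp
      ring
    have hgb : ∀ x, |relGrad S.Θ (fun θ => S.g θ x (Yo w)) θ i / S.g θ x (Yo w)| ≤ κ / ε := by
      intro x
      have h1 := (norm_le_pi_norm _ i).trans (hS.grad_g θ hθ x (Yo w))
      rw [abs_div, abs_of_pos (hε.trans_le (hS.bounds_g θ hθ x (Yo w)).1)]
      exact div_le_div₀ hκ h1 hε (hS.bounds_g θ hθ x (Yo w)).1
    have hmb : ∀ x x', |relGrad S.Θ (fun θ => S.m θ x x') θ i / S.m θ x x'| ≤ κ / ε := by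
      intro x x'
      have h1 := (norm_le_pi_norm _ i).trans (hS.grad_m θ hθ x x')
      rw [abs_div, abs_of_pos (hε.trans_le (hS.bounds_m θ hθ x x').1)]
      exact div_le_div₀ hκ h1 hε (hS.bounds_m θ hθ x x').1
    set ψ : X → ℝ := fun x => famGrad S.Θ i f θ (x, w) / f θ (x, w) with hψ
    -- The conditional density of the old state `x` given the new state `x'`.
    set k : X → X → ℝ := fun x' x => f θ (x, w) * S.m θ x x' / S.predDensity μ f θ (x', w) with hk
    have hfm : Measurable fun x => f θ (x, w) :=
      (hA.measurable θ hθ).comp measurable_prodMk_right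
    have hmm : ∀ x', Measurable fun x => S.m θ x x' := fun x' =>
      (hS.density_m θ hθ).measurable.comp measurable_prodMk_right
    have hkpos : ∀ x' x, ε ^ 2 * f θ (x, w) ≤ k x' x := by
      intro x' x
      have h1 := hf.predDensity_mem hS hε hθ (x', w)
      have h2 := (hS.bounds_m θ hθ x x').1
      have h3 := hf.pos hε hθ (x, w)
      simp only [hk]
      rw [le_div_iff₀ (hε.trans_le h1.1)]
      calc ε ^ 2 * f θ (x, w) * S.predDensity μ f θ (x', w)
          ≤ ε ^ 2 * f θ (x, w) * ε⁻¹ := by gcongr; exact h1.2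
        _ = f θ (x, w) * ε := by field_simp
        _ ≤ _ := by gcongr
    have hki : ∀ x', Integrable (k x') μ := by
      intro x'
      refine ((hf.integrable hθ w).mul_bdd (c := ε⁻¹) (hmm x').aestronglyMeasurable
        (.of_forall fun x => ?_)).div_const _
      have := hS.bounds_m θ hθ x x'
      rw [Real.norm_eq_abs, abs_of_pos (hε.trans_le this.1)]; exact this.2
    have hk1 : ∀ x', ∫ x, k x' x ∂μ = 1 := by
      intro x'
      simp only [hk]
      rw [integral_div]
      exact div_self (hε.trans_le (hf.predDensity_mem hS hε hθ (x', w)).1).ne'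
    have hψm : Measurable ψ :=
      ((hA.measurable_famGrad hΘ hθ i).comp measurable_prodMk_right).div hfm
    have hψb : ∀ x, |ψ x| ≤ 4 * κ / ε ^ 3 := by
      intro x
      have := hf.abs_famGrad_le hΘ hε hθ (x, w) i
      simp only [hψ]
      rw [abs_div, abs_of_pos (hf.pos hε hθ (x, w)), div_le_iff₀ (hf.pos hε hθ (x, w))]
      exact this
    have hψi : ∀ x', Integrable (fun x => ψ x * k x' x) μ := fun x' =>
      (hki x').bdd_mul (c := 4 * κ / ε ^ 3) hψm.aestronglyMeasurable (.of_forall hψb)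
    have hdm : ∀ x', Measurable fun x => relGrad S.Θ (fun θ => S.m θ x x') θ i / S.m θ x x' :=
      fun x' => (((hS.c1Family_m hε hκ).measurable_famGrad hΘ hθ i).comp
        (measurable_prodMk_right (y := x'))).div (hmm x')
    have hdi : ∀ x', Integrable
        (fun x => relGrad S.Θ (fun θ => S.m θ x x') θ i / S.m θ x x' * k x' x) μ := fun x' =>
      (hki x').bdd_mul (c := κ / ε) (hdm x').aestronglyMeasurable (.of_forall fun x => hmb x x')
    have hsplit : ∀ x', famGrad S.Θ i (S.predDensity μ f) θ (x', w) / S.predDensity μ f θ (x', w) =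
        ∫ x, ψ x * k x' x ∂μ +
          ∫ x, relGrad S.Θ (fun θ => S.m θ x x') θ i / S.m θ x x' * k x' x ∂μ := by
      intro x'
      rw [hf.famGrad_predDensity hS hε hκ hθ, ← integral_div, ← integral_add (hψi x') (hdi x')]
      refine integral_congr_ae (.of_forall fun x => ?_)
      simp only [hk, hψ]
      ring
    have hd : ∀ x', |∫ x, relGrad S.Θ (fun θ => S.m θ x x') θ i / S.m θ x x' * k x' x ∂μ| ≤
        κ / ε := by
      intro x'
      have hk0 : ∀ x, 0 ≤ k x' x := fun x =>
        (mul_nonneg (by positivity) (hf.pos hε hθ (x, w)).le).trans (hkpos x' x)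
      have := integral_mul_mem_of_density (hki x') hk0 (hk1 x') (hdm x')
        (fun x => (abs_le.1 (hmb x x')).1) (fun x => (abs_le.1 (hmb x x')).2)
      exact abs_le.2 this
    have hmain := abs_integral_sub_integral_le_of_minorized hψm (hf.osc θ hθ w · · i) (hki x₁)
      (hki x₂) (hf.integrable hθ w) (hk1 x₁) (hk1 x₂) (hf.integral_eq_one θ hθ w) (hkpos x₁)
      (hkpos x₂)
    rw [hgrad, hgrad, hsplit, hsplit]
    -- This identity determines K = 4κ/ε³ as the fixed point of K ↦ (1 - ε²)K + 4κ/ε.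
    have e1 : (1 - ε ^ 2) * (4 * κ / ε ^ 3) = 4 * κ / ε ^ 3 - 4 * (κ / ε) := by field_simp
    have := abs_le.1 hmain
    have g1 := abs_le.1 (hgb x₁)
    have g2 := abs_le.1 (hgb x₂)
    have d1 := abs_le.1 (hd x₁)
    have d2 := abs_le.1 (hd x₂)
    rw [e1] at this
    rw [abs_le]
    constructor <;> linarith [this.1, this.2]

end DensityFamily

end ParamSSM

/-! ### Exponential forgetting of the filter and of its gradient. -/

namespace ParamSSM

variable {p : ℕ} {X Y U W : Type*} [MeasurableSpace X] [MeasurableSpace Y] [MeasurableSpace U]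
  [MeasurableSpace W] {S : ParamSSM p X Y U} {ε κ : ℝ}

/-- `f` is proportional to `R * f'`, where `R` has oscillation at most `a` and gradient of
oscillation at most `b` in the state variable. -/
structure RatioFamily (S : ParamSSM p X Y U) (r a b D : ℝ)
    (f f' R : (Fin p → ℝ) → X × W → ℝ) : Prop where
  c1 : C1Family S.Θ D R
  lower : ∀ θ ∈ S.Θ, ∀ z, r ≤ R θ z
  eq : ∀ θ ∈ S.Θ, ∀ x w, f θ (x, w) * ∫ x', R θ (x', w) * f' θ (x', w) ∂S.lamX =
    R θ (x, w) * f' θ (x, w)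
  osc : ∀ θ ∈ S.Θ, ∀ w x x', |R θ (x, w) - R θ (x', w)| ≤ a
  osc_grad : ∀ θ ∈ S.Θ, ∀ w x x' i,
    |famGrad S.Θ i R θ (x, w) - famGrad S.Θ i R θ (x', w)| ≤ b

/-- The density of the backward kernel of the filter, as a function of the old state and the new
state. -/
def backwardDensity (S : ParamSSM p X Y U) (f : (Fin p → ℝ) → X × W → ℝ) :
    (Fin p → ℝ) → X × (X × W) → ℝ :=
  fun θ z => f θ (z.1, z.2.2) * S.m θ z.1 z.2.1 * (S.predDensity S.lamX f θ z.2)⁻¹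

/-- A bound for the backward density and its gradients, for densities with bound `B` and reference
measure of mass `Λ`. -/
def backwardBound (ε κ B Λ : ℝ) : ℝ :=
  2 * (2 * (B * (ε⁻¹ + κ)) * (ε⁻¹ + 2 * (B * (ε⁻¹ + κ)) * Λ / ε ^ 2))

namespace DensityFamily

variable {K B : ℝ} {f f' R : (Fin p → ℝ) → X × W → ℝ}

theorem comp {W' : Type*} [MeasurableSpace W'] {μ : Measure X} (hf : S.DensityFamily ε K μ f)
    {ζ : W' → W} (hζ : Measurable ζ) :
    S.DensityFamily ε K μ (fun θ (z : X × W') => f θ (z.1, ζ z.2)) := by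
  obtain ⟨A, hA⟩ := hf.exists_c1
  exact ⟨⟨A, hA.comp (measurable_fst.prodMk (hζ.comp measurable_snd))⟩,
    fun θ hθ z => hf.lower θ hθ _, fun θ hθ z => hf.upper θ hθ _,
    fun θ hθ w => hf.integral_eq_one θ hθ (ζ w), fun θ hθ w x x' i => hf.osc θ hθ (ζ w) x x' i⟩

theorem c1Family_backwardDensity [IsFiniteMeasure S.lamX] (hS : S.Assumptions ε κ)
    (hf : S.DensityFamily ε K S.lamX f) (hε : 0 < ε) (hκ : 0 ≤ κ) (hB : C1Family S.Θ B f) :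
    C1Family S.Θ (backwardBound ε κ B (S.lamX.real Set.univ)) (S.backwardDensity f) := by
  have hΘ := hS.isParameterSet
  have h1 : C1Family S.Θ (2 * (B * (ε⁻¹ + κ)))
      (fun θ (z : X × (X × W)) => f θ (z.1, z.2.2) * S.m θ z.1 z.2.1) :=
    (hB.comp (ζ := fun z : X × (X × W) => (z.1, z.2.2)) (by fun_prop)).mul
      ((hS.c1Family_m hε hκ).comp (ζ := fun z : X × (X × W) => (z.1, z.2.1)) (by fun_prop)) hΘ
  have h2 := (C1Family.predDensity hS hε hκ (μ := S.lamX) hB).inv hΘ hε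
    (fun θ hθ z => (hf.predDensity_mem hS hε hθ z).1)
  exact h1.mul (h2.comp (ζ := fun z : X × (X × W) => z.2) measurable_snd) hΘ

/-- Since m ≥ ε and the prediction is at most ε⁻¹, the quotient f·m/prediction is at least ε² f. The
minorant does not depend on the new state, which yields contraction. -/
theorem le_backwardDensity [IsFiniteMeasure S.lamX] (hS : S.Assumptions ε κ)
    (hf : S.DensityFamily ε K S.lamX f) (hε : 0 < ε) {θ : Fin p → ℝ} (hθ : θ ∈ S.Θ)
    (x x' : X) (w : W) : ε ^ 2 * f θ (x, w) ≤ S.backwardDensity f θ (x, (x', w)) := by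
  have h1 := hf.predDensity_mem hS hε hθ (x', w)
  have h2 := (hS.bounds_m θ hθ x x').1
  have h3 := hf.pos hε hθ (x, w)
  simp only [backwardDensity]
  rw [← div_eq_mul_inv, le_div_iff₀ (hε.trans_le h1.1)]
  calc ε ^ 2 * f θ (x, w) * S.predDensity S.lamX f θ (x', w)
      ≤ ε ^ 2 * f θ (x, w) * ε⁻¹ := by gcongr; exact h1.2
    _ = f θ (x, w) * ε := by field_simp
    _ ≤ _ := by gcongr

theorem integral_backwardDensity [IsFiniteMeasure S.lamX] (hS : S.Assumptions ε κ)
    (hf : S.DensityFamily ε K S.lamX f) (hε : 0 < ε) {θ : Fin p → ℝ} (hθ : θ ∈ S.Θ)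
    (z : X × W) : ∫ x, S.backwardDensity f θ (x, z) ∂S.lamX = 1 := by
  simp only [backwardDensity]
  rw [integral_mul_const]
  exact mul_inv_cancel₀ (hε.trans_le (hf.predDensity_mem hS hε hθ z).1).ne'

end DensityFamily

namespace RatioFamily

variable {K B r a b D : ℝ} {f f' R : (Fin p → ℝ) → X × W → ℝ}

theorem mono {a' b' D' : ℝ} (hR : S.RatioFamily r a b D f f' R) (ha : a ≤ a') (hb : b ≤ b')
    (hD : D ≤ D') : S.RatioFamily r a' b' D' f f' R :=
  ⟨hR.c1.mono hD, hR.lower, hR.eq, fun θ hθ w x x' => (hR.osc θ hθ w x x').trans ha,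
    fun θ hθ w x x' i => (hR.osc_grad θ hθ w x x' i).trans hb⟩

/-- If f is proportional to R f', its prediction is proportional to the prediction of f' times the
backward average of R, and the likelihood factor is common to both. So the new ratio is that
average, and its oscillation contracts. Differentiating the backward kernel adds a source term to
the gradient, but one proportional to the oscillation of R. For the same reason the sup bound `D`
grows only by a multiple of `a`. -/
theorem filterUpdate [IsFiniteMeasure S.lamX] (hS : S.Assumptions ε κ)
    (hR : S.RatioFamily r a b D f f' R) (hf : S.DensityFamily ε K S.lamX f)
    (hf' : S.DensityFamily ε K S.lamX f') (hε : 0 < ε) (hκ : 0 ≤ κ) (hr : 0 < r)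
    (hB : C1Family S.Θ B f') {Yo : W → Y} :
    S.RatioFamily r ((1 - ε ^ 2) * a)
      ((1 - ε ^ 2) * b +
        2 * (a * backwardBound ε κ B (S.lamX.real Set.univ) * S.lamX.real Set.univ))
      (D + a * backwardBound ε κ B (S.lamX.real Set.univ) * S.lamX.real Set.univ)
      (S.filterUpdate S.lamX Yo f) (S.filterUpdate S.lamX Yo f')
      (fun θ z => ∫ x, R θ (x, z.2) * S.backwardDensity f' θ (x, z) ∂S.lamX) := by
  have hΘ := hS.isParameterSet
  set k := S.backwardDensity f' with hkdef
  set Bk := backwardBound ε κ B (S.lamX.real Set.univ)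
  have hk : C1Family S.Θ Bk k := hf'.c1Family_backwardDensity hS hε hκ hB
  have hkx : ∀ z : X × W, Measurable fun x : X => (x, z) := fun z => measurable_prodMk_right
  have hR' := hR.c1.comp (ζ := fun z : X × (X × W) => (z.1, z.2.2)) (by fun_prop)
  have hRk := hR'.mul hk hΘ
  have hint := hRk.integral hΘ S.lamX
  have hki : ∀ θ ∈ S.Θ, ∀ z, Integrable (fun x => k θ (x, z)) S.lamX := fun θ hθ z =>
    (hk.comp (hkx z)).integrable hθ _
  have hk1 : ∀ θ ∈ S.Θ, ∀ z, ∫ x, k θ (x, z) ∂S.lamX = 1 := fun θ hθ z =>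
    hf'.integral_backwardDensity hS hε hθ z
  have hkge : ∀ θ ∈ S.Θ, ∀ x x' w, ε ^ 2 * f' θ (x, w) ≤ k θ (x, (x', w)) := fun θ hθ x x' w =>
    hf'.le_backwardDensity hS hε hθ x x' w
  have hk0 : ∀ θ ∈ S.Θ, ∀ x z, 0 ≤ k θ (x, z) := fun θ hθ x z =>
    (mul_nonneg (by positivity) (hf'.pos hε hθ (x, z.2)).le).trans (hkge θ hθ x z.1 z.2)
  have hRm : ∀ θ ∈ S.Θ, ∀ w, Measurable fun x => R θ (x, w) := fun θ hθ w =>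
    (hR.c1.measurable θ hθ).comp measurable_prodMk_right
  have hDm : ∀ θ ∈ S.Θ, ∀ w i, Measurable fun x => famGrad S.Θ i R θ (x, w) := fun θ hθ w i =>
    (hR.c1.measurable_famGrad hΘ hθ i).comp measurable_prodMk_right
  -- Backward densities integrate to one for every parameter, so their gradients have integral zero
  -- and see only the oscillation of `R`.
  have hk' : ∀ θ ∈ S.Θ, ∀ z i, ∫ x, famGrad S.Θ i k θ (x, z) ∂S.lamX = 0 := by
    intro θ hθ z i
    rw [← hk.famGrad_integral hΘ hθ S.lamX z i]
    simp only [famGrad]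
    rw [relGrad_congr (g := fun _ => (1 : ℝ)) (fun θ hθ => hk1 θ hθ z) hθ, relGrad_const]
  have hsmall : ∀ θ ∈ S.Θ, ∀ z i,
      |∫ x, R θ (x, z.2) * famGrad S.Θ i k θ (x, z) ∂S.lamX| ≤ a * Bk * S.lamX.real Set.univ :=
    fun θ hθ z i => abs_integral_mul_le_of_integral_eq_zero (hRm θ hθ z.2) (hR.osc θ hθ z.2)
      ((hk.measurable_famGrad hΘ hθ i).comp (hkx z)) (fun x => hk.grad θ hθ (x, z) i) (hk' θ hθ z i)
  have hgrad : ∀ θ ∈ S.Θ, ∀ z i, famGrad S.Θ i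
      (fun θ z => ∫ x, R θ (x, z.2) * k θ (x, z) ∂S.lamX) θ z =
      ∫ x, famGrad S.Θ i R θ (x, z.2) * k θ (x, z) ∂S.lamX +
        ∫ x, R θ (x, z.2) * famGrad S.Θ i k θ (x, z) ∂S.lamX := by
    intro θ hθ z i
    rw [show famGrad S.Θ i (fun θ z => ∫ x, R θ (x, z.2) * k θ (x, z) ∂S.lamX) θ z = _ from
      hRk.famGrad_integral hΘ hθ S.lamX z i, add_comm, ← integral_add]
    · exact integral_congr_ae (.of_forall fun x => hR'.famGrad_mul hk hΘ hθ (x, z) i)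
    · exact ((hk.comp (hkx z)).integrable_famGrad hΘ hθ S.lamX i).bdd_mul (c := D)
        (hRm θ hθ z.2).aestronglyMeasurable (.of_forall fun x => hR.c1.bound θ hθ (x, z.2))
    · exact (hki θ hθ z).bdd_mul (c := D)
        (hDm θ hθ z.2 i).aestronglyMeasurable (.of_forall fun x => hR.c1.grad θ hθ (x, z.2) i)
  refine ⟨⟨hint.measurable, hint.diff, fun θ hθ z => ?_, fun θ hθ z i => ?_⟩, fun θ hθ z => ?_,
    fun θ hθ x w => ?_, fun θ hθ w x₁ x₂ => ?_, fun θ hθ w x₁ x₂ i => ?_⟩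
  · have h1 := integral_mul_mem_of_density (hki θ hθ z) (fun x => hk0 θ hθ x z) (hk1 θ hθ z)
      (hRm θ hθ z.2) (fun x => (abs_le.1 (hR.c1.bound θ hθ (x, z.2))).1)
      (fun x => (abs_le.1 (hR.c1.bound θ hθ (x, z.2))).2)
    have hBk : 0 ≤ Bk := (abs_nonneg _).trans (hk.bound θ hθ (z.1, z))
    have ha : 0 ≤ a := (abs_nonneg _).trans (hR.osc θ hθ z.2 z.1 z.1)
    have : 0 ≤ a * Bk * S.lamX.real Set.univ := by positivity
    exact (abs_le.2 h1).trans (by linarith)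
  · rw [hgrad θ hθ z i]
    have h1 := integral_mul_mem_of_density (hki θ hθ z) (fun x => hk0 θ hθ x z) (hk1 θ hθ z)
      (hDm θ hθ z.2 i) (fun x => (abs_le.1 (hR.c1.grad θ hθ (x, z.2) i)).1)
      (fun x => (abs_le.1 (hR.c1.grad θ hθ (x, z.2) i)).2)
    exact (abs_add_le _ _).trans (add_le_add (abs_le.2 h1) (hsmall θ hθ z i))
  · exact (integral_mul_mem_of_density (hki θ hθ z) (fun x => hk0 θ hθ x z) (hk1 θ hθ z)
      (hRm θ hθ z.2) (fun x => hR.lower θ hθ (x, z.2))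
      (fun x => (le_abs_self _).trans (hR.c1.bound θ hθ (x, z.2)))).1
  · set R' : X → ℝ := fun x' => ∫ x, R θ (x, w) * k θ (x, (x', w)) ∂S.lamX with hR'def
    set s := ∫ x', R θ (x', w) * f' θ (x', w) ∂S.lamX with hs
    have hs0 : 0 < s := hr.trans_le (integral_mul_mem_of_density (hf'.integrable hθ w)
      (fun x => (hf'.pos hε hθ _).le) (hf'.integral_eq_one θ hθ w) (hRm θ hθ w)
      (fun x => hR.lower θ hθ (x, w))
      (fun x => (le_abs_self _).trans (hR.c1.bound θ hθ (x, w)))).1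
    have hpr' : ∀ x', S.predDensity S.lamX f' θ (x', w) ≠ 0 := fun x' =>
      (hε.trans_le (hf'.predDensity_mem hS hε hθ (x', w)).1).ne'
    -- Here `s` is the normaliser in f = R f' / s. It cancels between numerator and normaliser of
    -- the update.
    have hpr : ∀ x', S.predDensity S.lamX f θ (x', w) =
        s⁻¹ * (R' x' * S.predDensity S.lamX f' θ (x', w)) := by
      intro x'
      have e1 : R' x' * S.predDensity S.lamX f' θ (x', w) =
          ∫ x, R θ (x, w) * f' θ (x, w) * S.m θ x x' ∂S.lamX := by
        simp only [hR'def]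
        rw [← integral_mul_const]
        refine integral_congr_ae (.of_forall fun x => ?_)
        simp only [hkdef, backwardDensity]
        field_simp [hpr' x']
      rw [e1, ← integral_const_mul]
      refine integral_congr_ae (.of_forall fun x => ?_)
      simp only
      rw [← hR.eq θ hθ x w, ← hs]
      field_simp
    have hc'0 := ((pow_pos hε 3).trans_le (hf'.updateNorm_mem hS hε hκ hθ (Yo := Yo) w).1).ne'
    have hc0 := ((pow_pos hε 3).trans_le (hf.updateNorm_mem hS hε hκ hθ (Yo := Yo) w).1).ne'
    have hc : S.updateNorm S.lamX Yo f θ w = s⁻¹ * (S.updateNorm S.lamX Yo f' θ w *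
        ∫ x', R' x' * ParamSSM.filterUpdate S S.lamX Yo f' θ (x', w) ∂S.lamX) := by
      rw [← integral_const_mul, ← integral_const_mul]
      rw [show S.updateNorm S.lamX Yo f θ w =
        ∫ x', S.g θ x' (Yo w) * S.predDensity S.lamX f θ (x', w) ∂S.lamX from rfl]
      refine integral_congr_ae (.of_forall fun x' => ?_)
      simp only
      rw [hpr x']
      simp only [ParamSSM.filterUpdate]
      field_simp
    have hJ : ∫ x', R' x' * ParamSSM.filterUpdate S S.lamX Yo f' θ (x', w) ∂S.lamX =
        s * S.updateNorm S.lamX Yo f θ w / S.updateNorm S.lamX Yo f' θ w := by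
      rw [hc]; field_simp
    change ParamSSM.filterUpdate S S.lamX Yo f θ (x, w) *
      ∫ x', R' x' * ParamSSM.filterUpdate S S.lamX Yo f' θ (x', w) ∂S.lamX =
      R' x * ParamSSM.filterUpdate S S.lamX Yo f' θ (x, w)
    rw [hJ]
    simp only [ParamSSM.filterUpdate]
    rw [hpr x]
    field_simp
  · exact abs_integral_sub_integral_le_of_minorized (hRm θ hθ w) (hR.osc θ hθ w) (hki θ hθ _)
      (hki θ hθ _) (hf'.integrable hθ w) (hk1 θ hθ _) (hk1 θ hθ _) (hf'.integral_eq_one θ hθ w)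
      (fun x => hkge θ hθ x x₁ w) (fun x => hkge θ hθ x x₂ w)
  · have h1 := abs_integral_sub_integral_le_of_minorized (hDm θ hθ w i)
      (fun x x' => hR.osc_grad θ hθ w x x' i) (hki θ hθ (x₁, w))
      (hki θ hθ (x₂, w)) (hf'.integrable hθ w) (hk1 θ hθ _) (hk1 θ hθ _)
      (hf'.integral_eq_one θ hθ w) (fun x => hkge θ hθ x x₁ w) (fun x => hkge θ hθ x x₂ w)
    rw [hgrad θ hθ, hgrad θ hθ]
    have h2 := abs_le.1 (hsmall θ hθ (x₁, w) i)
    have h3 := abs_le.1 (hsmall θ hθ (x₂, w) i)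
    have h4 := abs_le.1 h1
    rw [abs_le]
    constructor <;> linarith [h2.1, h2.2, h3.1, h3.2, h4.1, h4.2]

/-- With s = ∫ R f' one has f - f' = f' (R - s)/s. As s is a weighted mean of R, the factor R - s is
controlled by the oscillation of R. The gradient of s also contains ∫ R ∂f', which is small because
∂f' has integral zero. -/
theorem c1Family_sub [IsFiniteMeasure S.lamX] (hS : S.Assumptions ε κ)
    (hR : S.RatioFamily r a b D f f' R)
    (hf' : S.DensityFamily ε K S.lamX f') (hε : 0 < ε) (hr : 0 < r)
    (hb : 0 ≤ b) (hB : C1Family S.Θ B f') :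
    C1Family S.Θ (2 * (B * (2 * ((a + b + a * B * S.lamX.real Set.univ) *
      (r⁻¹ + 2 * (D * B) * S.lamX.real Set.univ / r ^ 2))))) (fun θ z => f θ z - f' θ z) := by
  have hΘ := hS.isParameterSet
  have hRf := hR.c1.mul hB hΘ
  have hs := hRf.integral hΘ S.lamX
  have hRm : ∀ θ ∈ S.Θ, ∀ w, Measurable fun x => R θ (x, w) := fun θ hθ w =>
    (hR.c1.measurable θ hθ).comp measurable_prodMk_right
  have hDm : ∀ θ ∈ S.Θ, ∀ w i, Measurable fun x => famGrad S.Θ i R θ (x, w) := fun θ hθ w i =>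
    (hR.c1.measurable_famGrad hΘ hθ i).comp measurable_prodMk_right
  have hsr : ∀ θ ∈ S.Θ, ∀ w, r ≤ ∫ x, R θ (x, w) * f' θ (x, w) ∂S.lamX := fun θ hθ w =>
    (integral_mul_mem_of_density (hf'.integrable hθ w)
      (fun x => (hf'.pos hε hθ _).le) (hf'.integral_eq_one θ hθ w) (hRm θ hθ w)
      (fun x => hR.lower θ hθ (x, w))
      (fun x => (le_abs_self _).trans (hR.c1.bound θ hθ (x, w)))).1
  have hsi := (hs.inv hΘ hr hsr).comp (ζ := fun z : X × W => z.2) measurable_snd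
  have hs' := hs.comp (ζ := fun z : X × W => z.2) measurable_snd
  have hN0 := hR.c1.sub hs' hΘ
  have hN : C1Family S.Θ (a + b + a * B * S.lamX.real Set.univ)
      (fun θ z => R θ z - ∫ x, R θ (x, z.2) * f' θ (x, z.2) ∂S.lamX) := by
    refine ⟨hN0.measurable, hN0.diff, fun θ hθ z => ?_, fun θ hθ z i => ?_⟩
    · have hB0 : 0 ≤ B := (abs_nonneg _).trans (hB.bound θ hθ z)
      have ha : 0 ≤ a := (abs_nonneg _).trans (hR.osc θ hθ z.2 z.1 z.1)
      have h1 := integral_mul_mem_of_density (hf'.integrable hθ z.2)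
        (fun x => (hf'.pos hε hθ _).le) (hf'.integral_eq_one θ hθ z.2) (hRm θ hθ z.2)
        (fun x => show R θ z - a ≤ R θ (x, z.2) by
          linarith [(abs_le.1 (hR.osc θ hθ z.2 z.1 x)).2])
        (fun x => show R θ (x, z.2) ≤ R θ z + a by
          linarith [(abs_le.1 (hR.osc θ hθ z.2 z.1 x)).1])
      have hb0 : 0 ≤ a * B * S.lamX.real Set.univ := by positivity
      rw [abs_le]; constructor <;> linarith [h1.1, h1.2]
    · have ha : 0 ≤ a := (abs_nonneg _).trans (hR.osc θ hθ z.2 z.1 z.1)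
      have e : famGrad S.Θ i (fun θ z => R θ z - ∫ x, R θ (x, z.2) * f' θ (x, z.2) ∂S.lamX) θ z =
          famGrad S.Θ i R θ z - (∫ x, famGrad S.Θ i R θ (x, z.2) * f' θ (x, z.2) ∂S.lamX +
            ∫ x, R θ (x, z.2) * famGrad S.Θ i f' θ (x, z.2) ∂S.lamX) := by
        rw [show famGrad S.Θ i (fun θ z => R θ z - ∫ x, R θ (x, z.2) * f' θ (x, z.2) ∂S.lamX) θ z =
          _ from hR.c1.famGrad_sub hs' hΘ hθ z i]
        congr 1
        rw [show famGrad S.Θ i (fun θ (z : X × W) => ∫ x, R θ (x, z.2) * f' θ (x, z.2) ∂S.lamX) θ z =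
          _ from hRf.famGrad_integral hΘ hθ S.lamX z.2 i, add_comm, ← integral_add]
        · exact integral_congr_ae (.of_forall fun x => hR.c1.famGrad_mul hB hΘ hθ (x, z.2) i)
        · exact ((hB.comp measurable_prodMk_right).integrable_famGrad hΘ hθ S.lamX i).bdd_mul
            (c := D) (hRm θ hθ z.2).aestronglyMeasurable
            (.of_forall fun x => hR.c1.bound θ hθ (x, z.2))
        · exact (hf'.integrable hθ z.2).bdd_mul (c := D)
            (hDm θ hθ z.2 i).aestronglyMeasurable (.of_forall fun x => hR.c1.grad θ hθ (x, z.2) i)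
      have h1 := integral_mul_mem_of_density (hf'.integrable hθ z.2)
        (fun x => (hf'.pos hε hθ _).le) (hf'.integral_eq_one θ hθ z.2) (hDm θ hθ z.2 i)
        (fun x => show famGrad S.Θ i R θ z - b ≤ famGrad S.Θ i R θ (x, z.2) by
          linarith [(abs_le.1 (hR.osc_grad θ hθ z.2 z.1 x i)).2])
        (fun x => show famGrad S.Θ i R θ (x, z.2) ≤ famGrad S.Θ i R θ z + b by
          linarith [(abs_le.1 (hR.osc_grad θ hθ z.2 z.1 x i)).1])
      have h2 := abs_le.1 (abs_integral_mul_le_of_integral_eq_zero (μ := S.lamX) (hRm θ hθ z.2)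
        (hR.osc θ hθ z.2) ((hB.measurable_famGrad hΘ hθ i).comp measurable_prodMk_right)
        (fun x => hB.grad θ hθ (x, z.2) i) (hf'.integral_famGrad_eq_zero hΘ hθ z.2 i))
      simp only [Function.comp_def] at h2
      rw [e, abs_le]
      constructor <;> linarith [h1.1, h1.2, h2.1, h2.2]
  refine (hB.mul (hN.mul hsi hΘ) hΘ).congr fun θ hθ z => ?_
  have h0 := (hr.trans_le (hsr θ hθ z.2)).ne'
  have := hR.eq θ hθ z.1 z.2
  simp only [Prod.mk.eta] at this
  field_simp
  linarith

end RatioFamily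

/-- The measure with respect to which the filter at time `t` has a bounded density. -/
def filterBase (S : ParamSSM p X Y U) : ℕ → Measure X
  | 0 => measureOfDensity S.lamX S.m0
  | _ + 1 => S.lamX

/-- The filter recursion, as a family of densities relative to `filterBase`. -/
def obsFilter (S : ParamSSM p X Y U) : ℕ → (Fin p → ℝ) → X × (ℕ → Y) → ℝ
  | 0 => fun θ z => S.g θ z.1 (z.2 0) *
      (∫ x, S.g θ x (z.2 0) ∂(measureOfDensity S.lamX S.m0))⁻¹
  | t + 1 => S.filterUpdate (S.filterBase t) (fun y => y (t + 1)) (S.obsFilter t)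

/-- The filter recursion started from the uniform distribution, ignoring the first observation. -/
def uniformFilter (S : ParamSSM p X Y U) : ℕ → (Fin p → ℝ) → X × (ℕ → Y) → ℝ
  | 0 => fun _ _ => (S.lamX.real Set.univ)⁻¹
  | t + 1 => S.filterUpdate S.lamX (fun y => y (t + 1)) (S.uniformFilter t)

theorem Assumptions.isProbabilityMeasure_m0 (hS : S.Assumptions ε κ) :
    IsProbabilityMeasure (measureOfDensity S.lamX S.m0) := by
  constructor
  rw [measureOfDensity, withDensity_apply _ MeasurableSet.univ, Measure.restrict_univ,
    ← ofReal_integral_eq_lintegral_ofReal hS.integrable_m0 (.of_forall hS.nonneg_m0),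
    hS.integral_m0, ENNReal.ofReal_one]

theorem Assumptions.isFiniteMeasure_filterBase (hS : S.Assumptions ε κ) (t : ℕ) :
    IsFiniteMeasure (S.filterBase t) := by
  cases t with
  | zero => have := hS.isProbabilityMeasure_m0; exact inferInstanceAs
              (IsFiniteMeasure (measureOfDensity S.lamX S.m0))
  | succ t => exact hS.finite_lamX

/-- At time zero the density is taken relative to the initial law, since `m0` itself need not be
bounded. The score is then ∂g/g up to a constant in the state, with oscillation at most 2κ/ε. Later
times follow from stability under the update. -/
theorem Assumptions.densityFamily_obsFilter (hS : S.Assumptions ε κ) (hε : 0 < ε) (hε1 : ε < 1)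
    (hκ : 0 ≤ κ) (t : ℕ) :
    S.DensityFamily ε (4 * κ / ε ^ 3) (S.filterBase t) (S.obsFilter t) := by
  induction t with
  | zero =>
    have := hS.isProbabilityMeasure_m0
    have hΘ := hS.isParameterSet
    set μ := measureOfDensity S.lamX S.m0 with hμ
    have hg : C1Family S.Θ (ε⁻¹ + κ) (fun θ (z : X × (ℕ → Y)) => S.g θ z.1 (z.2 0)) :=
      (hS.c1Family_g hε hκ).comp (ζ := fun z : X × (ℕ → Y) => (z.1, z.2 0)) (by fun_prop)
    have hc := hg.integral hΘ μ
    have hcm : ∀ θ ∈ S.Θ, ∀ y : ℕ → Y, ε ≤ ∫ x, S.g θ x (y 0) ∂μ ∧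
        ∫ x, S.g θ x (y 0) ∂μ ≤ ε⁻¹ := by
      intro θ hθ y
      have := integral_mem_of_mem (μ := μ) (h := fun x => S.g θ x (y 0))
        ((hS.density_g θ hθ).measurable.comp measurable_prodMk_right)
        (fun x => (hS.bounds_g θ hθ x (y 0)).1) (fun x => (hS.bounds_g θ hθ x (y 0)).2)
      simpa using this
    have hcc := hc.comp (ζ := fun z : X × (ℕ → Y) => z.2) measurable_snd
    have hci := hcc.inv hΘ hε (fun θ hθ z => (hcm θ hθ z.2).1)
    have hfu := hg.mul hci hΘ
    have hε2 : ε ^ 5 ≤ ε ^ 2 := pow_le_pow_of_le_one hε.le hε1.le (by norm_num)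
    have hε3 : ε⁻¹ ^ 2 ≤ ε⁻¹ ^ 5 := pow_le_pow_right₀ ((one_le_inv₀ hε).2 hε1.le) (by norm_num)
    refine ⟨⟨_, hfu⟩, fun θ hθ z => hε2.trans ?_, fun θ hθ z => le_trans ?_ hε3, fun θ hθ w => ?_,
      fun θ hθ w x₁ x₂ i => ?_⟩
    · have h1 := hS.bounds_g θ hθ z.1 (z.2 0)
      have h2 := hcm θ hθ z.2
      simp only [obsFilter]
      rw [sq]
      exact mul_le_mul h1.1 ((le_inv_comm₀ hε (hε.trans_le h2.1)).2 h2.2) hε.le (hε.le.trans h1.1)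
    · have h1 := hS.bounds_g θ hθ z.1 (z.2 0)
      have h2 := hcm θ hθ z.2
      simp only [obsFilter]
      rw [sq]
      exact mul_le_mul h1.2 (inv_anti₀ hε h2.1) (inv_nonneg.2 (hε.le.trans h2.1))
        (inv_nonneg.2 hε.le)
    · simp only [obsFilter]
      rw [integral_mul_const]
      exact mul_inv_cancel₀ (hε.trans_le (hcm θ hθ w).1).ne'
    · have hgrad : ∀ x, famGrad S.Θ i (S.obsFilter 0) θ (x, w) / S.obsFilter 0 θ (x, w) =
          relGrad S.Θ (fun θ => S.g θ x (w 0)) θ i / S.g θ x (w 0) -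
          famGrad S.Θ i (fun θ (y : ℕ → Y) => ∫ x, S.g θ x (y 0) ∂μ) θ w /
            ∫ x, S.g θ x (w 0) ∂μ := by
        intro x
        have e := hg.famGrad_mul hci hΘ hθ (x, w) i
        rw [hcc.famGrad_inv hΘ hε (fun θ hθ z => (hcm θ hθ z.2).1) hθ] at e
        have e' : famGrad S.Θ i (S.obsFilter 0) θ (x, w) = _ := e
        rw [e']
        have h1 := (hε.trans_le (hS.bounds_g θ hθ x (w 0)).1).ne'
        have h3 := (hε.trans_le (hcm θ hθ w).1).ne'
        simp only [obsFilter, famGrad] at h1 h3 ⊢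
        field_simp
        ring
      have hgb : ∀ x, |relGrad S.Θ (fun θ => S.g θ x (w 0)) θ i / S.g θ x (w 0)| ≤ κ / ε := by
        intro x
        have h1 := (norm_le_pi_norm _ i).trans (hS.grad_g θ hθ x (w 0))
        rw [abs_div, abs_of_pos (hε.trans_le (hS.bounds_g θ hθ x (w 0)).1)]
        exact div_le_div₀ hκ h1 hε (hS.bounds_g θ hθ x (w 0)).1
      have h1 : κ / ε ≤ κ / ε ^ 3 := by
        have : ε ^ 3 ≤ ε := by simpa using pow_le_pow_of_le_one hε.le hε1.le (show 1 ≤ 3 by norm_num)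
        gcongr
      have h2 : 0 ≤ κ / ε ^ 3 := by positivity
      rw [hgrad, hgrad, mul_div_assoc]
      have g1 := abs_le.1 (hgb x₁)
      have g2 := abs_le.1 (hgb x₂)
      rw [abs_le]
      constructor <;> linarith [g1.1, g1.2, g2.1, g2.2]
  | succ t ih =>
    have := hS.isFiniteMeasure_filterBase t
    exact ih.filterUpdate hS hε hκ (measurable_pi_apply _)

theorem Assumptions.densityFamily_uniformFilter (hS : S.Assumptions ε κ) (hε : 0 < ε)
    (hε1 : ε < 1) (hκ : 0 ≤ κ) (hne : S.Θ.Nonempty) (t : ℕ) :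
    S.DensityFamily ε (4 * κ / ε ^ 3) S.lamX (S.uniformFilter t) := by
  have := hS.finite_lamX
  have hΛ := hS.mass_lamX hε hne
  have hΛ0 : 0 < S.lamX.real Set.univ := hε.trans_le hΛ.1
  induction t with
  | zero =>
    have h1 : ε ^ 5 ≤ ε := by simpa using pow_le_pow_of_le_one hε.le hε1.le (show 1 ≤ 5 by norm_num)
    have h2 : ε⁻¹ ≤ ε⁻¹ ^ 5 := le_self_pow₀ ((one_le_inv₀ hε).2 hε1.le) (by norm_num)
    refine ⟨⟨_, C1Family.const measurable_const fun _ => le_rfl⟩, fun θ hθ z => h1.trans ?_,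
      fun θ hθ z => le_trans ?_ h2, fun θ hθ w => ?_, fun θ hθ w x₁ x₂ i => ?_⟩
    · exact (le_inv_comm₀ hε hΛ0).2 hΛ.2
    · exact inv_anti₀ hε hΛ.1
    · simp [uniformFilter, hΛ0.ne']
    · simp only [famGrad, uniformFilter, relGrad_const]
      simp only [zero_div, sub_zero, abs_zero]
      positivity
  | succ t ih => exact ih.filterUpdate hS hε hκ (measurable_pi_apply _)

/-- Exponential forgetting of the initial condition of the filter, together with its gradient. -/
theorem Assumptions.exists_forgetting (hS : S.Assumptions ε κ) (hε : 0 < ε)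
    (hε1 : ε < 1) (hκ : 1 ≤ κ) (hne : S.Θ.Nonempty) :
    ∃ C q : ℝ, 0 ≤ C ∧ 0 < q ∧ q < 1 ∧ ∀ k n : ℕ, C1Family S.Θ (C * q ^ n)
      (fun θ (z : X × (ℕ → Y)) => S.obsFilter (k + 1 + n) θ z -
        S.uniformFilter n θ (z.1, fun j => z.2 (j + (k + 1)))) := by
  have := hS.finite_lamX
  have hΘ := hS.isParameterSet
  have hκ0 : 0 ≤ κ := by linarith
  set Λ := S.lamX.real Set.univ with hΛ
  set K := 4 * κ / ε ^ 3 with hK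
  have hK1 : 1 ≤ K := by
    rw [hK, le_div_iff₀ (by positivity)]
    have : ε ^ 3 ≤ 1 := pow_le_one₀ hε.le hε1.le
    linarith
  set B := K * ε⁻¹ ^ 5 with hBdef
  have hB0 : 0 ≤ B := by positivity
  set Bk := backwardBound ε κ B Λ with hBk
  have hΛ0 : 0 ≤ Λ := measureReal_nonneg
  have hBk0 : 0 ≤ Bk := by simp only [hBk, backwardBound]; positivity
  have hε2 : ε ^ 2 < 1 := pow_lt_one₀ hε.le hε1 (by norm_num)
  have hε20 : 0 < ε ^ 2 := by positivity
  -- Slower than the contraction 1 - ε² of the ratio: the spare ε²/2 absorbs the source term in the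
  -- recursion for the gradient.
  set q := 1 - ε ^ 2 / 2 with hq
  -- Chosen so that L(1 - ε²) + 2 Bk Λ ≤ L q, which closes the induction for the gradient.
  set L := 4 * (Bk * Λ) / ε ^ 2 + 1 with hL
  have hL1 : 1 ≤ L := by
    have : 0 ≤ 4 * (Bk * Λ) / ε ^ 2 := by positivity
    linarith
  have hLK : 2 * (Bk * Λ) ≤ L * (ε ^ 2 / 2) := by
    have : 4 * (Bk * Λ) / ε ^ 2 * (ε ^ 2 / 2) = 2 * (Bk * Λ) := by field_simp; ring
    rw [hL, add_mul, this]; linarith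
  set c := 2 * B with hc
  -- The sum of the geometric increments c Bk Λ qⁿ of the sup bound of the ratio.
  set G := c * (Bk * Λ) / (ε ^ 2 / 2) with hG
  have hG0 : 0 ≤ G := by positivity
  have hr : 0 < ε ^ 5 := by positivity
  have hq0 : 0 < q := by linarith
  have hq1 : q < 1 := by linarith
  -- The comparison starts at time `k + 1`, because only from time one on is the filter a density
  -- relative to `S.lamX`.
  have main : ∀ k n : ℕ, ∃ R, S.RatioFamily (ε ^ 5) (c * q ^ n) (L * c * q ^ n)
      (B + G * (1 - q ^ n)) (S.obsFilter (k + 1 + n))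
      (fun θ (z : X × (ℕ → Y)) => S.uniformFilter n θ (z.1, fun j => z.2 (j + (k + 1)))) R := by
    intro k n
    induction n with
    | zero =>
      have hd := hS.densityFamily_obsFilter hε hε1 hκ0 (k + 1)
      have := hS.isFiniteMeasure_filterBase (k + 1)
      have h1 : C1Family S.Θ B (S.obsFilter (k + 1)) := hd.c1Family hΘ hε hK1
      -- The restarted density is constant, so the filter density itself is a ratio, with
      -- oscillation at most 2B.
      refine ⟨S.obsFilter (k + 1), ⟨h1.mono (by simp), hd.lower, fun θ hθ x w => ?_,
        fun θ hθ w x x' => ?_, fun θ hθ w x x' i => ?_⟩⟩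
      · simp only [uniformFilter, add_zero]
        rw [integral_mul_const]
        have : ∫ x, S.obsFilter (k + 1) θ (x, w) ∂S.lamX = 1 := hd.integral_eq_one θ hθ w
        rw [this, one_mul]
      · refine (abs_sub _ _).trans ?_
        have := h1.bound θ hθ (x, w)
        have := h1.bound θ hθ (x', w)
        rw [pow_zero]; linarith
      · refine (abs_sub _ _).trans ?_
        have := h1.grad θ hθ (x, w) i
        have := h1.grad θ hθ (x', w) i
        rw [pow_zero]; nlinarith
    | succ n ih =>
      obtain ⟨R, hR⟩ := ih
      have hd := hS.densityFamily_obsFilter hε hε1 hκ0 (k + 1 + n)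
      have hbase : S.filterBase (k + 1 + n) = S.lamX := by
        rw [show k + 1 + n = (k + n) + 1 by ring]; rfl
      rw [hbase] at hd
      have hu := hS.densityFamily_uniformFilter hε hε1 hκ0 hne (Y := Y) n
      have hu' : S.DensityFamily ε K S.lamX
          (fun θ (z : X × (ℕ → Y)) => S.uniformFilter n θ (z.1, fun j => z.2 (j + (k + 1)))) :=
        hu.comp (ζ := fun (y : ℕ → Y) j => y (j + (k + 1))) (by fun_prop)
      have hR' := hR.filterUpdate (Yo := fun y => y (k + 1 + n + 1)) hS hd hu' hε hκ0 hr
        (hu'.c1Family hΘ hε hK1 : C1Family S.Θ B _)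
      rw [← hΛ, ← hBk] at hR'
      have e1 : S.filterUpdate S.lamX (fun y => y (k + 1 + n + 1)) (S.obsFilter (k + 1 + n)) =
          S.obsFilter (k + 1 + (n + 1)) := by
        rw [← hbase]; rfl
      have e2 : S.filterUpdate S.lamX (fun y => y (k + 1 + n + 1))
          (fun θ (z : X × (ℕ → Y)) => S.uniformFilter n θ (z.1, fun j => z.2 (j + (k + 1)))) =
          fun θ (z : X × (ℕ → Y)) => S.uniformFilter (n + 1) θ (z.1, fun j => z.2 (j + (k + 1))) := by
        rw [show k + 1 + n + 1 = n + 1 + (k + 1) by ring]; rfl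
      rw [e1, e2] at hR'
      have hqn : 0 < q ^ n := pow_pos hq0 n
      refine ⟨_, hR'.mono ?_ ?_ ?_⟩
      · rw [pow_succ q]
        have : (1 - ε ^ 2) ≤ q := by linarith
        calc (1 - ε ^ 2) * (c * q ^ n) ≤ q * (c * q ^ n) := by gcongr
          _ = _ := by ring
      · rw [pow_succ q]
        have e : (1 - ε ^ 2) * (L * c * q ^ n) + 2 * (c * q ^ n * Bk * Λ) =
          (L * (1 - ε ^ 2) + 2 * (Bk * Λ)) * (c * q ^ n) := by ring
        have e' : L * c * (q ^ n * q) = (L * q) * (c * q ^ n) := by ring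
        rw [e, e']
        gcongr
        rw [hq]; linarith
      · have : c * (Bk * Λ) = G * (1 - q) := by rw [hG, hq]; field_simp; ring
        rw [pow_succ q]
        have : c * q ^ n * Bk * Λ = G * (1 - q) * q ^ n := by rw [← this]; ring
        rw [this]; apply le_of_eq; ring
  refine ⟨2 * (B * (2 * ((c + L * c + c * B * Λ) *
    ((ε ^ 5)⁻¹ + 2 * ((B + G) * B) * Λ / (ε ^ 5) ^ 2)))), q, by positivity, hq0, hq1,
    fun k n => ?_⟩
  obtain ⟨R, hR⟩ := main k n
  have hqn : 0 < q ^ n := pow_pos hq0 n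
  have hu := hS.densityFamily_uniformFilter hε hε1 hκ0 hne (Y := Y) n
  have hu' : S.DensityFamily ε K S.lamX
      (fun θ (z : X × (ℕ → Y)) => S.uniformFilter n θ (z.1, fun j => z.2 (j + (k + 1)))) :=
    hu.comp (ζ := fun (y : ℕ → Y) j => y (j + (k + 1))) (by fun_prop)
  have hGq : G * (1 - q ^ n) ≤ G := mul_le_of_le_one_right hG0 (by linarith)
  have hR2 := hR.mono le_rfl le_rfl (add_le_add_right hGq B)
  refine (hR2.c1Family_sub hS hu' hε hr (by positivity) (hu'.c1Family hΘ hε hK1)).mono (le_of_eq ?_)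
  ring

end ParamSSM

/-! ### A strong law under decaying covariances. -/

section LawOfLargeNumbers

variable {Ω : Type*} [MeasurableSpace Ω] {P : Measure Ω} [IsProbabilityMeasure P]

/-- Adding one term to the sum adds its square and twice its covariances with the past, which form a
geometric series. The second moment therefore grows at most linearly. -/
theorem integral_sq_sum_le {ζ : ℕ → Ω → ℝ} {A C σ : ℝ} (hm : ∀ t, Measurable (ζ t))
    (hA : ∀ t ω, |ζ t ω| ≤ A) (hC : 0 ≤ C) (hσ0 : 0 ≤ σ) (hσ1 : σ < 1)
    (hcov : ∀ s d, |∫ ω, ζ s ω * ζ (s + d + 1) ω ∂P| ≤ C * σ ^ d) (t : ℕ) :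
    ∫ ω, (∑ s ∈ Finset.range t, ζ s ω) ^ 2 ∂P ≤ t * (2 * (C * (1 - σ)⁻¹) + A ^ 2) := by
  have hint : ∀ s r, Integrable (fun ω => ζ s ω * ζ r ω) P := fun s r =>
    .of_bound ((hm s).mul (hm r)).aestronglyMeasurable (A * A) (.of_forall fun ω => by
      rw [norm_mul]
      exact mul_le_mul (hA s ω) (hA r ω) (norm_nonneg _) ((abs_nonneg _).trans (hA s ω)))
  have hS : ∀ t, Measurable fun ω => ∑ s ∈ Finset.range t, ζ s ω := fun t =>
    Finset.measurable_sum _ fun s _ => hm s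
  have hSb : ∀ t ω, |∑ s ∈ Finset.range t, ζ s ω| ≤ t * A := fun t ω => by
    refine (Finset.abs_sum_le_sum_abs _ _).trans ?_
    simpa using Finset.sum_le_card_nsmul (Finset.range t) _ A fun s _ => hA s ω
  induction t with
  | zero => simp
  | succ t ih =>
    have hSS : Integrable (fun ω => (∑ s ∈ Finset.range t, ζ s ω) ^ 2) P :=
      .of_bound ((hS t).pow_const 2).aestronglyMeasurable ((t * A) ^ 2) (.of_forall fun ω => by
        rw [norm_pow]
        exact pow_le_pow_left₀ (norm_nonneg _) (hSb t ω) 2)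
    have e : ∀ ω, (∑ s ∈ Finset.range (t + 1), ζ s ω) ^ 2 =
        (∑ s ∈ Finset.range t, ζ s ω) ^ 2 + (2 * ∑ s ∈ Finset.range t, ζ s ω * ζ t ω +
          ζ t ω * ζ t ω) := by
      intro ω
      rw [Finset.sum_range_succ, ← Finset.sum_mul]; ring
    have hsum : Integrable (fun ω => ∑ s ∈ Finset.range t, ζ s ω * ζ t ω) P :=
      integrable_finsetSum _ fun s _ => hint s t
    simp only [e]
    have hadd : Integrable (fun ω => 2 * ∑ s ∈ Finset.range t, ζ s ω * ζ t ω + ζ t ω * ζ t ω) P :=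
      (hsum.const_mul 2).add (hint t t)
    rw [integral_add hSS hadd,
      integral_add (hsum.const_mul 2) (hint t t), integral_const_mul,
      integral_finsetSum _ fun s _ => hint s t]
    have h1 : ∑ s ∈ Finset.range t, ∫ ω, ζ s ω * ζ t ω ∂P ≤ C * (1 - σ)⁻¹ := by
      have : ∀ s ∈ Finset.range t, ∫ ω, ζ s ω * ζ t ω ∂P ≤ C * σ ^ (t - 1 - s) := by
        intro s hs
        have hs' := Finset.mem_range.1 hs
        have := hcov s (t - 1 - s)
        rw [show s + (t - 1 - s) + 1 = t by omega] at this
        exact (le_abs_self _).trans this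
      refine (Finset.sum_le_sum this).trans ?_
      rw [← Finset.mul_sum, Finset.sum_range_reflect (fun d => σ ^ d) t]
      refine mul_le_mul_of_nonneg_left ?_ hC
      rw [← tsum_geometric_of_lt_one hσ0 hσ1]
      exact (summable_geometric_of_lt_one hσ0 hσ1).sum_le_tsum _ fun _ _ => pow_nonneg hσ0 _
    have h2 : ∫ ω, ζ t ω * ζ t ω ∂P ≤ A ^ 2 := by
      calc ∫ ω, ζ t ω * ζ t ω ∂P ≤ ∫ _ω, A ^ 2 ∂P := by
            refine integral_mono (hint t t) (integrable_const _) fun ω => ?_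
            have := hA t ω
            simp only
            rw [← abs_mul_abs_self, sq]
            exact mul_le_mul this this (abs_nonneg _) ((abs_nonneg _).trans this)
        _ = A ^ 2 := by simp
    push_cast
    linarith

/-- A strong law of large numbers for bounded sequences with exponentially decaying
covariances. -/
theorem ae_tendsto_average_of_covariance {ψ : ℕ → Ω → ℝ} {A C σ l : ℝ}
    (hm : ∀ t, Measurable (ψ t)) (hA : ∀ t ω, |ψ t ω| ≤ A) (hC : 0 ≤ C) (hσ0 : 0 ≤ σ) (hσ1 : σ < 1)
    (hcov : ∀ s d, |∫ ω, ψ s ω * ψ (s + d + 1) ω ∂P -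
      (∫ ω, ψ s ω ∂P) * ∫ ω, ψ (s + d + 1) ω ∂P| ≤ C * σ ^ d)
    (hl : Tendsto (fun t => ∫ ω, ψ t ω ∂P) atTop (𝓝 l)) :
    ∀ᵐ ω ∂P, Tendsto (fun t : ℕ => (t : ℝ)⁻¹ * ∑ s ∈ Finset.range t, ψ s ω) atTop (𝓝 l) := by
  have hi : ∀ t, Integrable (ψ t) P := fun t =>
    .of_bound (hm t).aestronglyMeasurable A (.of_forall (hA t))
  have hEA : ∀ t, |∫ ω, ψ t ω ∂P| ≤ A := fun t => by
    simpa using norm_integral_le_of_norm_le_const (μ := P) (f := ψ t) (.of_forall (hA t))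
  set ζ : ℕ → Ω → ℝ := fun t ω => ψ t ω - ∫ ω, ψ t ω ∂P with hζ
  have hζm : ∀ t, Measurable (ζ t) := fun t => (hm t).sub_const _
  have hζA : ∀ t ω, |ζ t ω| ≤ A + A := fun t ω =>
    (abs_sub _ _).trans (add_le_add (hA t ω) (hEA t))
  have hζcov : ∀ s d, |∫ ω, ζ s ω * ζ (s + d + 1) ω ∂P| ≤ C * σ ^ d := by
    intro s d
    have hint : Integrable (fun ω => ψ s ω * ψ (s + d + 1) ω) P :=
      (hi _).bdd_mul (c := A) (hm s).aestronglyMeasurable (.of_forall (hA s))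
    have e : ∫ ω, ζ s ω * ζ (s + d + 1) ω ∂P = ∫ ω, ψ s ω * ψ (s + d + 1) ω ∂P -
      (∫ ω, ψ s ω ∂P) * ∫ ω, ψ (s + d + 1) ω ∂P := by
      set a := ∫ ω, ψ s ω ∂P with ha
      set b := ∫ ω, ψ (s + d + 1) ω ∂P with hb
      have : (fun ω => ζ s ω * ζ (s + d + 1) ω) = fun ω =>
          (ψ s ω * ψ (s + d + 1) ω - a * ψ (s + d + 1) ω) - (ψ s ω * b - a * b) := by
        ext ω; simp only [hζ]; ring
      have hint1 : Integrable (fun ω => ψ s ω * ψ (s + d + 1) ω - a * ψ (s + d + 1) ω) P :=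
        hint.sub ((hi _).const_mul a)
      have hint2 : Integrable (fun ω => ψ s ω * b - a * b) P :=
        ((hi s).mul_const b).sub (integrable_const _)
      rw [this, integral_sub hint1 hint2, integral_sub hint ((hi _).const_mul a),
        integral_sub ((hi s).mul_const b) (integrable_const _), integral_const_mul,
        integral_mul_const, ← ha, ← hb]
      simp
    rw [e]; exact hcov s d
  set D := 2 * (C * (1 - σ)⁻¹) + (A + A) ^ 2 with hD
  have hvar := fun t => integral_sq_sum_le hζm hζA hC hσ0 hσ1 hζcov t
  -- Averages along the squares: their second moments are O(k⁻²), hence summable, so they tend to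
  -- zero almost surely.
  set T : ℕ → Ω → ℝ := fun k ω =>
    ((((k + 1) ^ 2 : ℕ) : ℝ)⁻¹ * ∑ s ∈ Finset.range ((k + 1) ^ 2), ζ s ω) ^ 2 with hT
  have hTm : ∀ k, Measurable (T k) := fun k =>
    ((Finset.measurable_sum _ fun s _ => hζm s).const_mul _).pow_const 2
  have hD0 : 0 ≤ D := by
    have : 0 ≤ (1 - σ)⁻¹ := inv_nonneg.2 (by linarith)
    positivity
  have hTi : ∀ k, ∫⁻ ω, ENNReal.ofReal (T k ω) ∂P ≤
      ENNReal.ofReal (D * ((((k + 1 : ℕ) : ℝ) ^ 2))⁻¹) := by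
    intro k
    have hb : Integrable (T k) P := by
      refine .of_bound (hTm k).aestronglyMeasurable ((A + A) ^ 2) (.of_forall fun ω => ?_)
      rw [norm_pow]
      refine pow_le_pow_left₀ (norm_nonneg _) ?_ 2
      rw [norm_mul, norm_inv, Real.norm_natCast, inv_mul_le_iff₀ (by positivity)]
      refine (norm_sum_le _ _).trans ?_
      have := Finset.sum_le_card_nsmul (Finset.range ((k + 1) ^ 2)) _ (A + A) fun s _ => hζA s ω
      rwa [Finset.card_range, nsmul_eq_mul] at this
    rw [← ofReal_integral_eq_lintegral_ofReal hb (.of_forall fun ω => by positivity)]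
    refine ENNReal.ofReal_le_ofReal ?_
    simp only [hT, mul_pow]
    rw [integral_const_mul]
    have := hvar ((k + 1) ^ 2)
    have hk : (0 : ℝ) < ((k + 1) ^ 2 : ℕ) := by positivity
    calc _ ≤ ((((k + 1) ^ 2 : ℕ) : ℝ)⁻¹) ^ 2 * (((k + 1) ^ 2 : ℕ) * D) := by gcongr
      _ = _ := by push_cast; field_simp
  have hsum : ∑' k, ∫⁻ ω, ENNReal.ofReal (T k ω) ∂P ≠ ∞ := by
    have hs : Summable fun k : ℕ => D * ((((k + 1 : ℕ) : ℝ) ^ 2))⁻¹ :=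
      (((summable_nat_add_iff 1).2 (Real.summable_nat_pow_inv.2 one_lt_two))).mul_left D
    refine ne_top_of_le_ne_top ?_ (ENNReal.tsum_le_tsum hTi)
    rw [← ENNReal.ofReal_tsum_of_nonneg (fun k => by positivity) hs]
    exact ENNReal.ofReal_ne_top
  rw [← lintegral_tsum fun k => (hTm k).ennreal_ofReal.aemeasurable] at hsum
  filter_upwards [ae_lt_top (by
    exact Measurable.tsum fun k => (hTm k).ennreal_ofReal) hsum] with ω hω
  have h0 : Tendsto (fun k => T k ω) atTop (𝓝 0) := by
    have := (ENNReal.tendsto_toReal ENNReal.zero_ne_top).comp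
      (ENNReal.tendsto_atTop_zero_of_tsum_ne_top hω.ne)
    refine this.congr fun k => ?_
    simp only [Function.comp]
    exact ENNReal.toReal_ofReal (by positivity)
  have h1 : Tendsto (fun k : ℕ => ((((k + 1) ^ 2 : ℕ) : ℝ)⁻¹ *
      ∑ s ∈ Finset.range ((k + 1) ^ 2), ζ s ω)) atTop (𝓝 0) := by
    have := h0.sqrt
    simp only [hT, Real.sqrt_sq_eq_abs, Real.sqrt_zero] at this
    exact (tendsto_zero_iff_abs_tendsto_zero _).2 this
  have hsq : Tendsto (fun k : ℕ => (k + 1) ^ 2) atTop atTop :=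
    (tendsto_pow_atTop two_ne_zero).comp (tendsto_add_atTop_nat 1)
  have h2 := hl.cesaro.comp hsq
  have h3 : Tendsto (fun k : ℕ => ((((k + 1) ^ 2 : ℕ) : ℝ)⁻¹ *
      ∑ s ∈ Finset.range ((k + 1) ^ 2), ψ s ω)) atTop (𝓝 l) := by
    have := h1.add h2
    rw [zero_add] at this
    refine this.congr fun k => ?_
    simp only [Function.comp, hζ]
    rw [← mul_add, ← Finset.sum_add_distrib]
    simp
  -- Adding `A` makes the summands nonnegative and the partial sums monotone. Ratios of consecutive
  -- squares tend to one, so convergence along squares fills the gaps.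
  have h4 : Tendsto (fun t : ℕ => (∑ s ∈ Finset.range t, (ψ s ω + A)) / t) atTop (𝓝 (l + A)) := by
    refine tendsto_div_of_monotone_of_exists_subseq_tendsto_div _ _ ?_ fun a ha => ?_
    · refine monotone_nat_of_le_succ fun t => ?_
      rw [Finset.sum_range_succ]
      linarith [(abs_le.1 (hA t ω)).1]
    · refine ⟨fun k => (k + 1) ^ 2, ?_, hsq, ?_⟩
      · have : Tendsto (fun k : ℕ => (1 + 1 / ((k : ℝ) + 1)) ^ 2) atTop (𝓝 1) := by
          simpa using ((tendsto_one_div_add_atTop_nhds_zero_nat (𝕜 := ℝ)).const_add 1).pow 2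
        filter_upwards [this.eventually (gt_mem_nhds ha)] with k hk
        have : ((k + 1 + 1) ^ 2 : ℝ) = (1 + 1 / ((k : ℝ) + 1)) ^ 2 * ((k : ℝ) + 1) ^ 2 := by
          field_simp
        push_cast
        rw [this]
        exact mul_le_mul_of_nonneg_right hk.le (by positivity)
      · refine (h3.add_const A).congr fun k => ?_
        rw [Finset.sum_add_distrib, Finset.sum_const, Finset.card_range, nsmul_eq_mul]
        field_simp
  have h5 := h4.sub_const A
  rw [add_sub_cancel_right] at h5
  refine h5.congr' ?_
  filter_upwards [eventually_gt_atTop 0] with t ht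
  rw [Finset.sum_add_distrib, Finset.sum_const, Finset.card_range, nsmul_eq_mul]
  have : (0 : ℝ) < t := by exact_mod_cast ht
  field_simp
  ring

end LawOfLargeNumbers

/-! ### Decorrelation for chains whose kernel contracts oscillations. -/

section MixingChain

variable {Ω Z : Type*} [MeasurableSpace Ω] [MeasurableSpace Z]

/-- `ξ` is a Markov chain with transition kernel `K` that contracts oscillations by the factor
`ρ`. -/
structure IsMixingChain (P : Measure Ω) (ξ : Ω → ℕ → Z) (K : ProbabilityTheory.Kernel Z Z)
    (ρ : ℝ) : Prop where
  measurable : Measurable ξ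
  step : ∀ (T : ℕ) (H : (ℕ → Z) → ℝ) (A : ℝ), Measurable H → (∀ z, |H z| ≤ A) →
    DependsOn H (Set.Iic (T + 1)) →
    ∫ ω, H (ξ ω) ∂P = ∫ ω, ∫ z', H (Function.update (ξ ω) (T + 1) z') ∂(K (ξ ω T)) ∂P
  contract : ∀ (V : Z → ℝ) (a : ℝ), Measurable V → (∀ z z', |V z - V z'| ≤ a) →
    ∀ z z', |∫ x, V x ∂(K z) - ∫ x, V x ∂(K z')| ≤ ρ * a

namespace IsMixingChain

variable {P : Measure Ω} {ξ : Ω → ℕ → Z} {K : ProbabilityTheory.Kernel Z Z}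
  [ProbabilityTheory.IsMarkovKernel K] {ρ : ℝ}

/-- V is the conditional expectation of the block given its first coordinate, obtained by
integrating out the last coordinate repeatedly. The test function `G` of the past stands in for
conditioning, and V does not depend on the starting time `r`. -/
theorem exists_block (h : IsMixingChain P ξ K ρ) (n : ℕ) : ∀ (U : (ℕ → Z) → ℝ) (A : ℝ),
    Measurable U → (∀ z, |U z| ≤ A) → DependsOn U (Set.Iic n) →
    ∃ V : Z → ℝ, Measurable V ∧ (∀ z, |V z| ≤ A) ∧ ∀ (r : ℕ) (G : (ℕ → Z) → ℝ) (B : ℝ),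
      Measurable G → (∀ z, |G z| ≤ B) → DependsOn G (Set.Iic r) →
      ∫ ω, G (ξ ω) * U (fun j => ξ ω (j + r)) ∂P = ∫ ω, G (ξ ω) * V (ξ ω r) ∂P := by
  induction n with
  | zero =>
    intro U A hU hA hd
    refine ⟨fun a => U fun _ => a, hU.comp (measurable_pi_lambda _ fun _ => measurable_id),
      fun z => hA _, fun r G B _ _ _ => integral_congr_ae (.of_forall fun ω => ?_)⟩
    simp only
    congr 1
    refine hd fun i hi => ?_
    have : i = 0 := by simpa using hi
    simp [this]
  | succ n ih =>
    intro U A hU hA hd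
    set U' : (ℕ → Z) → ℝ := fun z => ∫ z', U (Function.update z (n + 1) z') ∂(K (z n)) with hU'
    have hupd : Measurable fun q : (ℕ → Z) × Z => U (Function.update q.1 (n + 1) q.2) :=
      hU.comp measurable_update'
    have hU'm : Measurable U' :=
      (StronglyMeasurable.integral_kernel_prod_right'
        (κ := K.comap (fun z : ℕ → Z => z n) (measurable_pi_apply n)) hupd.stronglyMeasurable).measurable
    have hU'A : ∀ z, |U' z| ≤ A := fun z => by
      simpa using norm_integral_le_of_norm_le_const (μ := K (z n))
        (f := fun z' => U (Function.update z (n + 1) z')) (.of_forall fun z' => hA _)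
    have hU'd : DependsOn U' (Set.Iic n) := by
      intro x y hxy
      simp only [hU']
      rw [hxy n (Set.mem_Iic.2 le_rfl)]
      refine integral_congr_ae (.of_forall fun z' => hd fun i hi => ?_)
      by_cases hin : i = n + 1
      · subst hin; simp
      · rw [Function.update_of_ne hin, Function.update_of_ne hin]
        refine hxy i ?_
        have : i ≤ n + 1 := hi
        exact Set.mem_Iic.2 (by omega)
    obtain ⟨V, hV, hVA, hVr⟩ := ih U' A hU'm hU'A hU'd
    refine ⟨V, hV, hVA, fun r G B hG hB hGd => ?_⟩
    rw [← hVr r G B hG hB hGd]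
    have hGU := h.step (n + r) (fun z => G z * U (fun j => z (j + r))) (B * A)
      (hG.mul (hU.comp (measurable_pi_lambda _ fun j => measurable_pi_apply _)))
      (fun z => by
        rw [abs_mul]
        exact mul_le_mul (hB z) (hA _) (abs_nonneg _) ((abs_nonneg _).trans (hB z)))
      (fun x y hxy => by
        have h1 : G x = G y := hGd fun i hi => hxy i (Set.mem_Iic.2 (by
          have : i ≤ r := hi
          omega))
        have h2 : U (fun j => x (j + r)) = U (fun j => y (j + r)) := hd fun i hi =>
          hxy (i + r) (Set.mem_Iic.2 (by
            have : i ≤ n + 1 := hi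
            omega))
        simp only [h1, h2])
    refine hGU.trans (integral_congr_ae (.of_forall fun ω => ?_))
    simp only [hU']
    rw [← integral_const_mul]
    refine integral_congr_ae (.of_forall fun z' => ?_)
    simp only
    congr 1
    · refine hGd fun i hi => Function.update_of_ne ?_ _ _
      have : i ≤ r := hi
      omega
    · congr 1
      ext j
      by_cases hj : j = n + 1
      · subst hj
        rw [Function.update_self, show n + 1 + r = n + r + 1 by ring, Function.update_self]
      · rw [Function.update_of_ne hj, Function.update_of_ne (by omega)]

/-- V' is V after `d` applications of the kernel, each contracting the oscillation by ρ. -/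
theorem exists_iterate (h : IsMixingChain P ξ K ρ) (d : ℕ) : ∀ (V : Z → ℝ) (A a : ℝ), Measurable V →
    (∀ z, |V z| ≤ A) → (∀ z z', |V z - V z'| ≤ a) →
    ∃ V' : Z → ℝ, Measurable V' ∧ (∀ z, |V' z| ≤ A) ∧ (∀ z z', |V' z - V' z'| ≤ ρ ^ d * a) ∧
      ∀ (s : ℕ) (G : (ℕ → Z) → ℝ) (B : ℝ), Measurable G → (∀ z, |G z| ≤ B) →
      DependsOn G (Set.Iic s) →
      ∫ ω, G (ξ ω) * V (ξ ω (s + d)) ∂P = ∫ ω, G (ξ ω) * V' (ξ ω s) ∂P := by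
  induction d with
  | zero =>
    intro V A a hV hA ha
    exact ⟨V, hV, hA, by simpa using ha, fun s G B _ _ _ => rfl⟩
  | succ d ih =>
    intro V A a hV hA ha
    have hKm : Measurable fun z => ∫ x, V x ∂(K z) :=
      (StronglyMeasurable.integral_kernel hV.stronglyMeasurable).measurable
    have hKA : ∀ z, |∫ x, V x ∂(K z)| ≤ A := fun z => by
      simpa using norm_integral_le_of_norm_le_const (μ := K z) (f := V) (.of_forall fun x => hA x)
    obtain ⟨V', hV', hVA', ha', hs'⟩ := ih _ A (ρ * a) hKm hKA (h.contract V a hV ha)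
    refine ⟨V', hV', hVA', fun z z' => (ha' z z').trans (le_of_eq (by ring)),
      fun s G B hG hB hGd => ?_⟩
    rw [← hs' s G B hG hB hGd]
    have := h.step (s + d) (fun z => G z * V (z (s + d + 1))) (B * A)
      (hG.mul (hV.comp (measurable_pi_apply _))) (fun z => by
        rw [abs_mul]
        exact mul_le_mul (hB z) (hA _) (abs_nonneg _) ((abs_nonneg _).trans (hB z)))
      (fun x y hxy => by
        have h1 : G x = G y := hGd fun i hi => hxy i (Set.mem_Iic.2 (by
          have : i ≤ s := hi
          omega))
        simp only [h1, hxy (s + d + 1) (Set.mem_Iic.2 le_rfl)])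
    refine this.trans (integral_congr_ae (.of_forall fun ω => ?_))
    simp only
    rw [← integral_const_mul]
    refine integral_congr_ae (.of_forall fun z' => ?_)
    simp only [Function.update_self]
    congr 1
    refine hGd fun i hi => Function.update_of_ne ?_ _ _
    have : i ≤ s := hi
    omega

variable [IsProbabilityMeasure P]

/-- Functions of the past and of the future of a mixing chain decorrelate exponentially fast. -/
theorem abs_covariance_le (h : IsMixingChain P ξ K ρ) {n : ℕ} {U G : (ℕ → Z) → ℝ}
    {A B : ℝ} (hU : Measurable U) (hA : ∀ z, |U z| ≤ A) (hUd : DependsOn U (Set.Iic n))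
    (s d : ℕ) (hG : Measurable G) (hB : ∀ z, |G z| ≤ B) (hGd : DependsOn G (Set.Iic s)) :
    |∫ ω, G (ξ ω) * U (fun j => ξ ω (j + (s + d))) ∂P -
      (∫ ω, G (ξ ω) ∂P) * ∫ ω, U (fun j => ξ ω (j + (s + d))) ∂P| ≤ B * (ρ ^ d * (2 * A)) := by
  obtain ⟨V, hV, hVA, hVr⟩ := h.exists_block n U A hU hA hUd
  obtain ⟨V', hV', hVA', hosc, hs'⟩ := h.exists_iterate d V A (2 * A) hV hVA (fun z z' =>
    (abs_sub _ _).trans (by linarith [hVA z, hVA z']))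
  have hone : DependsOn (fun _ : ℕ → Z => (1 : ℝ)) (Set.Iic s) := fun x y _ => rfl
  have hGd' : DependsOn G (Set.Iic (s + d)) := fun x y hxy =>
    hGd fun i hi => hxy i (Set.mem_Iic.2 (by have : i ≤ s := hi; omega))
  have e1 : ∫ ω, G (ξ ω) * U (fun j => ξ ω (j + (s + d))) ∂P = ∫ ω, G (ξ ω) * V' (ξ ω s) ∂P :=
    (hVr (s + d) G B hG hB hGd').trans (hs' s G B hG hB hGd)
  have e2 : ∫ ω, U (fun j => ξ ω (j + (s + d))) ∂P = ∫ ω, V' (ξ ω s) ∂P := by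
    have h1 := hVr (s + d) (fun _ => 1) 1 measurable_const (fun _ => by simp) (fun x y _ => rfl)
    have h2 := hs' s (fun _ => 1) 1 measurable_const (fun _ => by simp) hone
    simp only [one_mul] at h1 h2
    exact h1.trans h2
  have hξs : Measurable fun ω => ξ ω s := (measurable_pi_apply s).comp h.measurable
  have hGi : Integrable (fun ω => G (ξ ω)) P :=
    .of_bound (hG.comp h.measurable).aestronglyMeasurable B (.of_forall fun ω => hB _)
  have hGV : Integrable (fun ω => G (ξ ω) * V' (ξ ω s)) P :=
    hGi.mul_bdd (c := A) (hV'.comp hξs).aestronglyMeasurable (.of_forall fun ω => hVA' _)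
  have hVi : Integrable (fun ω => V' (ξ ω s)) P :=
    .of_bound (hV'.comp hξs).aestronglyMeasurable A (.of_forall fun ω => hVA' _)
  set v := ∫ ω, V' (ξ ω s) ∂P with hv
  -- After the gap the future is seen through V', which is almost constant and hence close to its
  -- mean.
  have hdev : ∀ ω, |V' (ξ ω s) - v| ≤ ρ ^ d * (2 * A) := by
    intro ω
    have : V' (ξ ω s) - v = ∫ ω', (V' (ξ ω s) - V' (ξ ω' s)) ∂P := by
      rw [integral_sub (integrable_const _) hVi]; simp [hv]
    rw [this]
    simpa using norm_integral_le_of_norm_le_const (μ := P)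
      (f := fun ω' => V' (ξ ω s) - V' (ξ ω' s)) (.of_forall fun ω' => hosc _ _)
  rw [e1, e2, ← integral_mul_const, ← integral_sub hGV (hGi.mul_const v)]
  have : (fun ω => G (ξ ω) * V' (ξ ω s) - G (ξ ω) * v) = fun ω => G (ξ ω) * (V' (ξ ω s) - v) := by
    ext ω; ring
  rw [this]
  have := norm_integral_le_of_norm_le_const (μ := P) (f := fun ω => G (ξ ω) * (V' (ξ ω s) - v))
    (C := B * (ρ ^ d * (2 * A))) (.of_forall fun ω => by
      rw [norm_mul]
      exact mul_le_mul (hB _) (hdev ω) (norm_nonneg _) ((abs_nonneg _).trans (hB (ξ ω))))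
  simpa using this

/-- The law of a block of a mixing chain converges exponentially fast. -/
theorem abs_integral_shift_sub_le (h : IsMixingChain P ξ K ρ) {n : ℕ} {U : (ℕ → Z) → ℝ}
    {A : ℝ} (hU : Measurable U) (hA : ∀ z, |U z| ≤ A) (hUd : DependsOn U (Set.Iic n)) (d : ℕ) :
    |∫ ω, U (fun j => ξ ω (j + (d + 1))) ∂P - ∫ ω, U (fun j => ξ ω (j + d)) ∂P| ≤
      ρ ^ d * (2 * A) := by
  obtain ⟨V, hV, hVA, hVr⟩ := h.exists_block n U A hU hA hUd
  obtain ⟨V', hV', hVA', hosc, hs'⟩ := h.exists_iterate d V A (2 * A) hV hVA (fun z z' =>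
    (abs_sub _ _).trans (by linarith [hVA z, hVA z']))
  have e : ∀ s, ∫ ω, U (fun j => ξ ω (j + (s + d))) ∂P = ∫ ω, V' (ξ ω s) ∂P := by
    intro s
    have h1 := hVr (s + d) (fun _ => 1) 1 measurable_const (fun _ => by simp) (fun x y _ => rfl)
    have h2 := hs' s (fun _ => 1) 1 measurable_const (fun _ => by simp) (fun x y _ => rfl)
    simp only [one_mul] at h1 h2
    exact h1.trans h2
  have e0 := e 0
  rw [zero_add] at e0
  rw [show d + 1 = 1 + d by ring, e 1, e0]
  have hVi : ∀ s, Integrable (fun ω => V' (ξ ω s)) P := fun s =>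
    .of_bound (hV'.comp ((measurable_pi_apply s).comp h.measurable)).aestronglyMeasurable A
      (.of_forall fun ω => hVA' _)
  rw [← integral_sub (hVi 1) (hVi 0)]
  simpa using norm_integral_le_of_norm_le_const (μ := P)
    (f := fun ω => V' (ξ ω 1) - V' (ξ ω 0)) (.of_forall fun ω => hosc _ _)

end IsMixingChain

end MixingChain

/-! ### Ergodic limits of forgetting functionals and their derivatives. -/

section ErgodicLimit

/-- With σ = √τ, rates τ^(d/2) with rounded exponent become geometric at the cost of a factor σ⁻¹.
-/
theorem pow_half_le {σ : ℝ} (h0 : 0 < σ) (h1 : σ < 1) (d : ℕ) : (σ ^ 2) ^ (d / 2) ≤ σ⁻¹ * σ ^ d := by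
  rw [le_inv_mul_iff₀ h0, ← pow_mul, ← pow_succ']
  exact pow_le_pow_of_le_one h0.le h1.le (by omega)

variable {Ω Z : Type*} [MeasurableSpace Ω] [MeasurableSpace Z]

/-- A sequence of functionals `φ t` of the path up to time `t + 1` which is approximated, up to
exponentially small errors, by functionals `u n` of the last `n + 1` coordinates. -/
structure IsForgetting (φ u : ℕ → (ℕ → Z) → ℝ) (A c τ : ℝ) : Prop where
  measurable : ∀ t, Measurable (φ t)
  measurable_block : ∀ n, Measurable (u n)
  bound : ∀ t z, |φ t z| ≤ A
  bound_block : ∀ n z, |u n z| ≤ A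
  dependsOn : ∀ t, DependsOn (φ t) (Set.Iic (t + 1))
  dependsOn_block : ∀ n, DependsOn (u n) (Set.Iic (n + 1))
  close : ∀ k n z, |φ (k + 1 + n) z - u n (fun j => z (j + (k + 1)))| ≤ c * τ ^ n

namespace IsForgetting

variable {P : Measure Ω} [IsProbabilityMeasure P] {ξ : Ω → ℕ → Z} {K : ProbabilityTheory.Kernel Z Z}
  {φ u : ℕ → (ℕ → Z) → ℝ} {A c τ : ℝ}

theorem integrable (hφ : IsForgetting φ u A c τ) (h : IsMixingChain P ξ K τ) (t : ℕ) :
    Integrable (fun ω => φ t (ξ ω)) P :=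
  .of_bound ((hφ.measurable t).comp h.measurable).aestronglyMeasurable A
    (.of_forall fun _ => hφ.bound t _)

theorem integrable_block (hφ : IsForgetting φ u A c τ) (h : IsMixingChain P ξ K τ) (n k : ℕ) :
    Integrable (fun ω => u n (fun j => ξ ω (j + k))) P :=
  .of_bound ((hφ.measurable_block n).comp (measurable_pi_lambda _ fun _ =>
    (measurable_pi_apply _).comp h.measurable)).aestronglyMeasurable A
    (.of_forall fun _ => hφ.bound_block n _)

theorem abs_integral_sub_block_le (hφ : IsForgetting φ u A c τ) (h : IsMixingChain P ξ K τ)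
    (k n : ℕ) : |∫ ω, φ (k + 1 + n) (ξ ω) ∂P - ∫ ω, u n (fun j => ξ ω (j + (k + 1))) ∂P| ≤
      c * τ ^ n := by
  rw [← integral_sub (hφ.integrable h _) (hφ.integrable_block h _ _)]
  simpa using norm_integral_le_of_norm_le_const (μ := P)
    (f := fun ω => φ (k + 1 + n) (ξ ω) - u n (fun j => ξ ω (j + (k + 1))))
    (.of_forall fun ω => hφ.close k n (ξ ω))

variable [ProbabilityTheory.IsMarkovKernel K]

/-- Both functionals are compared with the same block functional `u n` with `n = t / 2`, started one
step apart. The first half of the time makes the law of the block nearly stationary, the second half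
makes the block approximation accurate. -/
theorem abs_integral_succ_sub_le (hφ : IsForgetting φ u A c τ) (h : IsMixingChain P ξ K τ)
    (hA : 0 ≤ A) (hτ0 : 0 ≤ τ) (hτ1 : τ ≤ 1) (t : ℕ) :
    |∫ ω, φ (t + 2) (ξ ω) ∂P - ∫ ω, φ (t + 1) (ξ ω) ∂P| ≤ (2 * c + 2 * A) * τ ^ (t / 2) := by
  set n := t / 2
  set k := t - t / 2
  have h1 := hφ.abs_integral_sub_block_le h k n
  have h2 := hφ.abs_integral_sub_block_le h (k + 1) n
  have h3 := h.abs_integral_shift_sub_le (hφ.measurable_block n) (hφ.bound_block n)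
    (hφ.dependsOn_block n) (k + 1)
  rw [show k + 1 + n = t + 1 by omega] at h1
  rw [show k + 1 + 1 + n = t + 2 by omega] at h2
  have h4 : τ ^ (k + 1) * (2 * A) ≤ τ ^ n * (2 * A) :=
    mul_le_mul_of_nonneg_right (pow_le_pow_of_le_one hτ0 hτ1 (by omega)) (by positivity)
  rw [abs_le] at *
  constructor <;> nlinarith [h1.1, h1.2, h2.1, h2.2, h3.1, h3.2]

/-- The lag is halved: the later functional is replaced by one of its last `d - d / 2` steps, which
leaves a gap of `d / 2` for the chain to decorrelate. -/
theorem abs_covariance_le (hφ : IsForgetting φ u A c τ) (h : IsMixingChain P ξ K τ)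
    (hA : 0 ≤ A) (hc : 0 ≤ c) (hτ0 : 0 ≤ τ) (hτ1 : τ ≤ 1) (s d : ℕ) :
    |∫ ω, φ s (ξ ω) * φ (s + d + 1) (ξ ω) ∂P -
      (∫ ω, φ s (ξ ω) ∂P) * ∫ ω, φ (s + d + 1) (ξ ω) ∂P| ≤
      (2 * A * c + 2 * A * A) * τ ^ (d / 2) := by
  set j := d / 2
  set n := d - d / 2
  set k := s + j
  have hk : s + d + 1 = k + 1 + n := by omega
  rw [hk]
  have h1 := hφ.abs_integral_sub_block_le h k n
  have h2 := h.abs_covariance_le (hφ.measurable_block n) (hφ.bound_block n)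
    (hφ.dependsOn_block n) (s + 1) j (hφ.measurable s) (hφ.bound s) (hφ.dependsOn s)
  rw [show s + 1 + j = k + 1 by omega] at h2
  have hb : ∀ {f : Ω → ℝ}, Integrable f P → Integrable (fun ω => φ s (ξ ω) * f ω) P := fun hf =>
    hf.bdd_mul (c := A) ((hφ.measurable s).comp h.measurable).aestronglyMeasurable
      (.of_forall fun ω => hφ.bound s _)
  have h3 : |∫ ω, φ s (ξ ω) * φ (k + 1 + n) (ξ ω) ∂P -
      ∫ ω, φ s (ξ ω) * u n (fun j => ξ ω (j + (k + 1))) ∂P| ≤ A * (c * τ ^ n) := by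
    rw [← integral_sub (hb (hφ.integrable h _)) (hb (hφ.integrable_block h _ _))]
    have := norm_integral_le_of_norm_le_const (μ := P) (C := A * (c * τ ^ n))
      (f := fun ω => φ s (ξ ω) * φ (k + 1 + n) (ξ ω) -
        φ s (ξ ω) * u n (fun j => ξ ω (j + (k + 1)))) (.of_forall fun ω => by
        rw [← mul_sub, norm_mul]
        exact mul_le_mul (hφ.bound s _) (hφ.close k n (ξ ω)) (norm_nonneg _) hA)
    simpa using this
  have h4 : |∫ ω, φ s (ξ ω) ∂P| ≤ A := by
    simpa using norm_integral_le_of_norm_le_const (μ := P) (f := fun ω => φ s (ξ ω))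
      (.of_forall fun ω => hφ.bound s (ξ ω))
  have h5 : |(∫ ω, φ s (ξ ω) ∂P) * (∫ ω, φ (k + 1 + n) (ξ ω) ∂P -
      ∫ ω, u n (fun j => ξ ω (j + (k + 1))) ∂P)| ≤ A * (c * τ ^ n) := by
    rw [abs_mul]; exact mul_le_mul h4 h1 (abs_nonneg _) hA
  have h6 : A * (c * τ ^ n) ≤ A * (c * τ ^ j) := by
    have : τ ^ n ≤ τ ^ j := pow_le_pow_of_le_one hτ0 hτ1 (by omega)
    gcongr
  rw [mul_sub] at h5
  have e : (2 * A * c + 2 * A * A) * τ ^ j =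
    A * (c * τ ^ j) + A * (c * τ ^ j) + A * (τ ^ j * (2 * A)) := by ring
  rw [e]
  rw [abs_le] at *
  constructor <;> linarith [h2.1, h2.2, h3.1, h3.2, h5.1, h5.2]

/-- Successive expectations differ by a summable amount. The tail bound depends only on the
constants, hence is uniform over a parametric family, as needed to pass derivatives to the limit. -/
theorem exists_limit (hφ : IsForgetting φ u A c τ) (h : IsMixingChain P ξ K τ)
    (hA : 0 ≤ A) (hτ0 : 0 < τ) (hτ1 : τ < 1) :
    ∃ l : ℝ, Tendsto (fun t => ∫ ω, φ (t + 1) (ξ ω) ∂P) atTop (𝓝 l) ∧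
      ∀ t, |∫ ω, φ (t + 1) (ξ ω) ∂P - l| ≤ ∑' m, (2 * c + 2 * A) * τ ^ ((t + m) / 2) := by
  set σ := Real.sqrt τ
  have hσ0 : 0 < σ := Real.sqrt_pos.2 hτ0
  have hσ1 : σ < 1 := by rw [Real.sqrt_lt' one_pos]; simpa using hτ1
  have hσ : τ = σ ^ 2 := (Real.sq_sqrt hτ0.le).symm
  have hs : Summable fun t : ℕ => (2 * c + 2 * A) * τ ^ (t / 2) := by
    refine Summable.mul_left _ (Summable.of_nonneg_of_le (fun t => by positivity) (fun t => ?_)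
      ((summable_geometric_of_lt_one hσ0.le hσ1).mul_left σ⁻¹))
    rw [hσ]; exact pow_half_le hσ0 hσ1 t
  have hd : ∀ t, dist (∫ ω, φ (t + 1) (ξ ω) ∂P) (∫ ω, φ (t.succ + 1) (ξ ω) ∂P) ≤
      (2 * c + 2 * A) * τ ^ (t / 2) := fun t => by
    rw [dist_comm, Real.dist_eq]
    exact hφ.abs_integral_succ_sub_le h hA hτ0.le hτ1.le t
  obtain ⟨l, hl⟩ := cauchySeq_tendsto_of_complete (cauchySeq_of_dist_le_of_summable _ hd hs)
  exact ⟨l, hl, fun t => by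
    simpa only [Real.dist_eq] using dist_le_tsum_of_dist_le_of_tendsto _ hd hs hl t⟩

theorem tendsto_tail_zero (A c τ : ℝ) :
    Tendsto (fun t : ℕ => ∑' m, (2 * c + 2 * A) * τ ^ ((t + m) / 2)) atTop (𝓝 0) := by
  simpa only [add_comm] using tendsto_sum_nat_add fun t : ℕ => (2 * c + 2 * A) * τ ^ (t / 2)

theorem ae_tendsto_average (hφ : IsForgetting φ u A c τ) (h : IsMixingChain P ξ K τ)
    (hA : 0 ≤ A) (hc : 0 ≤ c) (hτ0 : 0 < τ) (hτ1 : τ < 1) {l : ℝ}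
    (hl : Tendsto (fun t => ∫ ω, φ (t + 1) (ξ ω) ∂P) atTop (𝓝 l)) :
    ∀ᵐ ω ∂P, Tendsto (fun t : ℕ => (t : ℝ)⁻¹ * ∑ s ∈ Finset.range t, φ s (ξ ω)) atTop (𝓝 l) := by
  set σ := Real.sqrt τ
  have hσ0 : 0 < σ := Real.sqrt_pos.2 hτ0
  have hσ1 : σ < 1 := by rw [Real.sqrt_lt' one_pos]; simpa using hτ1
  have hσ : τ = σ ^ 2 := (Real.sq_sqrt hτ0.le).symm
  have key : ∀ d, (2 * A * c + 2 * A * A) * τ ^ (d / 2) ≤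
      (2 * A * c + 2 * A * A) * σ⁻¹ * σ ^ d := fun d => by
    have h0 : 0 ≤ 2 * A * c + 2 * A * A := by positivity
    have h1 : τ ^ (d / 2) ≤ σ⁻¹ * σ ^ d := by rw [hσ]; exact pow_half_le hσ0 hσ1 d
    rw [mul_assoc (2 * A * c + 2 * A * A)]
    exact mul_le_mul_of_nonneg_left h1 h0
  exact ae_tendsto_average_of_covariance (ψ := fun t ω => φ t (ξ ω)) (σ := σ)
    (C := (2 * A * c + 2 * A * A) * σ⁻¹)
    (fun t => (hφ.measurable t).comp h.measurable) (fun t ω => hφ.bound t _) (by positivity)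
    hσ0.le hσ1 (fun s d => (hφ.abs_covariance_le h hA hc hτ0.le hτ1.le s d).trans (key d))
    ((tendsto_add_atTop_iff_nat 1).1 hl)

end IsForgetting

/-- Ergodic averages of forgetting families along a mixing chain converge to a differentiable
function, and gradients of expectations converge to its gradient. -/
theorem exists_ergodic_limit {p : ℕ} {Θ : Set (Fin p → ℝ)} (hΘ : IsParameterSet Θ)
    {P : Measure Ω} [IsProbabilityMeasure P] {ξ : Ω → ℕ → Z} {K : ProbabilityTheory.Kernel Z Z}
    [ProbabilityTheory.IsMarkovKernel K] {A c τ : ℝ} (h : IsMixingChain P ξ K τ)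
    (hA : 0 ≤ A) (hc : 0 ≤ c) (hτ0 : 0 < τ) (hτ1 : τ < 1)
    {F G : ℕ → (Fin p → ℝ) → (ℕ → Z) → ℝ} (hF : ∀ t, C1Family Θ A (F t))
    (hG : ∀ n, C1Family Θ A (G n))
    (hFd : ∀ t, ∀ θ ∈ Θ, DependsOn (F t θ) (Set.Iic (t + 1)))
    (hGd : ∀ n, ∀ θ ∈ Θ, DependsOn (G n θ) (Set.Iic (n + 1)))
    (hFG : ∀ k n, C1Family Θ (c * τ ^ n)
      (fun θ z => F (k + 1 + n) θ z - G n θ (fun j => z (j + (k + 1))))) :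
    ∃ l : (Fin p → ℝ) → ℝ, DifferentiableOn ℝ l Θ ∧
      (∀ θ ∈ Θ, ∀ᵐ ω ∂P, Tendsto
        (fun t : ℕ => (t : ℝ)⁻¹ * ∑ s ∈ Finset.range t, F s θ (ξ ω)) atTop (𝓝 (l θ))) ∧
      ∀ θ ∈ Θ, ∀ i, Tendsto (fun t => ∫ ω, famGrad Θ i (F (t + 1)) θ (ξ ω) ∂P) atTop
        (𝓝 (relGrad Θ l θ i)) := by
  have hval : ∀ θ ∈ Θ, IsForgetting (fun t => F t θ) (fun n => G n θ) A c τ := fun θ hθ =>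
    ⟨fun t => (hF t).measurable θ hθ, fun n => (hG n).measurable θ hθ,
      fun t => (hF t).bound θ hθ, fun n => (hG n).bound θ hθ, fun t => hFd t θ hθ,
      fun n => hGd n θ hθ, fun k n z => (hFG k n).bound θ hθ z⟩
  have hdep : ∀ (F : (Fin p → ℝ) → (ℕ → Z) → ℝ) (s : Set ℕ), (∀ θ ∈ Θ, DependsOn (F θ) s) →
      ∀ θ ∈ Θ, ∀ i, DependsOn (famGrad Θ i F θ) s := fun F s hF θ hθ i x y hxy => by
    simp only [famGrad]
    rw [relGrad_congr (fun θ hθ => hF θ hθ hxy) hθ]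
  -- The partial derivatives forget at the same rate as the values, so their expectations converge
  -- with the same error bound for all θ.
  have hgrad : ∀ θ ∈ Θ, ∀ i, IsForgetting (fun t => famGrad Θ i (F t) θ)
      (fun n => famGrad Θ i (G n) θ) A c τ := fun θ hθ i =>
    ⟨fun t => (hF t).measurable_famGrad hΘ hθ i, fun n => (hG n).measurable_famGrad hΘ hθ i,
      fun t z => (hF t).grad θ hθ z i, fun n z => (hG n).grad θ hθ z i,
      fun t => hdep _ _ (hFd t) θ hθ i, fun n => hdep _ _ (hGd n) θ hθ i, fun k n z => by
        have hs : Measurable fun z : ℕ → Z => fun j => z (j + (k + 1)) := by fun_prop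
        have := (hFG k n).grad θ hθ z i
        rwa [(hF (k + 1 + n)).famGrad_sub ((hG n).comp hs) hΘ hθ] at this⟩
  choose! l hl using fun θ hθ => (hval θ hθ).exists_limit h hA hτ0 hτ1
  choose! a ha using fun θ hθ i => (hgrad θ hθ i).exists_limit h hA hτ0 hτ1
  have hder := fun t θ hθ => ((hF (t + 1)).comp h.measurable).hasFDerivWithinAt_integral hΘ hθ P
    (θ := θ)
  -- Expectations are differentiable and their gradients converge uniformly, so limit and gradient
  -- commute. The almost sure limit itself is never differentiated pathwise.
  have hld : ∀ θ ∈ Θ, HasFDerivWithinAt l (coordFunctional (a θ)) Θ θ := fun θ hθ =>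
    hasFDerivWithinAt_of_uniform_limit hΘ (F := fun t θ => ∫ ω, F (t + 1) θ (ξ ω) ∂P)
      (IsForgetting.tendsto_tail_zero A c τ)
      (fun t θ hθ => (hder t θ hθ).differentiableWithinAt) (fun θ hθ => (hl θ hθ).1)
      (fun θ hθ i t => by
        rw [relGrad_of_hasFDerivWithinAt hΘ hθ (hder t θ hθ)]
        exact (ha θ hθ i).2 t) hθ
  refine ⟨l, fun θ hθ => (hld θ hθ).differentiableWithinAt, fun θ hθ =>
    (hval θ hθ).ae_tendsto_average h hA hc hτ0 hτ1 (hl θ hθ).1, fun θ hθ i => ?_⟩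
  rw [relGrad_of_hasFDerivWithinAt hΘ hθ (hld θ hθ)]
  exact (ha θ hθ i).1

end ErgodicLimit

/-! ### Splitting the last state and observation off a path. -/

section Splitting

theorem measurePreserving_prodProdProdComm {A B C D : Type*} [MeasurableSpace A] [MeasurableSpace B]
    [MeasurableSpace C] [MeasurableSpace D] (a : Measure A) (b : Measure B) (c : Measure C)
    (d : Measure D) [SFinite a] [SFinite b] [SFinite c] [SFinite d] :
    MeasurePreserving (fun z : (A × B) × (C × D) => ((z.1.1, z.2.1), (z.1.2, z.2.2)))
      ((a.prod b).prod (c.prod d)) ((a.prod c).prod (b.prod d)) := by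
  have h1 := measurePreserving_prodAssoc a b (c.prod d)
  have h2 := (MeasurePreserving.id a).prod ((measurePreserving_prodAssoc b c d).symm)
  have h3 := (MeasurePreserving.id a).prod
    ((Measure.measurePreserving_swap (μ := b) (ν := c)).prod (MeasurePreserving.id d))
  have h4 := (MeasurePreserving.id a).prod (measurePreserving_prodAssoc c b d)
  have h5 := (measurePreserving_prodAssoc a c (b.prod d)).symm
  exact h5.comp (h4.comp (h3.comp (h2.comp h1)))

theorem measurePreserving_snoc {X : Type*} [MeasurableSpace X] (μ : Measure X) [SigmaFinite μ]
    (n : ℕ) : MeasurePreserving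
      (fun z : (Fin n → X) × X => Fin.snoc (α := fun _ => X) z.1 z.2)
      ((Measure.pi fun _ => μ).prod μ) (Measure.pi fun _ : Fin (n + 1) => μ) := by
  have h1 := (measurePreserving_piFinSuccAbove (fun _ : Fin (n + 1) => μ) (Fin.last n)).symm
  have h2 := h1.comp (Measure.measurePreserving_swap (μ := Measure.pi fun _ : Fin n => μ) (ν := μ))
  convert h2 using 1
  ext z i
  simp [MeasurableEquiv.piFinSuccAbove, Fin.insertNthEquiv, Fin.insertNth_last']

theorem measurable_ssmDensity {X Y : Type*} [MeasurableSpace X] [MeasurableSpace Y] {m0 : X → ℝ}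
    {m : X → X → ℝ} {g : X → Y → ℝ} (h0 : Measurable m0) (hm : Measurable (Function.uncurry m))
    (hg : Measurable (Function.uncurry g)) (T : ℕ) :
    Measurable fun z : (Fin (T + 1) → X) × (Fin (T + 1) → Y) => ssmDensity m0 m g T z.1 z.2 := by
  have hx : ∀ i, Measurable fun z : (Fin (T + 1) → X) × (Fin (T + 1) → Y) => z.1 i := fun i =>
    (measurable_pi_apply i).comp measurable_fst
  have hy : ∀ i, Measurable fun z : (Fin (T + 1) → X) × (Fin (T + 1) → Y) => z.2 i := fun i =>
    (measurable_pi_apply i).comp measurable_snd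
  refine ((h0.comp (hx 0)).mul (hg.comp ((hx 0).prodMk (hy 0)))).mul
    (Finset.measurable_prod _ fun t _ => ?_)
  exact (hm.comp ((hx _).prodMk (hx _))).mul (hg.comp ((hx _).prodMk (hy _)))

theorem ssmDensity_nonneg {X Y : Type*} {m0 : X → ℝ} {m : X → X → ℝ} {g : X → Y → ℝ}
    (h0 : ∀ x, 0 ≤ m0 x) (hm : ∀ x x', 0 ≤ m x x') (hg : ∀ x y, 0 ≤ g x y) (T : ℕ)
    (x : Fin (T + 1) → X) (y : Fin (T + 1) → Y) : 0 ≤ ssmDensity m0 m g T x y :=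
  mul_nonneg (mul_nonneg (h0 _) (hg _ _))
    (Finset.prod_nonneg fun _ _ => mul_nonneg (hm _ _) (hg _ _))

/-- The Markov property in terms of densities. It gives both the transition kernel of the chain and
the filter recursion. -/
theorem ssmDensity_snoc {X Y : Type*} (m0 : X → ℝ) (m : X → X → ℝ) (g : X → Y → ℝ) (T : ℕ)
    (x : Fin (T + 1) → X) (y : Fin (T + 1) → Y) (x' : X) (y' : Y) :
    ssmDensity m0 m g (T + 1) (Fin.snoc (α := fun _ => X) x x') (Fin.snoc (α := fun _ => Y) y y') =
      ssmDensity m0 m g T x y * (m (x (Fin.last T)) x' * g x' y') := by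
  have hc : ∀ {A : Type _} (a : Fin (T + 1) → A) (a' : A) (i : Fin (T + 1)),
      (Fin.snoc (α := fun _ => A) a a' : Fin (T + 2) → A) i.castSucc = a i :=
    fun a a' i => Fin.snoc_castSucc ..
  have hl : ∀ {A : Type _} (a : Fin (T + 1) → A) (a' : A),
      (Fin.snoc (α := fun _ => A) a a' : Fin (T + 2) → A) (Fin.last (T + 1)) = a' :=
    fun a a' => Fin.snoc_last ..
  unfold ssmDensity
  rw [Fin.prod_univ_castSucc]
  have h0 : (0 : Fin (T + 2)) = (0 : Fin (T + 1)).castSucc := rfl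
  rw [h0, hc, Fin.snoc_castSucc (α := fun _ => Y), Fin.succ_last, hl, hc,
    Fin.snoc_last (α := fun _ => Y), mul_assoc, mul_assoc, mul_assoc]
  congr 3
  refine Finset.prod_congr rfl fun t _ => ?_
  rw [Fin.succ_castSucc, hc, hc, Fin.snoc_castSucc (α := fun _ => Y)]

end Splitting

/-! ### A state-space model is a mixing chain. -/

section StateSpaceModel

variable {X Y Ω : Type*} [MeasurableSpace X] [MeasurableSpace Y] [MeasurableSpace Ω]
  {lamX : Measure X} {lamY : Measure Y} {m0 : X → ℝ} {m : X → X → ℝ} {g : X → Y → ℝ}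
  {P : Measure Ω} {Xs : ℕ → Ω → X} {Ys : ℕ → Ω → Y}

theorem IsTransitionDensity.integrable {A B : Type*} [MeasurableSpace A] [MeasurableSpace B]
    {μ : Measure B} {k : A → B → ℝ} (hk : IsTransitionDensity μ k) (a : A) :
    Integrable (k a) μ := by
  by_contra h
  have := hk.integral_eq_one a
  rw [integral_undef h] at this
  exact zero_ne_one this

theorem measurable_ssmKernel_density (hm : IsTransitionDensity lamX m)
    (hg : IsTransitionDensity lamY g) : Measurable (Function.uncurry fun (z z' : X × Y) =>
      ENNReal.ofReal (m z.1 z'.1 * g z'.1 z'.2)) :=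
  ((hm.measurable.comp (f := fun q : (X × Y) × (X × Y) => (q.1.1, q.2.1)) (by fun_prop)).mul
    (hg.measurable.comp (f := fun q : (X × Y) × (X × Y) => q.2) (by fun_prop))).ennreal_ofReal

variable [IsFiniteMeasure lamX] [IsFiniteMeasure lamY]

/-- The transition kernel of the chain of states and observations. -/
def ssmKernel (lamX : Measure X) (lamY : Measure Y) [IsFiniteMeasure lamX] [IsFiniteMeasure lamY]
    (m : X → X → ℝ) (g : X → Y → ℝ) : ProbabilityTheory.Kernel (X × Y) (X × Y) :=
  (ProbabilityTheory.Kernel.const (X × Y) (lamX.prod lamY)).withDensity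
    fun z z' => ENNReal.ofReal (m z.1 z'.1 * g z'.1 z'.2)

theorem ssmKernel_apply (hm : IsTransitionDensity lamX m) (hg : IsTransitionDensity lamY g)
    (z : X × Y) : ssmKernel lamX lamY m g z = (lamX.prod lamY).withDensity
      fun z' => ENNReal.ofReal (m z.1 z'.1 * g z'.1 z'.2) := by
  rw [ssmKernel, ProbabilityTheory.Kernel.withDensity_apply _ (measurable_ssmKernel_density hm hg),
    ProbabilityTheory.Kernel.const_apply]

theorem integral_ssmKernel (hm : IsTransitionDensity lamX m) (hg : IsTransitionDensity lamY g)
    (z : X × Y) (V : X × Y → ℝ) : ∫ z', V z' ∂(ssmKernel lamX lamY m g z) =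
      ∫ z', V z' * (m z.1 z'.1 * g z'.1 z'.2) ∂(lamX.prod lamY) := by
  have hd : Measurable fun z' : X × Y => ENNReal.ofReal (m z.1 z'.1 * g z'.1 z'.2) :=
    (measurable_ssmKernel_density hm hg).comp measurable_prodMk_left
  rw [ssmKernel_apply hm hg, integral_withDensity_eq_integral_toReal_smul hd
    (.of_forall fun _ => ENNReal.ofReal_lt_top)]
  refine integral_congr_ae (.of_forall fun z' => ?_)
  simp only [smul_eq_mul]
  rw [ENNReal.toReal_ofReal (mul_nonneg (hm.nonneg _ _) (hg.nonneg _ _)), mul_comm]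

theorem integrable_mul_density {h : X → ℝ} (hh : Integrable h lamX)
    (hh0 : ∀ x, 0 ≤ h x) (hhm : Measurable h) (hg : IsTransitionDensity lamY g) :
    Integrable (fun z : X × Y => h z.1 * g z.1 z.2) (lamX.prod lamY) ∧
      ∫ z, h z.1 * g z.1 z.2 ∂(lamX.prod lamY) = ∫ x, h x ∂lamX := by
  have hi : Integrable (fun z : X × Y => h z.1 * g z.1 z.2) (lamX.prod lamY) := by
    have hm : Measurable fun z : X × Y => h z.1 * g z.1 z.2 :=
      (hhm.comp measurable_fst).mul hg.measurable
    rw [integrable_prod_iff hm.aestronglyMeasurable]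
    refine ⟨.of_forall fun x => (hg.integrable x).const_mul (h x), ?_⟩
    refine hh.congr (.of_forall fun x => ?_)
    simp only [norm_mul, Real.norm_eq_abs, abs_of_nonneg (hh0 x), abs_of_nonneg (hg.nonneg _ _)]
    rw [integral_const_mul, hg.integral_eq_one, mul_one]
  refine ⟨hi, ?_⟩
  rw [integral_prod _ hi]
  refine integral_congr_ae (.of_forall fun x => ?_)
  simp only
  rw [integral_const_mul, hg.integral_eq_one, mul_one]

theorem isMarkovKernel_ssmKernel (hm : IsTransitionDensity lamX m)
    (hg : IsTransitionDensity lamY g) :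
    ProbabilityTheory.IsMarkovKernel (ssmKernel lamX lamY m g) := by
  refine ⟨fun z => ⟨?_⟩⟩
  have h := integrable_mul_density (hm.integrable z.1) (hm.nonneg z.1)
    (hm.measurable.comp measurable_prodMk_left) hg
  rw [ssmKernel_apply hm hg, withDensity_apply _ MeasurableSet.univ, Measure.restrict_univ,
    ← ofReal_integral_eq_lintegral_ofReal h.1
      (.of_forall fun z' => mul_nonneg (hm.nonneg _ _) (hg.nonneg _ _)), h.2,
    hm.integral_eq_one, ENNReal.ofReal_one]

/-- The joint density at time T + 1 is the one at time T multiplied by m·g, so Fubini gives the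
Markov step. For the contraction, m·g ≥ ε g, and g/Λ is a probability density on pairs. This is a
Doeblin condition with constant εΛ. -/
theorem IsSSM.isMixingChain [IsProbabilityMeasure P] {ε : ℝ} (hε : 0 < ε)
    (hm0 : Measurable m0) (hm00 : ∀ x, 0 ≤ m0 x)
    (hm : IsTransitionDensity lamX m) (hg : IsTransitionDensity lamY g)
    (hmε : ∀ x x', ε ≤ m x x') (hΛ : 0 < lamX.real Set.univ)
    (h : IsSSM lamX lamY m0 m g P Xs Ys) :
    IsMixingChain P (fun ω t => (Xs t ω, Ys t ω)) (ssmKernel lamX lamY m g)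
      (1 - ε * lamX.real Set.univ) := by
  refine ⟨measurable_pi_lambda _ fun t => (h.measurable_state t).prodMk (h.measurable_obs t), ?_, ?_⟩
  · intro T H A hH hA hd
    set dens := fun (T : ℕ) (z : (Fin (T + 1) → X) × (Fin (T + 1) → Y)) =>
      ssmDensity m0 m g T z.1 z.2 with hdens
    have hdm : ∀ T, Measurable (dens T) := fun T =>
      measurable_ssmDensity hm0 hm.measurable hg.measurable T
    have hd0 : ∀ T z, 0 ≤ dens T z := fun T z =>
      ssmDensity_nonneg hm00 hm.nonneg hg.nonneg T z.1 z.2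
    set path : (T : ℕ) → Ω → (Fin (T + 1) → X) × (Fin (T + 1) → Y) := fun T ω =>
      ((fun t : Fin (T + 1) => Xs t ω), (fun t : Fin (T + 1) => Ys t ω)) with hpath
    have hpm : ∀ T, Measurable (path T) := fun T =>
      (measurable_pi_lambda _ fun t : Fin (T + 1) => h.measurable_state t).prodMk
        (measurable_pi_lambda _ fun t : Fin (T + 1) => h.measurable_obs t)
    set pm : (T : ℕ) → Measure ((Fin (T + 1) → X) × (Fin (T + 1) → Y)) := fun T =>
      (Measure.pi fun _ : Fin (T + 1) => lamX).prod (Measure.pi fun _ : Fin (T + 1) => lamY) with hpmd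
    have hlaw : ∀ (T : ℕ) (Φ : (Fin (T + 1) → X) × (Fin (T + 1) → Y) → ℝ), Measurable Φ →
        ∫ ω, Φ (path T ω) ∂P = ∫ z, dens T z * Φ z ∂(pm T) := by
      intro T Φ hΦ
      rw [← integral_map (hpm T).aemeasurable hΦ.aestronglyMeasurable, h.law T,
        integral_withDensity_eq_integral_toReal_smul (hdm T).ennreal_ofReal
          (.of_forall fun _ => ENNReal.ofReal_lt_top)]
      refine integral_congr_ae (.of_forall fun z => ?_)
      simp only [smul_eq_mul]
      rw [ENNReal.toReal_ofReal (hd0 T z)]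
    have hdi : ∀ T, Integrable (dens T) (pm T) := by
      intro T
      have : IsProbabilityMeasure (P.map (path T)) :=
        Measure.isProbabilityMeasure_map (hpm T).aemeasurable
      refine ⟨(hdm T).aestronglyMeasurable, ?_⟩
      rw [hasFiniteIntegral_iff_ofReal (.of_forall (hd0 T))]
      have h1 : P.map (path T) Set.univ = 1 := measure_univ
      rw [h.law T, withDensity_apply _ MeasurableSet.univ, Measure.restrict_univ] at h1
      exact h1.trans_lt ENNReal.one_lt_top
    -- A finite path is continued as a constant after time `T`. The continuation is irrelevant,
    -- since only functionals of coordinates up to `T` are evaluated on it.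
    set ext : (T : ℕ) → (Fin (T + 1) → X) × (Fin (T + 1) → Y) → ℕ → X × Y := fun T z n =>
      (z.1 ⟨min n T, by omega⟩, z.2 ⟨min n T, by omega⟩) with hext
    have hextm : ∀ T, Measurable (ext T) := fun T => measurable_pi_lambda _ fun n =>
      ((measurable_pi_apply _).comp measurable_fst).prodMk
        ((measurable_pi_apply _).comp measurable_snd)
    have hextp : ∀ T ω, ∀ i ∈ Set.Iic T, (fun t => (Xs t ω, Ys t ω)) i = ext T (path T ω) i := by
      intro T ω i hi
      have : min i T = i := min_eq_left hi
      simp only [hext, hpath, this]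
    have hL : ∫ ω, H (fun t => (Xs t ω, Ys t ω)) ∂P =
        ∫ z, dens (T + 1) z * H (ext (T + 1) z) ∂(pm (T + 1)) := by
      rw [← hlaw (T + 1) (fun z => H (ext (T + 1) z)) (hH.comp (hextm _))]
      exact integral_congr_ae (.of_forall fun ω => hd (hextp (T + 1) ω))
    have hmark := isMarkovKernel_ssmKernel hm hg
    set H' : (ℕ → X × Y) → ℝ := fun z =>
      ∫ z', H (Function.update z (T + 1) z') ∂(ssmKernel lamX lamY m g (z T)) with hH'
    have hH'm : Measurable H' :=
      (StronglyMeasurable.integral_kernel_prod_right'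
        (κ := (ssmKernel lamX lamY m g).comap (fun z : ℕ → X × Y => z T) (measurable_pi_apply T))
        (hH.comp measurable_update' :
          Measurable fun q : (ℕ → X × Y) × (X × Y) =>
            H (Function.update q.1 (T + 1) q.2)).stronglyMeasurable).measurable
    have hH'd : DependsOn H' (Set.Iic T) := by
      intro x y hxy
      simp only [hH']
      rw [hxy T (Set.mem_Iic.2 le_rfl)]
      refine integral_congr_ae (.of_forall fun z' => hd fun i hi => ?_)
      by_cases hin : i = T + 1
      · subst hin; simp
      · rw [Function.update_of_ne hin, Function.update_of_ne hin]
        refine hxy i ?_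
        have : i ≤ T + 1 := hi
        exact Set.mem_Iic.2 (by omega)
    have hR : ∫ ω, H' (fun t => (Xs t ω, Ys t ω)) ∂P =
        ∫ z, dens T z * H' (ext T z) ∂(pm T) := by
      rw [← hlaw T (fun z => H' (ext T z)) (hH'm.comp (hextm _))]
      exact integral_congr_ae (.of_forall fun ω => hH'd (hextp T ω))
    rw [hL]
    refine Eq.trans ?_ hR.symm
    set e : ((Fin (T + 1) → X) × (Fin (T + 1) → Y)) × (X × Y) →
        (Fin (T + 2) → X) × (Fin (T + 2) → Y) := fun q =>
      (Fin.snoc (α := fun _ => X) q.1.1 q.2.1, Fin.snoc (α := fun _ => Y) q.1.2 q.2.2) with he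
    have hmp : MeasurePreserving e ((pm T).prod (lamX.prod lamY)) (pm (T + 1)) :=
      ((measurePreserving_snoc lamX (T + 1)).prod (measurePreserving_snoc lamY (T + 1))).comp
        (measurePreserving_prodProdProdComm _ _ lamX lamY)
    have hΦi : Integrable (fun z => dens (T + 1) z * H (ext (T + 1) z)) (pm (T + 1)) :=
      (hdi _).mul_bdd (c := A) (hH.comp (hextm _)).aestronglyMeasurable
        (.of_forall fun z => hA _)
    have hΦe := (hmp.integrable_comp hΦi.1).2 hΦi
    rw [← hmp.map_eq, integral_map hmp.measurable.aemeasurable (by rw [hmp.map_eq]; exact hΦi.1)]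
    refine (integral_prod _ hΦe).trans (integral_congr_ae (.of_forall fun z => ?_))
    simp only [hH', Function.comp]
    rw [integral_ssmKernel hm hg, ← integral_const_mul]
    refine integral_congr_ae (.of_forall fun z' => ?_)
    have e1 : dens (T + 1) (e (z, z')) =
        dens T z * (m (z.1 (Fin.last T)) z'.1 * g z'.1 z'.2) :=
      ssmDensity_snoc m0 m g T z.1 z.2 z'.1 z'.2
    have e2 : H (ext (T + 1) (e (z, z'))) = H (Function.update (ext T z) (T + 1) z') := by
      refine hd fun i hi => ?_
      have hi' : i ≤ T + 1 := hi
      have hmin : min i (T + 1) = i := min_eq_left hi'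
      by_cases hin : i = T + 1
      · subst hin
        rw [Function.update_self]
        simp only [hext, he, min_self]
        exact Prod.ext (Fin.snoc_last (α := fun _ => X) ..) (Fin.snoc_last (α := fun _ => Y) ..)
      · rw [Function.update_of_ne hin]
        have hmin' : min i T = i := by omega
        simp only [hext, he, hmin, hmin']
        exact Prod.ext
          (Fin.snoc_castSucc (α := fun _ => X) (n := T + 1) z'.1 z.1 ⟨i, by omega⟩)
          (Fin.snoc_castSucc (α := fun _ => Y) (n := T + 1) z'.2 z.2 ⟨i, by omega⟩)
    have e3 : (ext T z T).1 = z.1 (Fin.last T) := by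
      simp only [hext, min_self]; rfl
    simp only
    rw [e1, e2, e3]; ring
  · intro V a hV ha z z'
    rw [integral_ssmKernel hm hg, integral_ssmKernel hm hg]
    have hk : ∀ z : X × Y, Integrable (fun z' : X × Y => m z.1 z'.1 * g z'.1 z'.2) (lamX.prod lamY) ∧
        ∫ z', m z.1 z'.1 * g z'.1 z'.2 ∂(lamX.prod lamY) = 1 := fun z => by
      have := integrable_mul_density (hm.integrable z.1) (hm.nonneg z.1)
        (hm.measurable.comp measurable_prodMk_left) hg
      rwa [hm.integral_eq_one] at this
    have hq := integrable_mul_density (lamX := lamX) (h := fun _ => (lamX.real Set.univ)⁻¹)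
      (integrable_const _) (fun _ => (inv_pos.2 hΛ).le) measurable_const hg
    have hδ : ∀ (z q : X × Y), ε * lamX.real Set.univ * ((lamX.real Set.univ)⁻¹ * g q.1 q.2) ≤
        m z.1 q.1 * g q.1 q.2 := fun z q => by
      have : ε * lamX.real Set.univ * ((lamX.real Set.univ)⁻¹ * g q.1 q.2) = ε * g q.1 q.2 := by
        field_simp
      rw [this]
      exact mul_le_mul_of_nonneg_right (hmε _ _) (hg.nonneg _ _)
    refine abs_integral_sub_integral_le_of_minorized hV ha (hk z).1 (hk z').1 hq.1 (hk z).2 (hk z').2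
      ?_ (hδ z) (hδ z')
    rw [hq.2]
    simp [hΛ.ne']

end StateSpaceModel

/-! ### Second-order expansions for averages of independent samples. -/

section MonteCarlo

variable {E : Type*} [MeasurableSpace E] {π : Measure E} [IsProbabilityMeasure π]
  {w v : E → ℝ} {a b B : ℝ}

theorem integral_eval_pi (hw : Measurable w) {n : ℕ} (i : Fin n) :
    ∫ z : Fin n → E, w (z i) ∂(Measure.pi fun _ => π) = ∫ x, w x ∂π := by
  exact integral_comp_eval (μ := fun _ : Fin n => π) (i := i) hw.aestronglyMeasurable

theorem integrable_eval_pi (hw : Measurable w) (hb : ∀ x, |w x| ≤ b) {n : ℕ} (i : Fin n) :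
    Integrable (fun z : Fin n → E => w (z i)) (Measure.pi fun _ => π) :=
  .of_bound (hw.comp (measurable_pi_apply i)).aestronglyMeasurable b (.of_forall fun _ => hb _)

theorem integral_sum_pi (hw : Measurable w) (hb : ∀ x, |w x| ≤ b) (n : ℕ) :
    ∫ z : Fin n → E, ∑ i, w (z i) ∂(Measure.pi fun _ => π) = n * ∫ x, w x ∂π := by
  rw [integral_finsetSum _ fun i _ => integrable_eval_pi hw hb i]
  simp [integral_eval_pi hw]

/-- Variances of independent terms add, and each is at most the second moment. -/
theorem integral_sq_sum_sub_le (hw : Measurable w) (hb : ∀ x, |w x| ≤ b) (n : ℕ) :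
    ∫ z : Fin n → E, (∑ i, w (z i) - n * ∫ x, w x ∂π) ^ 2 ∂(Measure.pi fun _ => π) ≤
      n * b ^ 2 := by
  have hL : MemLp w 2 π := .of_bound hw.aestronglyMeasurable b (.of_forall hb)
  have h1 := ProbabilityTheory.variance_sum_pi (μ := fun _ : Fin n => π) (X := fun _ => w)
    (fun _ => hL)
  have hm : Measurable fun z : Fin n → E => ∑ i, w (z i) :=
    Finset.measurable_sum _ fun i _ => hw.comp (measurable_pi_apply i)
  have h2 : (∑ i : Fin n, fun z : Fin n → E => w (z i)) = fun z => ∑ i, w (z i) := by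
    ext z; simp
  rw [h2, ProbabilityTheory.variance_eq_integral hm.aemeasurable, integral_sum_pi hw hb] at h1
  rw [h1, Finset.sum_const, Finset.card_univ, Fintype.card_fin, nsmul_eq_mul]
  refine mul_le_mul_of_nonneg_left ?_ (by positivity)
  refine (ProbabilityTheory.variance_le_expectation_sq hw.aestronglyMeasurable).trans ?_
  calc ∫ x, (w ^ 2) x ∂π ≤ ∫ _x, b ^ 2 ∂π := by
        refine integral_mono_of_nonneg (.of_forall fun x => by simp [sq_nonneg]) (integrable_const _)
          (.of_forall fun x => ?_)
        simp only [Pi.pow_apply]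
        exact sq_le_sq' (abs_le.1 (hb x)).1 (abs_le.1 (hb x)).2
    _ = b ^ 2 := by simp

/-- The inequality log s ≤ s - 1, applied to y/x and to x/y, traps log y - log x between (y - x)/y
and (y - x)/x. The two differ by (y - x)²/(xy). -/
theorem abs_log_sub_log_sub_le {x y : ℝ} (ha : 0 < a) (hx : a ≤ x) (hy : a ≤ y) :
    |Real.log y - Real.log x - (y - x) / x| ≤ (y - x) ^ 2 / a ^ 2 := by
  have hx0 := ha.trans_le hx
  have hy0 := ha.trans_le hy
  have h1 : Real.log y - Real.log x ≤ (y - x) / x := by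
    rw [← Real.log_div hy0.ne' hx0.ne', sub_div, div_self hx0.ne']
    exact Real.log_le_sub_one_of_pos (by positivity)
  have h2 : Real.log x - Real.log y ≤ (x - y) / y := by
    rw [← Real.log_div hx0.ne' hy0.ne', sub_div, div_self hy0.ne']
    exact Real.log_le_sub_one_of_pos (by positivity)
  have h3 : (x - y) / y + (y - x) / x = (y - x) ^ 2 / (x * y) := by field_simp; ring
  have h4 : (y - x) ^ 2 / (x * y) ≤ (y - x) ^ 2 / a ^ 2 := by
    have : a ^ 2 ≤ x * y := by rw [sq]; exact mul_le_mul hx hy ha.le hx0.le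
    gcongr
  have h5 : 0 ≤ (y - x) ^ 2 / a ^ 2 := by positivity
  rw [abs_le]; constructor <;> linarith

theorem integral_mem_of_prob (hw : Measurable w) (ha : ∀ x, a ≤ w x) (hb : ∀ x, w x ≤ b) :
    a ≤ ∫ x, w x ∂π ∧ ∫ x, w x ∂π ≤ b := by
  simpa using integral_mem_of_mem (μ := π) hw ha hb

/-- The bias of self-normalised importance sampling is of the order of the inverse sample size. -/
theorem abs_integral_ratio_sub_le (hw : Measurable w) (hv : Measurable v) (ha0 : 0 < a)
    (ha : ∀ x, a ≤ w x) (hb : ∀ x, w x ≤ b) (hB : ∀ x, |v x| ≤ B) (n : ℕ) :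
    |∫ z : Fin (n + 1) → E, (∑ i, w (z i))⁻¹ * ∑ i, v (z i) ∂(Measure.pi fun _ => π) -
      (∫ x, v x ∂π) / ∫ x, w x ∂π| ≤
      ((B ^ 2 + b ^ 2) / a ^ 2 + B * b ^ 2 / a ^ 3) / ((n : ℝ) + 1) := by
  have hwb : ∀ x, |w x| ≤ b := fun x => by rw [abs_of_pos (ha0.trans_le (ha x))]; exact hb x
  set c := ∫ x, w x ∂π with hc
  set d := ∫ x, v x ∂π with hd
  set M : ℝ := (n : ℝ) + 1 with hM
  have hM0 : 0 < M := by positivity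
  have hMc : ((n + 1 : ℕ) : ℝ) = M := by push_cast; rfl
  have hcm := integral_mem_of_prob (π := π) hw ha hb
  rw [← hc] at hcm
  have hc0 := ha0.trans_le hcm.1
  have hB0 : 0 ≤ B := by
    obtain ⟨x⟩ := π.nonempty_of_neZero
    exact (abs_nonneg _).trans (hB x)
  set Q : Measure (Fin (n + 1) → E) := Measure.pi fun _ => π with hQ
  set Sw : (Fin (n + 1) → E) → ℝ := fun z => ∑ i, w (z i) with hSw
  set Sv : (Fin (n + 1) → E) → ℝ := fun z => ∑ i, v (z i) with hSv
  have hSwm : Measurable Sw := Finset.measurable_sum _ fun i _ => hw.comp (measurable_pi_apply i)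
  have hSvm : Measurable Sv := Finset.measurable_sum _ fun i _ => hv.comp (measurable_pi_apply i)
  have hSwa : ∀ z, M * a ≤ Sw z := fun z => by
    have := Finset.card_nsmul_le_sum (Finset.univ : Finset (Fin (n + 1))) (fun i => w (z i)) a
      fun i _ => ha _
    simpa [hMc] using this
  have hSvB : ∀ z, |Sv z| ≤ M * B := fun z => by
    refine (Finset.abs_sum_le_sum_abs _ _).trans ?_
    have := Finset.sum_le_card_nsmul (Finset.univ : Finset (Fin (n + 1))) (fun i => |v (z i)|) B
      fun i _ => hB _
    simpa [hMc] using this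
  have hSwi : Integrable Sw Q := integrable_finsetSum _ fun i _ => integrable_eval_pi hw hwb i
  have hSvi : Integrable Sv Q := integrable_finsetSum _ fun i _ => integrable_eval_pi hv hB i
  have hEw : ∫ z, Sw z ∂Q = M * c := by rw [← hMc]; exact integral_sum_pi hw hwb _
  have hEv : ∫ z, Sv z ∂Q = M * d := by rw [← hMc]; exact integral_sum_pi hv hB _
  have hVw : ∫ z, (Sw z - M * c) ^ 2 ∂Q ≤ M * b ^ 2 := by
    have := integral_sq_sum_sub_le (π := π) hw hwb (n + 1); rwa [hMc] at this
  have hVv : ∫ z, (Sv z - M * d) ^ 2 ∂Q ≤ M * B ^ 2 := by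
    have := integral_sq_sum_sub_le (π := π) hv hB (n + 1); rwa [hMc] at this
  have hsqi : ∀ {f : (Fin (n + 1) → E) → ℝ} {C : ℝ}, Measurable f → (∀ z, |f z| ≤ C) →
      Integrable f Q := fun hf hC => .of_bound hf.aestronglyMeasurable _ (.of_forall hC)
  have hSwb : ∀ z, |Sw z| ≤ M * b := fun z => by
    refine (Finset.abs_sum_le_sum_abs _ _).trans ?_
    have := Finset.sum_le_card_nsmul (Finset.univ : Finset (Fin (n + 1))) (fun i => |w (z i)|) b
      fun i _ => hwb _
    simpa [hMc] using this
  have hWi : Integrable (fun z => (Sw z - M * c) ^ 2) Q :=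
    hsqi (C := (M * b + |M * c|) ^ 2) ((hSwm.sub_const _).pow_const 2) fun z => by
      rw [abs_pow]
      exact pow_le_pow_left₀ (abs_nonneg _) ((abs_sub _ _).trans (by linarith [hSwb z])) 2
  have hVi : Integrable (fun z => (Sv z - M * d) ^ 2) Q :=
    hsqi (C := (M * B + |M * d|) ^ 2) ((hSvm.sub_const _).pow_const 2) fun z => by
      rw [abs_pow]
      exact pow_le_pow_left₀ (abs_nonneg _) ((abs_sub _ _).trans (by linarith [hSvB z])) 2
  -- The linearisation of `Sv / Sw` at the means `M * d` and `M * c`. It has mean zero, so the bias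
  -- is the mean of the quadratic remainder.
  set L : (Fin (n + 1) → E) → ℝ := fun z =>
    (Sv z - M * d) / (M * c) + d * (M * c - Sw z) / (M * c ^ 2) with hL
  have hLi1 : Integrable (fun z => (Sv z - M * d) / (M * c)) Q :=
    (hSvi.sub (integrable_const _)).div_const _
  have hLi2 : Integrable (fun z => d * (M * c - Sw z) / (M * c ^ 2)) Q :=
    (((integrable_const _).sub hSwi).const_mul d).div_const _
  have hLi : Integrable L Q := hLi1.add hLi2
  have hL0 : ∫ z, L z ∂Q = 0 := by
    simp only [hL]
    rw [integral_add hLi1 hLi2, integral_div, integral_div,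
      integral_const_mul, integral_sub hSvi (integrable_const _),
      integral_sub (integrable_const _) hSwi, hEw, hEv]
    simp
  set α := (2 * (M * a) ^ 2)⁻¹ + B * (M * a ^ 3)⁻¹ * M⁻¹ with hα
  set β := (2 * (M * a) ^ 2)⁻¹ with hβ
  have hpt : ∀ z, |(Sw z)⁻¹ * Sv z - d / c - L z| ≤
      α * (Sw z - M * c) ^ 2 + β * (Sv z - M * d) ^ 2 := by
    intro z
    have hS0 : 0 < Sw z := (by positivity : 0 < M * a).trans_le (hSwa z)
    -- An exact remainder, quadratic in the deviations. These have second moment O(M) and are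
    -- divided by quantities of order M², which leaves O(1/M).
    have e : (Sw z)⁻¹ * Sv z - d / c - L z =
        (Sv z - M * d) * (M * c - Sw z) / (M * c) ^ 2 +
          Sv z * (Sw z - M * c) ^ 2 / (Sw z * (M * c) ^ 2) := by
      simp only [hL]; field_simp; ring
    rw [e]
    refine (abs_add_le _ _).trans ?_
    have h1 : |(Sv z - M * d) * (M * c - Sw z) / (M * c) ^ 2| ≤
        β * (Sw z - M * c) ^ 2 + β * (Sv z - M * d) ^ 2 := by
      rw [abs_div, abs_of_pos (show 0 < (M * c) ^ 2 by positivity), abs_mul]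
      have h2 : |Sv z - M * d| * |M * c - Sw z| ≤
          ((Sw z - M * c) ^ 2 + (Sv z - M * d) ^ 2) / 2 := by
        have := two_mul_le_add_sq |Sv z - M * d| |M * c - Sw z|
        rw [sq_abs, sq_abs, show (M * c - Sw z) ^ 2 = (Sw z - M * c) ^ 2 by ring] at this
        linarith
      have h3 : (M * a) ^ 2 ≤ (M * c) ^ 2 := by gcongr; exact hcm.1
      calc _ ≤ (((Sw z - M * c) ^ 2 + (Sv z - M * d) ^ 2) / 2) / (M * a) ^ 2 := by gcongr
        _ = _ := by rw [hβ]; field_simp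
    have h2 : |Sv z * (Sw z - M * c) ^ 2 / (Sw z * (M * c) ^ 2)| ≤
        B * (M * a ^ 3)⁻¹ * M⁻¹ * (Sw z - M * c) ^ 2 := by
      rw [abs_div, abs_of_pos (show 0 < Sw z * (M * c) ^ 2 by positivity), abs_mul,
        abs_of_nonneg (sq_nonneg (Sw z - M * c))]
      calc _ ≤ (M * B) * (Sw z - M * c) ^ 2 / ((M * a) * (M * a) ^ 2) := by
            gcongr
            · exact hSvB z
            · exact hSwa z
            · exact hcm.1
        _ = _ := by field_simp
    refine (add_le_add h1 h2).trans (le_of_eq ?_)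
    rw [hα, add_mul]
    ring
  have hratio : Integrable (fun z => (Sw z)⁻¹ * Sv z) Q :=
    hSvi.bdd_mul (c := (M * a)⁻¹) hSwm.inv.aestronglyMeasurable (.of_forall fun z => by
      have hS0 : 0 < Sw z := (by positivity : 0 < M * a).trans_le (hSwa z)
      rw [Real.norm_eq_abs, abs_of_pos (inv_pos.2 hS0)]
      exact inv_anti₀ (by positivity) (hSwa z))
  have e : ∫ z, (Sw z)⁻¹ * Sv z ∂Q - d / c = ∫ z, ((Sw z)⁻¹ * Sv z - d / c - L z) ∂Q := by
    have h1 : Integrable (fun z => (Sw z)⁻¹ * Sv z - d / c) Q := hratio.sub (integrable_const _)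
    rw [integral_sub h1 hLi, integral_sub hratio (integrable_const _), hL0]
    simp
  rw [e]
  calc |∫ z, ((Sw z)⁻¹ * Sv z - d / c - L z) ∂Q|
      ≤ ∫ z, |(Sw z)⁻¹ * Sv z - d / c - L z| ∂Q := abs_integral_le_integral_abs
    _ ≤ ∫ z, (α * (Sw z - M * c) ^ 2 + β * (Sv z - M * d) ^ 2) ∂Q :=
        integral_mono_of_nonneg (.of_forall fun _ => abs_nonneg _)
          ((hWi.const_mul α).add (hVi.const_mul β)) (.of_forall hpt)
    _ = α * ∫ z, (Sw z - M * c) ^ 2 ∂Q + β * ∫ z, (Sv z - M * d) ^ 2 ∂Q := by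
        rw [integral_add (hWi.const_mul α) (hVi.const_mul β), integral_const_mul,
          integral_const_mul]
    _ ≤ α * (M * b ^ 2) + β * (M * B ^ 2) := by
        have : 0 ≤ α := by rw [hα]; positivity
        have : 0 ≤ β := by rw [hβ]; positivity
        gcongr
    _ = ((B ^ 2 + b ^ 2) / (2 * a ^ 2) + B * b ^ 2 / a ^ 3) / M := by
        rw [hα, hβ]; field_simp; ring
    _ ≤ _ := by
        have : (B ^ 2 + b ^ 2) / (2 * a ^ 2) ≤ (B ^ 2 + b ^ 2) / a ^ 2 := by
          gcongr; linarith [sq_nonneg a]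
        gcongr

/-- First-order expansion of the expected log-average in one of its terms. -/
theorem abs_integral_log_sub_le (hw : Measurable w) (ha0 : 0 < a)
    (ha : ∀ x, a ≤ w x) (hb : ∀ x, w x ≤ b) (n : ℕ) {w₀ : ℝ} (hw0 : a ≤ w₀) (hw1 : w₀ ≤ b) :
    |((n : ℝ) + 1) * (∫ z : Fin n → E, Real.log (((n : ℝ) + 1)⁻¹ * w₀ +
          ((n : ℝ) + 1)⁻¹ * ∑ i, w (z i)) ∂(Measure.pi fun _ => π) -
        ∫ z : Fin n → E, Real.log (((n : ℝ) + 1)⁻¹ * (∫ x, w x ∂π) +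
          ((n : ℝ) + 1)⁻¹ * ∑ i, w (z i)) ∂(Measure.pi fun _ => π)) -
      (w₀ - ∫ x, w x ∂π) / ∫ x, w x ∂π| ≤ (b ^ 2 / a ^ 2 + b ^ 3 / a ^ 3) / ((n : ℝ) + 1) := by
  have hwb : ∀ x, |w x| ≤ b := fun x => by rw [abs_of_pos (ha0.trans_le (ha x))]; exact hb x
  set c := ∫ x, w x ∂π with hc
  set M : ℝ := (n : ℝ) + 1 with hM
  have hM0 : 0 < M := by positivity
  have hcm := integral_mem_of_prob (π := π) hw ha hb
  rw [← hc] at hcm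
  have hc0 := ha0.trans_le hcm.1
  have hb0 : 0 < b := hc0.trans_le hcm.2
  set Q : Measure (Fin n → E) := Measure.pi fun _ => π with hQ
  set Sw : (Fin n → E) → ℝ := fun z => ∑ i, w (z i) with hSw
  have hSwm : Measurable Sw := Finset.measurable_sum _ fun i _ => hw.comp (measurable_pi_apply i)
  have hSwi : Integrable Sw Q := integrable_finsetSum _ fun i _ => integrable_eval_pi hw hwb i
  have hEw : ∫ z, Sw z ∂Q = n * c := integral_sum_pi hw hwb _
  have hVw : ∫ z, (Sw z - n * c) ^ 2 ∂Q ≤ n * b ^ 2 := integral_sq_sum_sub_le (π := π) hw hwb n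
  have hSwa : ∀ z, n * a ≤ Sw z := fun z => by
    have := Finset.card_nsmul_le_sum (Finset.univ : Finset (Fin n)) (fun i => w (z i)) a
      fun i _ => ha _
    simpa using this
  have hSwb : ∀ z, Sw z ≤ n * b := fun z => by
    have := Finset.sum_le_card_nsmul (Finset.univ : Finset (Fin n)) (fun i => w (z i)) b
      fun i _ => hb _
    simpa using this
  -- With the free slot filled by `c`, the average `T c` has mean exactly `c`.
  set T : ℝ → (Fin n → E) → ℝ := fun x z => M⁻¹ * x + M⁻¹ * Sw z with hT
  have hTm : ∀ x, Measurable (T x) := fun x => (hSwm.const_mul _).const_add _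
  have hTa : ∀ x, a ≤ x → ∀ z, a ≤ T x z := fun x hx z => by
    have : a = M⁻¹ * a + M⁻¹ * (n * a) := by rw [hM]; field_simp; ring
    simp only [hT]
    rw [this]
    have := hSwa z
    gcongr
  have hTb : ∀ x, x ≤ b → ∀ z, T x z ≤ b := fun x hx z => by
    have e : M⁻¹ * b + M⁻¹ * (n * b) = b := by rw [hM]; field_simp; ring
    calc T x z ≤ M⁻¹ * b + M⁻¹ * (n * b) := by
          simp only [hT]; have := hSwb z; gcongr
      _ = b := e
  have hlogi : ∀ x, a ≤ x → x ≤ b → Integrable (fun z => Real.log (T x z)) Q := fun x hx hx' =>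
    .of_bound (hTm x).log.aestronglyMeasurable (|Real.log a| + |Real.log b|) (.of_forall fun z => by
      have h1 := Real.log_le_log ha0 (hTa x hx z)
      have h2 := Real.log_le_log (ha0.trans_le (hTa x hx z)) (hTb x hx' z)
      rw [Real.norm_eq_abs, abs_le]
      constructor
      · linarith [neg_abs_le (Real.log a), abs_nonneg (Real.log b)]
      · linarith [le_abs_self (Real.log b), abs_nonneg (Real.log a)])
  have hwc : |w₀ - c| ≤ b := by
    rw [abs_le]; constructor <;> linarith [hcm.1, hcm.2]
  -- The logarithm is expanded to give `(w₀ - c) / T c`, and `L` is the first-order term, of mean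
  -- zero, in replacing `1 / T c` by `1 / c`.
  set L : (Fin n → E) → ℝ := fun z => -(w₀ - c) * (Sw z - n * c) / (M * c ^ 2) with hL
  have hLi : Integrable L Q := ((hSwi.sub (integrable_const _)).const_mul _).div_const _
  have hL0 : ∫ z, L z ∂Q = 0 := by
    simp only [hL]
    rw [integral_div, integral_const_mul, integral_sub hSwi (integrable_const _), hEw]
    simp
  have hWi : Integrable (fun z => (Sw z - n * c) ^ 2) Q :=
    .of_bound ((hSwm.sub_const _).pow_const 2).aestronglyMeasurable ((n * b + |n * c|) ^ 2)
      (.of_forall fun z => by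
      rw [norm_pow]
      refine pow_le_pow_left₀ (norm_nonneg _) ((abs_sub _ _).trans ?_) 2
      have : |Sw z| ≤ n * b := by
        have := hSwa z
        have h0 : 0 ≤ n * a := by positivity
        rw [abs_of_nonneg (h0.trans this)]; exact hSwb z
      linarith)
  set β := b * (M ^ 2 * a ^ 3)⁻¹ with hβ
  have hpt : ∀ z, |M * (Real.log (T w₀ z) - Real.log (T c z)) - (w₀ - c) / c - L z| ≤
      b ^ 2 / (a ^ 2 * M) + β * (Sw z - n * c) ^ 2 := by
    intro z
    have hT0 : a ≤ T c z := hTa c hcm.1 z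
    have hTpos := ha0.trans_le hT0
    have hdiff : T w₀ z - T c z = M⁻¹ * (w₀ - c) := by simp only [hT]; ring
    have h1 := abs_log_sub_log_sub_le ha0 hT0 (hTa w₀ hw0 z)
    rw [hdiff] at h1
    have hTc : T c z - c = M⁻¹ * (Sw z - n * c) := by simp only [hT, hM]; field_simp; ring
    have e : M * (Real.log (T w₀ z) - Real.log (T c z)) - (w₀ - c) / c - L z =
        M * (Real.log (T w₀ z) - Real.log (T c z) - M⁻¹ * (w₀ - c) / T c z) +
          (w₀ - c) * (T c z - c) ^ 2 / (c ^ 2 * T c z) := by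
      have eL : L z = -(w₀ - c) * (T c z - c) / c ^ 2 := by
        rw [hTc]; simp only [hL]; field_simp
      rw [eL]; field_simp; ring
    rw [e]
    refine (abs_add_le _ _).trans (add_le_add ?_ ?_)
    · rw [abs_mul, abs_of_pos hM0]
      calc _ ≤ M * ((M⁻¹ * (w₀ - c)) ^ 2 / a ^ 2) := by gcongr
        _ = |w₀ - c| ^ 2 / (a ^ 2 * M) := by rw [sq_abs]; field_simp
        _ ≤ _ := by gcongr
    · rw [abs_div, abs_mul, abs_of_nonneg (sq_nonneg (T c z - c)),
        abs_of_pos (show 0 < c ^ 2 * T c z by positivity)]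
      calc _ ≤ b * (T c z - c) ^ 2 / (a ^ 2 * a) := by
            gcongr
            exact hcm.1
        _ = _ := by rw [hTc, hβ]; field_simp
  have hdi : Integrable (fun z => M * (Real.log (T w₀ z) - Real.log (T c z))) Q :=
    ((hlogi w₀ hw0 hw1).sub (hlogi c hcm.1 hcm.2)).const_mul M
  have e : M * (∫ z, Real.log (T w₀ z) ∂Q - ∫ z, Real.log (T c z) ∂Q) - (w₀ - c) / c =
      ∫ z, (M * (Real.log (T w₀ z) - Real.log (T c z)) - (w₀ - c) / c - L z) ∂Q := by
    have h1 : Integrable (fun z => M * (Real.log (T w₀ z) - Real.log (T c z)) - (w₀ - c) / c) Q :=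
      hdi.sub (integrable_const _)
    rw [integral_sub h1 hLi, integral_sub hdi (integrable_const _), hL0, integral_const_mul,
      integral_sub (hlogi w₀ hw0 hw1) (hlogi c hcm.1 hcm.2)]
    simp
  rw [e]
  calc _ ≤ ∫ z, |M * (Real.log (T w₀ z) - Real.log (T c z)) - (w₀ - c) / c - L z| ∂Q :=
        abs_integral_le_integral_abs
    _ ≤ ∫ z, (b ^ 2 / (a ^ 2 * M) + β * (Sw z - n * c) ^ 2) ∂Q :=
        integral_mono_of_nonneg (.of_forall fun _ => abs_nonneg _)
          ((integrable_const _).add (hWi.const_mul β)) (.of_forall hpt)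
    _ = b ^ 2 / (a ^ 2 * M) + β * ∫ z, (Sw z - n * c) ^ 2 ∂Q := by
        rw [integral_add (integrable_const _) (hWi.const_mul β), integral_const_mul]; simp
    _ ≤ b ^ 2 / (a ^ 2 * M) + β * (M * b ^ 2) := by
        have : 0 ≤ β := by rw [hβ]; positivity
        have : n * b ^ 2 ≤ M * b ^ 2 := by gcongr; linarith
        gcongr
        linarith
    _ = _ := by rw [hβ]; field_simp

end MonteCarlo

/-! ### Integration against densities, and the filter density as the solution of its recursion. -/

theorem integral_measureOfDensity {A : Type*} [MeasurableSpace A] {μ : Measure A} {φ : A → ℝ}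
    (hφ : Measurable φ) (h0 : ∀ a, 0 ≤ φ a) (F : A → ℝ) :
    ∫ a, F a ∂(measureOfDensity μ φ) = ∫ a, φ a * F a ∂μ := by
  rw [measureOfDensity, integral_withDensity_eq_integral_toReal_smul hφ.ennreal_ofReal
    (.of_forall fun _ => ENNReal.ofReal_lt_top)]
  refine integral_congr_ae (.of_forall fun a => ?_)
  simp only [smul_eq_mul]
  rw [ENNReal.toReal_ofReal (h0 a)]

theorem integrable_measureOfDensity {A : Type*} [MeasurableSpace A] {μ : Measure A} {φ : A → ℝ}
    (hφ : Measurable φ) (h0 : ∀ a, 0 ≤ φ a) (F : A → ℝ) :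
    Integrable F (measureOfDensity μ φ) ↔ Integrable (fun a => φ a * F a) μ := by
  rw [measureOfDensity, integrable_withDensity_iff_integrable_smul' hφ.ennreal_ofReal
    (.of_forall fun _ => ENNReal.ofReal_lt_top)]
  refine integrable_congr (.of_forall fun a => ?_)
  simp only [smul_eq_mul]
  rw [ENNReal.toReal_ofReal (h0 a)]

namespace ParamSSM

variable {p : ℕ} {X Y U W : Type*} [MeasurableSpace X] [MeasurableSpace Y] [MeasurableSpace U]
  [MeasurableSpace W] {S : ParamSSM p X Y U} {ε κ : ℝ}

/-- The density of `filterBase` with respect to the reference measure. -/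
def baseDensity (S : ParamSSM p X Y U) : ℕ → X → ℝ
  | 0 => S.m0
  | _ + 1 => fun _ => 1

theorem filterBase_eq (S : ParamSSM p X Y U) (t : ℕ) :
    S.filterBase t = measureOfDensity S.lamX (S.baseDensity t) := by
  cases t with
  | zero => rfl
  | succ t =>
    simp only [filterBase, baseDensity, measureOfDensity, ENNReal.ofReal_one]
    exact withDensity_one.symm

namespace Assumptions

theorem measurable_baseDensity (hS : S.Assumptions ε κ) (t : ℕ) : Measurable (S.baseDensity t) := by
  cases t with
  | zero => exact hS.measurable_m0
  | succ t => exact measurable_const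

theorem baseDensity_nonneg (hS : S.Assumptions ε κ) (t : ℕ) (x : X) : 0 ≤ S.baseDensity t x := by
  cases t with
  | zero => exact hS.nonneg_m0 x
  | succ t => exact zero_le_one

theorem integral_filterBase (hS : S.Assumptions ε κ) (t : ℕ) (F : X → ℝ) :
    ∫ x, F x ∂(S.filterBase t) = ∫ x, S.baseDensity t x * F x ∂S.lamX := by
  rw [filterBase_eq, integral_measureOfDensity (hS.measurable_baseDensity t)
    (hS.baseDensity_nonneg t)]

theorem measurable_ssmDensity (hS : S.Assumptions ε κ) {θ : Fin p → ℝ} (hθ : θ ∈ S.Θ) (t : ℕ)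
    (y : Fin (t + 1) → Y) : Measurable fun x => ssmDensity S.m0 (S.m θ) (S.g θ) t x y :=
  (_root_.measurable_ssmDensity hS.measurable_m0 (hS.density_m θ hθ).measurable
    (hS.density_g θ hθ).measurable t).comp measurable_prodMk_right

theorem integrable_ssmDensity (hS : S.Assumptions ε κ) (hε : 0 < ε) {θ : Fin p → ℝ} (hθ : θ ∈ S.Θ)
    (t : ℕ) (y : Fin (t + 1) → Y) : Integrable (fun x => ssmDensity S.m0 (S.m θ) (S.g θ) t x y)
      (Measure.pi fun _ => S.lamX) := by
  have := hS.finite_lamX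
  have h0 : Integrable (fun x : Fin (t + 1) → X => S.m0 (x 0)) (Measure.pi fun _ => S.lamX) :=
    integrable_comp_eval (μ := fun _ : Fin (t + 1) => S.lamX) (i := 0) hS.integrable_m0
  refine (h0.mul_const (ε⁻¹ * ∏ _s : Fin t, (ε⁻¹ * ε⁻¹))).mono'
    (hS.measurable_ssmDensity hθ t y).aestronglyMeasurable (.of_forall fun x => ?_)
  have hm := fun x x' => hε.le.trans (hS.bounds_m θ hθ x x').1
  have hg := fun x y => hε.le.trans (hS.bounds_g θ hθ x y).1
  rw [Real.norm_eq_abs, abs_of_nonneg (ssmDensity_nonneg hS.nonneg_m0 hm hg t x y), ssmDensity,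
    mul_assoc]
  have hi : 0 < ε⁻¹ := inv_pos.2 hε
  refine mul_le_mul_of_nonneg_left ?_ (hS.nonneg_m0 _)
  refine mul_le_mul (hS.bounds_g θ hθ _ _).2 (Finset.prod_le_prod (fun s _ =>
    mul_nonneg (hm _ _) (hg _ _)) fun s _ => mul_le_mul (hS.bounds_m θ hθ _ _).2
      (hS.bounds_g θ hθ _ _).2 (hg _ _) hi.le) (Finset.prod_nonneg fun s _ =>
    mul_nonneg (hm _ _) (hg _ _)) hi.le

/-- Fubini over all states but the last, with a test function of the last state. The function 1
gives the normaliser of the filter, and the next transition gives the recursion. -/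
theorem integral_pi_succ_ssmDensity (hS : S.Assumptions ε κ) (hε : 0 < ε) {θ : Fin p → ℝ}
    (hθ : θ ∈ S.Θ) (t : ℕ) (y : Fin (t + 1) → Y) {h : X → ℝ} (hh : Measurable h) {B : ℝ}
    (hB : ∀ x, |h x| ≤ B) :
    ∫ x : Fin (t + 1) → X, ssmDensity S.m0 (S.m θ) (S.g θ) t x y * h (x (Fin.last t))
        ∂(Measure.pi fun _ => S.lamX) =
      ∫ x, (∫ x' : Fin t → X, ssmDensity S.m0 (S.m θ) (S.g θ) t (Fin.snoc (α := fun _ => X) x' x) y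
        ∂(Measure.pi fun _ => S.lamX)) * h x ∂S.lamX := by
  have := hS.finite_lamX
  have hmp := measurePreserving_snoc S.lamX t
  have hm : Measurable fun x : Fin (t + 1) → X =>
      ssmDensity S.m0 (S.m θ) (S.g θ) t x y * h (x (Fin.last t)) :=
    (hS.measurable_ssmDensity hθ t y).mul (hh.comp (measurable_pi_apply _))
  have hi : Integrable (fun x : Fin (t + 1) → X =>
      ssmDensity S.m0 (S.m θ) (S.g θ) t x y * h (x (Fin.last t))) (Measure.pi fun _ => S.lamX) :=
    (hS.integrable_ssmDensity hε hθ t y).mul_bdd (c := B)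
      (hh.comp (measurable_pi_apply _)).aestronglyMeasurable (.of_forall fun x => hB _)
  rw [← hmp.map_eq] at hi ⊢
  rw [integral_map hmp.measurable.aemeasurable hm.aestronglyMeasurable]
  rw [integrable_map_measure hm.aestronglyMeasurable hmp.measurable.aemeasurable] at hi
  simp only [Function.comp_def, Fin.snoc_last] at hi ⊢
  rw [integral_prod_symm _ hi]
  refine integral_congr_ae (.of_forall fun x => ?_)
  simp only []
  rw [integral_mul_const]

/-- The filter densities satisfy the filter recursion. -/
theorem exists_integral_snoc_eq (hS : S.Assumptions ε κ) (hε : 0 < ε) (hε1 : ε < 1) (hκ : 0 ≤ κ)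
    {θ : Fin p → ℝ} (hθ : θ ∈ S.Θ) (y : ℕ → Y) (t : ℕ) : ∃ Z : ℝ, 0 < Z ∧ ∀ x,
      ∫ x' : Fin t → X, ssmDensity S.m0 (S.m θ) (S.g θ) t (Fin.snoc (α := fun _ => X) x' x)
        (fun s => y s) ∂(Measure.pi fun _ => S.lamX) =
      Z * (S.baseDensity t x * S.obsFilter t θ (x, y)) := by
  have := hS.finite_lamX
  induction t with
  | zero =>
    have := hS.isProbabilityMeasure_m0
    have h := (integral_mem_of_prob (π := measureOfDensity S.lamX S.m0)
      ((hS.density_g θ hθ).measurable.comp (measurable_prodMk_right (y := y 0)))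
      (fun x => (hS.bounds_g θ hθ x (y 0)).1) fun x => (hS.bounds_g θ hθ x (y 0)).2).1
    have hpos : 0 < ∫ x, S.g θ x (y 0) ∂(measureOfDensity S.lamX S.m0) := hε.trans_le h
    refine ⟨_, hpos, fun x => ?_⟩
    simp only [obsFilter, baseDensity, ssmDensity]
    rw [integral_unique]
    have e : ∀ a : Fin 0 → X, Fin.snoc (α := fun _ => X) a x 0 = x := fun a => Fin.snoc_last (n := 0) ..
    simp [e, measureReal_def]
    field_simp
  | succ t ih =>
    obtain ⟨Z, hZ, hx⟩ := ih
    have := hS.isFiniteMeasure_filterBase t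
    have hd := hS.densityFamily_obsFilter hε hε1 hκ t
    have hN : 0 < S.updateNorm (S.filterBase t) (fun y => y (t + 1)) (S.obsFilter t) θ y :=
      (pow_pos hε 3).trans_le (hd.updateNorm_mem hS hε hκ hθ y).1
    -- The constant is the likelihood of the observations so far. Each step multiplies it by the
    -- next predictive likelihood.
    refine ⟨Z * S.updateNorm (S.filterBase t) (fun y => y (t + 1)) (S.obsFilter t) θ y,
      by positivity, fun x => ?_⟩
    have hy : (fun s : Fin (t + 2) => y s) =
        Fin.snoc (α := fun _ => Y) (fun s : Fin (t + 1) => y s) (y (t + 1)) := by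
      ext s
      refine Fin.lastCases ?_ (fun s => ?_) s
      · rw [Fin.snoc_last]; simp
      · rw [Fin.snoc_castSucc]; simp
    rw [hy]
    simp only [ssmDensity_snoc]
    have h1 := hS.integral_pi_succ_ssmDensity hε hθ t (fun s => y s)
      (h := fun x2 => S.m θ x2 x * S.g θ x (y (t + 1))) (B := ε⁻¹ * ε⁻¹)
      (((hS.density_m θ hθ).measurable.comp measurable_prodMk_right).mul_const _) (fun x2 => by
        have h1 := hS.bounds_m θ hθ x2 x
        have h2 := hS.bounds_g θ hθ x (y (t + 1))
        rw [abs_mul, abs_of_pos (hε.trans_le h1.1), abs_of_pos (hε.trans_le h2.1)]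
        exact mul_le_mul h1.2 h2.2 (hε.le.trans h2.1) (inv_pos.2 hε).le)
    rw [h1]
    simp only [hx]
    rw [show S.baseDensity (t + 1) x = 1 from rfl]
    simp only [obsFilter, ParamSSM.filterUpdate, predDensity]
    rw [hS.integral_filterBase]
    have e : ∀ a : X, Z * (S.baseDensity t a * S.obsFilter t θ (a, y)) *
        (S.m θ a x * S.g θ x (y (t + 1))) =
        (S.baseDensity t a * (S.obsFilter t θ (a, y) * S.m θ a x)) * (Z * S.g θ x (y (t + 1))) :=
      fun a => by ring
    simp only [e]
    rw [integral_mul_const]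
    field_simp

theorem filterDensity_eq (hS : S.Assumptions ε κ) (hε : 0 < ε) (hε1 : ε < 1) (hκ : 0 ≤ κ)
    {θ : Fin p → ℝ} (hθ : θ ∈ S.Θ) (y : ℕ → Y) (t : ℕ) (x : X) :
    S.filterDensity θ y t x = S.baseDensity t x * S.obsFilter t θ (x, y) := by
  have := hS.finite_lamX
  obtain ⟨Z, hZ, hx⟩ := hS.exists_integral_snoc_eq hε hε1 hκ hθ y t
  have h1 := hS.integral_pi_succ_ssmDensity hε hθ t (fun s => y s) (h := fun _ => 1) (B := 1)
    measurable_const (by simp)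
  simp only [mul_one, hx] at h1
  rw [integral_const_mul, ← hS.integral_filterBase,
    (hS.densityFamily_obsFilter hε hε1 hκ t).integral_eq_one θ hθ y, mul_one] at h1
  rw [filterDensity, h1, hx]
  field_simp

/-- The factor `baseDensity` does not involve θ, so it passes through the gradient. This reduces
tangent filters to gradients of the bounded densities `obsFilter`. -/
theorem tangentDensity_eq (hS : S.Assumptions ε κ) (hε : 0 < ε) (hε1 : ε < 1) (hκ : 0 ≤ κ)
    {θ : Fin p → ℝ} (hθ : θ ∈ S.Θ) (y : ℕ → Y) (t : ℕ) (x : X) (i : Fin p) :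
    S.tangentDensity θ y t x i = S.baseDensity t x * famGrad S.Θ i (S.obsFilter t) θ (x, y) := by
  have := hS.isFiniteMeasure_filterBase t
  obtain ⟨A, hA⟩ := (hS.densityFamily_obsFilter hε hε1 hκ t).exists_c1
  have h := relGrad_mul hS.isParameterSet hθ
    (differentiableOn_const (S.baseDensity t x)) (hA.diff (x, y)) i
  rw [relGrad_const] at h
  rw [tangentDensity, relGrad_congr (fun θ hθ => hS.filterDensity_eq hε hε1 hκ hθ y t x) hθ, h]
  simp [famGrad]

end Assumptions

end ParamSSM

/-! ### Product measures with densities. -/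

section PiDensity

variable {E : Type*} [MeasurableSpace E] {q : Measure E} {F : E → ℝ}

theorem isProbabilityMeasure_measureOfDensity (hi : Integrable F q) (h0 : ∀ e, 0 ≤ F e)
    (h1 : ∫ e, F e ∂q = 1) : IsProbabilityMeasure (measureOfDensity q F) := by
  constructor
  rw [measureOfDensity, withDensity_apply _ MeasurableSet.univ, Measure.restrict_univ,
    ← ofReal_integral_eq_lintegral_ofReal hi (.of_forall h0), h1, ENNReal.ofReal_one]

/-- A product of measures with densities has the product density. -/
theorem pi_measureOfDensity [IsFiniteMeasure q] (hi : Integrable F q) (h0 : ∀ e, 0 ≤ F e) (n : ℕ) :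
    (Measure.pi fun _ : Fin n => measureOfDensity q F) =
      measureOfDensity (Measure.pi fun _ : Fin n => q) (fun z => ∏ i, F (z i)) := by
  have : IsFiniteMeasure (measureOfDensity q F) := isFiniteMeasure_withDensity_ofReal hi.2
  refine Measure.pi_eq fun s hs => ?_
  simp only [measureOfDensity]
  rw [withDensity_apply _ (MeasurableSet.univ_pi hs), Measure.restrict_pi_pi,
    ← ofReal_integral_eq_lintegral_ofReal
      (Integrable.fintype_prod (f := fun _ => F) fun i => hi.restrict)
      (.of_forall fun z => Finset.prod_nonneg fun i _ => h0 _),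
    integral_fintype_prod_eq_prod (fun _ => F), ENNReal.ofReal_prod_of_nonneg
      fun i _ => integral_nonneg h0]
  refine Finset.prod_congr rfl fun i _ => ?_
  rw [withDensity_apply _ (hs i), ofReal_integral_eq_lintegral_ofReal hi.restrict (.of_forall h0)]

theorem integral_pi_measureOfDensity [IsFiniteMeasure q] (hm : Measurable F) (hi : Integrable F q) (h0 : ∀ e, 0 ≤ F e)
    (n : ℕ) (Φ : (Fin n → E) → ℝ) : ∫ z, Φ z ∂(Measure.pi fun _ => measureOfDensity q F) =
      ∫ z, Φ z * ∏ i, F (z i) ∂(Measure.pi fun _ => q) := by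
  have hm' : Measurable fun z : Fin n → E => ∏ i, F (z i) :=
    Finset.measurable_prod _ fun i _ => hm.comp (measurable_pi_apply i)
  rw [pi_measureOfDensity hi h0, integral_measureOfDensity hm'
    fun z => Finset.prod_nonneg fun i _ => h0 _]
  simp only [mul_comm]

end PiDensity

/-! ### Gradients of importance-weighted bounds. -/

section ImportanceWeighting

variable {p : ℕ} {E W : Type*} [MeasurableSpace E] [MeasurableSpace W] {q : Measure E}
  {Θ : Set (Fin p → ℝ)} {A B K a b η : ℝ} {w f f' : (Fin p → ℝ) → E × W → ℝ}

/-- A differentiable family of weights with values in `[a, b]`. -/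
structure WeightFamily (Θ : Set (Fin p → ℝ)) (A a b : ℝ) (w : (Fin p → ℝ) → E × W → ℝ) : Prop where
  c1 : C1Family Θ A w
  lower : ∀ θ ∈ Θ, ∀ z, a ≤ w θ z
  upper : ∀ θ ∈ Θ, ∀ z, w θ z ≤ b

/-- A differentiable family of probability densities whose scores are bounded by `K`. -/
structure ScoreFamily (Θ : Set (Fin p → ℝ)) (q : Measure E) (B K : ℝ)
    (f : (Fin p → ℝ) → E × W → ℝ) : Prop where
  c1 : C1Family Θ B f
  pos : ∀ θ ∈ Θ, ∀ z, 0 < f θ z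
  integral_eq_one : ∀ θ ∈ Θ, ∀ v, ∫ e, f θ (e, v) ∂q = 1
  score : ∀ θ ∈ Θ, ∀ z i, |famGrad Θ i f θ z| ≤ K * f θ z

/-- The expected weight. -/
def marginalLik (q : Measure E) (w f : (Fin p → ℝ) → E × W → ℝ) : (Fin p → ℝ) → W → ℝ :=
  fun θ v => ∫ e, w θ (e, v) * f θ (e, v) ∂q

/-- The logarithm of the average weight of a sample of size `M`. -/
def logAverage (M : ℕ) (w : (Fin p → ℝ) → E × W → ℝ) : (Fin p → ℝ) → (Fin M → E) × W → ℝ :=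
  fun θ z => Real.log ((M : ℝ)⁻¹ * ∑ i, w θ (z.1 i, z.2))

/-- The importance-weighted lower bound for the logarithm of the expected weight. -/
def iwBound (q : Measure E) (M : ℕ) (w f : (Fin p → ℝ) → E × W → ℝ) : (Fin p → ℝ) → W → ℝ :=
  fun θ v => ∫ z : Fin M → E, logAverage M w θ (z, v) * ∏ i, f θ (z i, v) ∂(Measure.pi fun _ => q)

theorem measurable_sampleProj {M : ℕ} (i : Fin M) :
    Measurable fun z : (Fin M → E) × W => (z.1 i, z.2) :=
  ((measurable_pi_apply i).comp measurable_fst).prodMk measurable_snd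

namespace WeightFamily

theorem le_average (hw : WeightFamily Θ A a b w) {n : ℕ} {θ : Fin p → ℝ} (hθ : θ ∈ Θ)
    (z : (Fin (n + 1) → E) × W) : a ≤ ((n + 1 : ℕ) : ℝ)⁻¹ * ∑ i, w θ (z.1 i, z.2) := by
  have := Finset.card_nsmul_le_sum (Finset.univ : Finset (Fin (n + 1)))
    (fun i => w θ (z.1 i, z.2)) a fun i _ => hw.lower θ hθ _
  rw [Finset.card_univ, Fintype.card_fin, nsmul_eq_mul] at this
  rw [← div_eq_inv_mul, le_div_iff₀ (by positivity)]
  linarith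

theorem c1Family_average (hw : WeightFamily Θ A a b w) (hΘ : IsParameterSet Θ) (n : ℕ) :
    C1Family Θ (2 * (((n + 1 : ℕ) : ℝ)⁻¹ * ((n + 1 : ℕ) * A)))
      (fun θ (z : (Fin (n + 1) → E) × W) => ((n + 1 : ℕ) : ℝ)⁻¹ * ∑ i, w θ (z.1 i, z.2)) := by
  have h1 : C1Family Θ (((n + 1 : ℕ) : ℝ) * A)
      (fun θ (z : (Fin (n + 1) → E) × W) => ∑ i, w θ (z.1 i, z.2)) := by
    have := C1Family.sum hΘ Finset.univ
      (f := fun (i : Fin (n + 1)) θ (z : (Fin (n + 1) → E) × W) => w θ (z.1 i, z.2))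
      fun i _ => hw.c1.comp (measurable_sampleProj i)
    rwa [Finset.card_univ, Fintype.card_fin] at this
  exact (C1Family.const measurable_const fun _ => by
    rw [abs_of_pos (by positivity)]).mul h1 hΘ

theorem exists_c1Family_logAverage (ha : 0 < a) (A : ℝ) (n : ℕ) :
    ∃ C, ∀ {p : ℕ} {Θ : Set (Fin p → ℝ)} {E W : Type*} [MeasurableSpace E] [MeasurableSpace W]
      {w : (Fin p → ℝ) → E × W → ℝ}, IsParameterSet Θ → WeightFamily Θ A a b w →
        C1Family Θ C (logAverage (n + 1) w) :=
  ⟨_, fun hΘ hw => (hw.c1Family_average hΘ n).log hΘ ha fun _ hθ z => hw.le_average hθ z⟩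

theorem famGrad_logAverage (hw : WeightFamily Θ A a b w) (hΘ : IsParameterSet Θ) (ha : 0 < a)
    {n : ℕ} {θ : Fin p → ℝ} (hθ : θ ∈ Θ) (z : (Fin (n + 1) → E) × W) (i : Fin p) :
    famGrad Θ i (logAverage (n + 1) w) θ z =
      (∑ k, w θ (z.1 k, z.2))⁻¹ * ∑ k, famGrad Θ i w θ (z.1 k, z.2) := by
  have h := (hw.c1Family_average hΘ n).famGrad_log hΘ ha (fun _ hθ z => hw.le_average hθ z) hθ z i
  have h1 : famGrad Θ i (fun θ (z : (Fin (n + 1) → E) × W) =>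
      ((n + 1 : ℕ) : ℝ)⁻¹ * ∑ i, w θ (z.1 i, z.2)) θ z =
      ((n + 1 : ℕ) : ℝ)⁻¹ * ∑ k, famGrad Θ i w θ (z.1 k, z.2) := by
    simp only [famGrad]
    rw [relGrad_mul hΘ hθ (differentiableOn_const _)
      (DifferentiableOn.fun_sum fun k _ => hw.c1.diff (z.1 k, z.2)), relGrad_const, zero_mul,
      add_zero, relGrad_sum hΘ hθ _ fun k _ => hw.c1.diff (z.1 k, z.2)]
  rw [h1] at h
  refine h.trans ?_
  rw [mul_inv, inv_inv]
  have : ((n + 1 : ℕ) : ℝ) ≠ 0 := by positivity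
  field_simp

end WeightFamily

/-- The remaining factors are indexed by `Fin n` through `succAbove`, which matches the splitting of
the product measure at coordinate `k`. -/
theorem relGrad_prod_succ {θ : Fin p → ℝ} (hΘ : IsParameterSet Θ) (hθ : θ ∈ Θ) {n : ℕ}
    {g : Fin (n + 1) → (Fin p → ℝ) → ℝ} (hg : ∀ k, DifferentiableOn ℝ (g k) Θ) (i : Fin p) :
    relGrad Θ (fun θ => ∏ k, g k θ) θ i =
      ∑ k, relGrad Θ (g k) θ i * ∏ j, g (k.succAbove j) θ := by
  simp only [relGrad]
  rw [fderivWithin_finsetProd (hΘ.uniqueDiffWithinAt hθ) fun k _ => hg k θ hθ]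
  simp only [_root_.sum_apply, _root_.smul_apply, smul_eq_mul]
  refine Finset.sum_congr rfl fun k _ => ?_
  rw [mul_comm]
  congr 1
  rw [Fin.univ_succAbove n k]
  simp

variable [IsFiniteMeasure q]

theorem ScoreFamily.integrable (hf : ScoreFamily Θ q B K f) {θ : Fin p → ℝ} (hθ : θ ∈ Θ) (v : W) :
    Integrable (fun e => f θ (e, v)) q :=
  (hf.c1.comp measurable_prodMk_right).integrable hθ q

theorem ScoreFamily.integrable_famGrad (hf : ScoreFamily Θ q B K f) (hΘ : IsParameterSet Θ)
    {θ : Fin p → ℝ} (hθ : θ ∈ Θ) (v : W) (i : Fin p) :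
    Integrable (fun e => famGrad Θ i f θ (e, v)) q :=
  (hf.c1.comp measurable_prodMk_right).integrable_famGrad hΘ hθ q i

theorem ScoreFamily.integral_famGrad_eq_zero (hf : ScoreFamily Θ q B K f) (hΘ : IsParameterSet Θ)
    {θ : Fin p → ℝ} (hθ : θ ∈ Θ) (v : W) (i : Fin p) :
    ∫ e, famGrad Θ i f θ (e, v) ∂q = 0 := by
  rw [← hf.c1.famGrad_integral hΘ hθ q v i]
  simp only [famGrad]
  rw [relGrad_congr (g := fun _ => (1 : ℝ)) (fun θ hθ => hf.integral_eq_one θ hθ v) hθ,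
    relGrad_const]

theorem marginalLik_mem (hw : WeightFamily Θ A a b w) (hf : ScoreFamily Θ q B K f)
    {θ : Fin p → ℝ} (hθ : θ ∈ Θ) (v : W) : a ≤ marginalLik q w f θ v ∧ marginalLik q w f θ v ≤ b :=
  integral_mul_mem_of_density (hf.integrable hθ v) (fun _ => (hf.pos θ hθ _).le)
    (hf.integral_eq_one θ hθ v) ((hw.c1.measurable θ hθ).comp measurable_prodMk_right)
    (fun _ => hw.lower θ hθ _) fun _ => hw.upper θ hθ _

theorem c1Family_marginalLik (hw : WeightFamily Θ A a b w) (hf : C1Family Θ B f)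
    (hΘ : IsParameterSet Θ) :
    C1Family Θ (2 * (A * B) * q.real Set.univ) (marginalLik q w f) :=
  (hw.c1.mul hf hΘ).integral hΘ q

theorem c1Family_log_marginalLik (hw : WeightFamily Θ A a b w) (hf : ScoreFamily Θ q B K f)
    (hΘ : IsParameterSet Θ) (ha : 0 < a) (hAB : 0 ≤ A * B) {Q : ℝ} (hQ : q.real Set.univ ≤ Q) :
    C1Family Θ (|Real.log a| + |Real.log (2 * (A * B) * Q)| + 2 * (A * B) * Q / a)
      (fun θ v => Real.log (marginalLik q w f θ v)) :=
  ((c1Family_marginalLik hw hf.c1 hΘ).mono (mul_le_mul_of_nonneg_left hQ (by positivity))).log hΘ ha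
    fun _ hθ v => (marginalLik_mem hw hf hθ v).1

theorem c1Family_log_marginalLik_sub (hw : WeightFamily Θ A a b w) (hf : ScoreFamily Θ q B K f)
    (hf' : ScoreFamily Θ q B K f') (hΘ : IsParameterSet Θ) (ha : 0 < a)
    (h : C1Family Θ η (fun θ z => f θ z - f' θ z)) :
    C1Family Θ ((a⁻¹ + 2 * (A * B) * q.real Set.univ / a ^ 2) *
      (2 * (A * η) * q.real Set.univ))
      (fun θ v => Real.log (marginalLik q w f θ v) - Real.log (marginalLik q w f' θ v)) := by
  refine C1Family.log_sub_log (c1Family_marginalLik hw hf.c1 hΘ) (c1Family_marginalLik hw hf'.c1 hΘ)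
    hΘ ha (fun _ hθ v => (marginalLik_mem hw hf hθ v).1)
    (fun _ hθ v => (marginalLik_mem hw hf' hθ v).1) ?_
  refine ((hw.c1.mul h hΘ).integral hΘ q).congr fun θ hθ v => ?_
  simp only [mul_sub, marginalLik]
  exact integral_sub (((hw.c1.mul hf.c1 hΘ).comp measurable_prodMk_right).integrable hθ q)
    (((hw.c1.mul hf'.c1 hΘ).comp measurable_prodMk_right).integrable hθ q)

theorem famGrad_log_marginalLik (hw : WeightFamily Θ A a b w) (hf : ScoreFamily Θ q B K f)
    (hΘ : IsParameterSet Θ) (ha : 0 < a) {θ : Fin p → ℝ} (hθ : θ ∈ Θ) (v : W) (i : Fin p) :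
    famGrad Θ i (fun θ v => Real.log (marginalLik q w f θ v)) θ v =
      (marginalLik q w f θ v)⁻¹ * (∫ e, w θ (e, v) * famGrad Θ i f θ (e, v) ∂q +
        ∫ e, famGrad Θ i w θ (e, v) * f θ (e, v) ∂q) := by
  have h1 : ∀ e, |w θ (e, v)| ≤ A := fun e => hw.c1.bound θ hθ _
  rw [(c1Family_marginalLik hw hf.c1 hΘ).famGrad_log hΘ ha
    (fun _ hθ v => (marginalLik_mem hw hf hθ v).1) hθ v i]
  congr 1
  refine ((hw.c1.mul hf.c1 hΘ).famGrad_integral hΘ hθ q v i).trans ?_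
  simp only [hw.c1.famGrad_mul hf.c1 hΘ hθ]
  exact integral_add ((hf.integrable_famGrad hΘ hθ v i).bdd_mul (c := A)
      ((hw.c1.measurable θ hθ).comp measurable_prodMk_right).aestronglyMeasurable (.of_forall h1))
    ((hf.integrable hθ v).bdd_mul (c := A)
      ((hw.c1.measurable_famGrad hΘ hθ i).comp measurable_prodMk_right).aestronglyMeasurable
      (.of_forall fun e => hw.c1.grad θ hθ _ i))

/-- The constant is chosen before the measure and the families, so one constant serves all times. It
may depend on the sample size: here it only serves existence of the limits, not the rate in M. -/
theorem exists_c1Family_iwBound (ha : 0 < a) (A b B Q : ℝ) (n : ℕ) :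
    ∃ C, ∀ {p : ℕ} {Θ : Set (Fin p → ℝ)} {E W : Type*} [MeasurableSpace E] [MeasurableSpace W]
      {q : Measure E} [IsFiniteMeasure q] {w f : (Fin p → ℝ) → E × W → ℝ}, IsParameterSet Θ →
      q.real Set.univ ≤ Q → WeightFamily Θ A a b w → C1Family Θ B f →
        C1Family Θ C (iwBound q (n + 1) w f) := by
  obtain ⟨C₁, h₁⟩ := WeightFamily.exists_c1Family_logAverage (b := b) ha A n
  obtain ⟨C₂, h₂⟩ := C1Family.exists_prod_bound B (n + 1)
  refine ⟨2 * (|C₁| * |C₂|) * Q ^ (n + 1), fun {p Θ E W _ _ q _ w f} hΘ hQ hw hf => ?_⟩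
  have h3 := h₂ hΘ (fun k θ (z : (Fin (n + 1) → E) × W) => f θ (z.1 k, z.2))
    fun k => hf.comp (measurable_sampleProj k)
  have h4 := (((h₁ hΘ hw).mono (le_abs_self C₁)).mul (h3.mono (le_abs_self C₂)) hΘ).integral hΘ
    (Measure.pi fun _ : Fin (n + 1) => q)
  refine h4.mono (mul_le_mul_of_nonneg_left ?_ (by positivity))
  simp only [measureReal_def, Measure.pi_univ, Finset.prod_const, Finset.card_univ, Fintype.card_fin,
    ENNReal.toReal_pow] at hQ ⊢
  gcongr

theorem exists_c1Family_iwBound_sub (ha : 0 < a) (A b B Q : ℝ) (n : ℕ) :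
    ∃ C, 0 ≤ C ∧ ∀ {p : ℕ} {Θ : Set (Fin p → ℝ)} {E W : Type*} [MeasurableSpace E]
      [MeasurableSpace W] {q : Measure E} [IsFiniteMeasure q] {w f f' : (Fin p → ℝ) → E × W → ℝ}
      {η : ℝ}, IsParameterSet Θ → 0 ≤ η → q.real Set.univ ≤ Q → WeightFamily Θ A a b w →
      C1Family Θ B f → C1Family Θ B f' → C1Family Θ η (fun θ z => f θ z - f' θ z) →
        C1Family Θ (C * η) (fun θ v => iwBound q (n + 1) w f θ v - iwBound q (n + 1) w f' θ v) := by
  obtain ⟨C₁, h₁⟩ := WeightFamily.exists_c1Family_logAverage (b := b) ha A n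
  obtain ⟨C₂, h₂⟩ := C1Family.exists_prod_sub_prod_bound B (n + 1)
  obtain ⟨C₃, h₃⟩ := C1Family.exists_prod_bound B (n + 1)
  refine ⟨2 * (|C₁| * |C₂|) * |Q| ^ (n + 1), by positivity,
    fun {p Θ E W _ _ q _ w f f' η} hΘ hη hQ hw hf hf' h => ?_⟩
  have hl := (h₁ hΘ hw).mono (le_abs_self C₁)
  have hp := h₃ hΘ (fun k θ (z : (Fin (n + 1) → E) × W) => f θ (z.1 k, z.2))
    fun k => hf.comp (measurable_sampleProj k)
  have hp' := h₃ hΘ (fun k θ (z : (Fin (n + 1) → E) × W) => f' θ (z.1 k, z.2))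
    fun k => hf'.comp (measurable_sampleProj k)
  have h3 := h₂ hΘ η (fun k θ (z : (Fin (n + 1) → E) × W) => f θ (z.1 k, z.2))
    (fun k θ (z : (Fin (n + 1) → E) × W) => f' θ (z.1 k, z.2))
    (fun k => hf.comp (measurable_sampleProj k)) (fun k => hf'.comp (measurable_sampleProj k))
    fun k => h.comp (measurable_sampleProj k)
  have h3' := h3.mono (mul_le_mul_of_nonneg_right (le_abs_self C₂) hη)
  have h4 := (hl.mul h3' hΘ).integral hΘ (Measure.pi fun _ : Fin (n + 1) => q)
  refine (h4.mono ?_).congr fun θ hθ v => ?_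
  · have : (Measure.pi fun _ : Fin (n + 1) => q).real Set.univ ≤ |Q| ^ (n + 1) := by
      replace hQ := hQ.trans (le_abs_self Q)
      simp only [measureReal_def, Measure.pi_univ, Finset.prod_const, Finset.card_univ,
        Fintype.card_fin, ENNReal.toReal_pow] at hQ ⊢
      gcongr
    calc _ ≤ 2 * (|C₁| * (|C₂| * η)) * |Q| ^ (n + 1) := by gcongr
      _ = _ := by ring
  · simp only [mul_sub, iwBound]
    exact integral_sub (((hl.mul hp hΘ).comp measurable_prodMk_right).integrable hθ _)
      (((hl.mul hp' hΘ).comp measurable_prodMk_right).integrable hθ _)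

theorem integral_pi_density_eq (hf : ScoreFamily Θ q B K f) {θ : Fin p → ℝ} (hθ : θ ∈ Θ) (v : W)
    {n : ℕ} (Φ : (Fin n → E) → ℝ) :
    ∫ z, Φ z ∂(Measure.pi fun _ => measureOfDensity q fun e => f θ (e, v)) =
      ∫ z, Φ z * ∏ i, f θ (z i, v) ∂(Measure.pi fun _ => q) :=
  integral_pi_measureOfDensity ((hf.c1.measurable θ hθ).comp measurable_prodMk_right)
    (hf.integrable hθ v) (fun _ => (hf.pos θ hθ _).le) n Φ

omit [MeasurableSpace E] [MeasurableSpace W] in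
theorem logAverage_insert {n : ℕ} {θ : Fin p → ℝ} (v : W) (z : Fin (n + 1) → E)
    (k : Fin (n + 1)) : logAverage (n + 1) w θ (z, v) =
      Real.log (((n + 1 : ℕ) : ℝ)⁻¹ * w θ (z k, v) +
        ((n + 1 : ℕ) : ℝ)⁻¹ * ∑ j, w θ (z (k.succAbove j), v)) := by
  rw [logAverage, Fin.sum_univ_succAbove _ k, mul_add]

/-- The gradient of the importance-weighted bound. -/
theorem famGrad_iwBound (hw : WeightFamily Θ A a b w) (hf : ScoreFamily Θ q B K f)
    (hΘ : IsParameterSet Θ) (ha : 0 < a) (n : ℕ) {θ : Fin p → ℝ} (hθ : θ ∈ Θ) (v : W) (i : Fin p) :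
    famGrad Θ i (iwBound q (n + 1) w f) θ v =
      ∫ z : Fin (n + 1) → E, (∑ k, w θ (z k, v))⁻¹ * ∑ k, famGrad Θ i w θ (z k, v)
        ∂(Measure.pi fun _ => measureOfDensity q fun e => f θ (e, v)) +
      ((n + 1 : ℕ) : ℝ) * ∫ e, (∫ z : Fin n → E, Real.log (((n + 1 : ℕ) : ℝ)⁻¹ * w θ (e, v) +
        ((n + 1 : ℕ) : ℝ)⁻¹ * ∑ j, w θ (z j, v))
        ∂(Measure.pi fun _ => measureOfDensity q fun e => f θ (e, v))) * famGrad Θ i f θ (e, v)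
          ∂q := by
  obtain ⟨C₁, h₁⟩ := WeightFamily.exists_c1Family_logAverage (b := b) ha A n
  obtain ⟨C₃, h₃⟩ := C1Family.exists_prod_bound B (n + 1)
  have hl := h₁ hΘ hw
  have hp := h₃ hΘ (fun k θ (z : (Fin (n + 1) → E) × W) => f θ (z.1 k, z.2))
    fun k => hf.c1.comp (measurable_sampleProj k)
  set Q : Measure (Fin (n + 1) → E) := Measure.pi fun _ => q with hQ
  have hlm : ∀ {h : (Fin (n + 1) → E) → ℝ}, Integrable h Q →
      Integrable (fun z => logAverage (n + 1) w θ (z, v) * h z) Q := fun hh =>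
    hh.bdd_mul (c := C₁) ((hl.measurable θ hθ).comp measurable_prodMk_right).aestronglyMeasurable
      (.of_forall fun z => hl.bound θ hθ _)
  set D : Fin (n + 1) → (Fin (n + 1) → E) → ℝ := fun k z =>
    famGrad Θ i f θ (z k, v) * ∏ j, f θ (z (k.succAbove j), v) with hD
  have hDi : ∀ k, Integrable (D k) Q := fun k => by
    refine .of_bound (C := B * B ^ n) ?_ (.of_forall fun z => ?_)
    · exact (((hf.c1.measurable_famGrad hΘ hθ i).comp
        ((measurable_pi_apply k).prodMk measurable_const)).mul
        (Finset.measurable_prod _ fun j _ => (hf.c1.measurable θ hθ).comp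
          ((measurable_pi_apply _).prodMk measurable_const))).aestronglyMeasurable
    · rw [Real.norm_eq_abs, abs_mul, Finset.abs_prod]
      have hB : 0 ≤ B := (abs_nonneg _).trans (hf.c1.bound θ hθ (z k, v))
      refine mul_le_mul (hf.c1.grad θ hθ _ _) ?_ (Finset.prod_nonneg fun _ _ => abs_nonneg _) hB
      calc _ ≤ ∏ _j : Fin n, B := Finset.prod_le_prod (fun _ _ => abs_nonneg _)
            fun _ _ => hf.c1.bound θ hθ _
        _ = _ := by simp
  have hprod : ∀ z, famGrad Θ i (fun θ (z : (Fin (n + 1) → E) × W) => ∏ k, f θ (z.1 k, z.2)) θ (z, v)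
      = ∑ k, D k z := fun z =>
    relGrad_prod_succ hΘ hθ (g := fun k θ => f θ (z k, v)) (fun k => hf.c1.diff _) i
  -- The log-average is symmetric in the samples, so each factor of the product density contributes
  -- the same integral. Their number is the factor M.
  have hsym : ∀ k, ∫ z, logAverage (n + 1) w θ (z, v) * D k z ∂Q =
      ∫ e, (∫ z : Fin n → E, Real.log (((n + 1 : ℕ) : ℝ)⁻¹ * w θ (e, v) +
        ((n + 1 : ℕ) : ℝ)⁻¹ * ∑ j, w θ (z j, v))
        ∂(Measure.pi fun _ => measureOfDensity q fun e => f θ (e, v))) * famGrad Θ i f θ (e, v)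
          ∂q := by
    intro k
    set Φ : E × (Fin n → E) → ℝ := fun s => Real.log (((n + 1 : ℕ) : ℝ)⁻¹ * w θ (s.1, v) +
      ((n + 1 : ℕ) : ℝ)⁻¹ * ∑ j, w θ (s.2 j, v)) *
        (famGrad Θ i f θ (s.1, v) * ∏ j, f θ (s.2 j, v)) with hΦ
    have hmp := measurePreserving_piFinSuccAbove (fun _ : Fin (n + 1) => q) k
    have e : ∀ z, logAverage (n + 1) w θ (z, v) * D k z =
        Φ (MeasurableEquiv.piFinSuccAbove (fun _ => E) k z) := fun z => by
      rw [logAverage_insert v z k]; rfl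
    have hi : Integrable Φ (q.prod (Measure.pi fun _ => q)) := by
      rw [← hmp.integrable_comp_emb (MeasurableEquiv.measurableEmbedding _)]
      exact (hlm (hDi k)).congr (.of_forall e)
    simp only [e]
    rw [hmp.integral_comp', integral_prod _ hi]
    refine integral_congr_ae (.of_forall fun x => ?_)
    simp only [hΦ]
    rw [integral_pi_density_eq hf hθ v, ← integral_mul_const]
    exact integral_congr_ae (.of_forall fun z => by simp only []; ring)
  have hsi : Integrable (fun z => ∑ k, D k z) Q := integrable_finsetSum _ fun k _ => hDi k
  refine ((hl.mul hp hΘ).famGrad_integral hΘ hθ Q v i).trans ?_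
  simp only [hl.famGrad_mul hp hΘ hθ, hprod]
  have hgi : Integrable (fun z : Fin (n + 1) → E =>
      famGrad Θ i (logAverage (n + 1) w) θ (z, v) * ∏ k, f θ (z k, v)) Q :=
    (((hp.comp measurable_prodMk_right).integrable hθ Q)).bdd_mul (c := C₁)
      ((hl.measurable_famGrad hΘ hθ i).comp measurable_prodMk_right).aestronglyMeasurable
      (.of_forall fun z => hl.grad θ hθ _ i)
  rw [integral_add (hlm hsi) hgi, add_comm]
  congr 1
  · rw [integral_pi_density_eq hf hθ v]
    simp only [hw.famGrad_logAverage hΘ ha hθ, hQ]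
  · have : ∫ z, logAverage (n + 1) w θ (z, v) * ∑ k, D k z ∂Q =
        ∑ k, ∫ z, logAverage (n + 1) w θ (z, v) * D k z ∂Q := by
      simp only [Finset.mul_sum]
      exact integral_finsetSum _ fun k _ => hlm (hDi k)
    rw [this]
    simp only [hsym]
    rw [Finset.sum_const, Finset.card_univ, Fintype.card_fin, nsmul_eq_mul]

theorem integrable_integral_log_insert (hw : WeightFamily Θ A a b w) (hf : ScoreFamily Θ q B K f)
    (hΘ : IsParameterSet Θ) (ha : 0 < a) (n : ℕ) {θ : Fin p → ℝ} (hθ : θ ∈ Θ) (v : W) (i : Fin p) :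
    Integrable (fun e => (∫ z : Fin n → E, Real.log (((n + 1 : ℕ) : ℝ)⁻¹ * w θ (e, v) +
        ((n + 1 : ℕ) : ℝ)⁻¹ * ∑ j, w θ (z j, v))
        ∂(Measure.pi fun _ => measureOfDensity q fun e => f θ (e, v))) *
          famGrad Θ i f θ (e, v)) q := by
  have hP : IsProbabilityMeasure (measureOfDensity q fun e => f θ (e, v)) :=
    isProbabilityMeasure_measureOfDensity (hf.integrable hθ v) (fun e => (hf.pos θ hθ _).le)
      (hf.integral_eq_one θ hθ v)
  obtain ⟨C₁, h₁⟩ := WeightFamily.exists_c1Family_logAverage (b := b) ha A n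
  have hl := h₁ hΘ hw
  have hwm : Measurable fun e => w θ (e, v) := (hw.c1.measurable θ hθ).comp measurable_prodMk_right
  have hm : Measurable fun s : (Fin n → E) × E =>
      Real.log (((n + 1 : ℕ) : ℝ)⁻¹ * w θ (s.2, v) +
        ((n + 1 : ℕ) : ℝ)⁻¹ * ∑ j, w θ (s.1 j, v)) :=
    (((hwm.comp measurable_snd).const_mul _).add ((Finset.measurable_sum _ fun j _ =>
      hwm.comp ((measurable_pi_apply j).comp measurable_fst)).const_mul _)).log
  refine (hf.integrable_famGrad hΘ hθ v i).bdd_mul (c := C₁)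
    hm.stronglyMeasurable.integral_prod_left'.measurable.aestronglyMeasurable
    (.of_forall fun e => ?_)
  refine (norm_integral_le_of_norm_le_const (C := C₁) (.of_forall fun z => ?_)).trans (by simp)
  have := hl.bound θ hθ (Fin.cons e z, v)
  rw [logAverage, Fin.sum_univ_succ, mul_add] at this
  simpa using this

/-- The gradient of the importance-weighted bound approximates the gradient of the logarithm of the
expected weight, at a rate inverse to the sample size. -/
theorem abs_famGrad_iwBound_sub_le (hw : WeightFamily Θ A a b w) (hf : ScoreFamily Θ q B K f)
    (hΘ : IsParameterSet Θ) (ha : 0 < a) (n : ℕ) {θ : Fin p → ℝ} (hθ : θ ∈ Θ)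
    (v : W) (i : Fin p) :
    |famGrad Θ i (iwBound q (n + 1) w f) θ v -
      famGrad Θ i (fun θ v => Real.log (marginalLik q w f θ v)) θ v| ≤
      ((A ^ 2 + b ^ 2) / a ^ 2 + A * b ^ 2 / a ^ 3 + (b ^ 2 / a ^ 2 + b ^ 3 / a ^ 3) * K) /
        ((n + 1 : ℕ) : ℝ) := by
  rw [famGrad_iwBound hw hf hΘ ha n hθ v i, famGrad_log_marginalLik hw hf hΘ ha hθ v i]
  have hfm : Measurable fun e => f θ (e, v) := (hf.c1.measurable θ hθ).comp measurable_prodMk_right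
  have hf0 : ∀ e, 0 ≤ f θ (e, v) := fun e => (hf.pos θ hθ _).le
  have hwm : Measurable fun e => w θ (e, v) := (hw.c1.measurable θ hθ).comp measurable_prodMk_right
  have hgm : Measurable fun e => famGrad Θ i w θ (e, v) :=
    (hw.c1.measurable_famGrad hΘ hθ i).comp measurable_prodMk_right
  have hφi := hf.integrable_famGrad hΘ hθ v i
  have hφ0 := hf.integral_famGrad_eq_zero hΘ hθ v i
  have hP : IsProbabilityMeasure (measureOfDensity q fun e => f θ (e, v)) :=
    isProbabilityMeasure_measureOfDensity (hf.integrable hθ v) hf0 (hf.integral_eq_one θ hθ v)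
  set π := measureOfDensity q fun e => f θ (e, v) with hπ
  set φ : E → ℝ := fun e => famGrad Θ i f θ (e, v) with hφ
  set M : ℝ := ((n + 1 : ℕ) : ℝ) with hM
  have hMn : M = (n : ℝ) + 1 := by rw [hM]; push_cast; rfl
  have hM0 : 0 < M := by rw [hMn]; positivity
  have hc : ∫ e, w θ (e, v) ∂π = marginalLik q w f θ v := by
    rw [hπ, integral_measureOfDensity hfm hf0]; simp only [marginalLik, mul_comm]
  have hd : ∫ e, famGrad Θ i w θ (e, v) ∂π = ∫ e, famGrad Θ i w θ (e, v) * f θ (e, v) ∂q := by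
    rw [hπ, integral_measureOfDensity hfm hf0]; simp only [mul_comm]
  have hcm := marginalLik_mem hw hf hθ v
  set c := marginalLik q w f θ v with hcdef
  have hc0 := ha.trans_le hcm.1
  -- The first half: the self-normalised estimate of the weight gradient.
  have h1 := abs_integral_ratio_sub_le (π := π) hwm hgm ha (fun e => hw.lower θ hθ _)
    (fun e => hw.upper θ hθ _) (fun e => hw.c1.grad θ hθ _ i) n
  rw [hc, hd, ← hMn] at h1
  set ψ : ℝ → ℝ := fun x => ∫ z : Fin n → E, Real.log (M⁻¹ * x + M⁻¹ * ∑ j, w θ (z j, v))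
    ∂(Measure.pi fun _ => π) with hψ
  have h2 : ∀ e, |M * (ψ (w θ (e, v)) - ψ c) - (w θ (e, v) - c) / c| ≤
      (b ^ 2 / a ^ 2 + b ^ 3 / a ^ 3) / M := fun e => by
    have := abs_integral_log_sub_le (π := π) hwm ha (fun e => hw.lower θ hθ _)
      (fun e => hw.upper θ hθ _) n (hw.lower θ hθ (e, v)) (hw.upper θ hθ (e, v))
    rw [hc, ← hMn] at this
    exact this
  have hb0 : 0 < b := hc0.trans_le hcm.2
  set c₂ := (b ^ 2 / a ^ 2 + b ^ 3 / a ^ 3) / M with hc₂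
  have hc₂0 : 0 ≤ c₂ := by positivity
  set R : E → ℝ := fun e => M * (ψ (w θ (e, v)) - ψ c) - (w θ (e, v) - c) / c with hR
  have hψm : Measurable fun e => ψ (w θ (e, v)) := by
    have : Measurable fun s : (Fin n → E) × E =>
        Real.log (M⁻¹ * w θ (s.2, v) + M⁻¹ * ∑ j, w θ (s.1 j, v)) :=
      (((hwm.comp measurable_snd).const_mul _).add ((Finset.measurable_sum _ fun j _ =>
        hwm.comp ((measurable_pi_apply j).comp measurable_fst)).const_mul _)).log
    exact this.stronglyMeasurable.integral_prod_left'.measurable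
  have hRm : Measurable R := ((hψm.sub_const _).const_mul _).sub ((hwm.sub_const _).div_const _)
  have hRi : Integrable (fun e => R e * φ e) q :=
    hφi.bdd_mul (c := c₂) hRm.aestronglyMeasurable (.of_forall h2)
  have hwi : Integrable (fun e => w θ (e, v) * φ e) q :=
    hφi.bdd_mul (c := A) hwm.aestronglyMeasurable (.of_forall fun e => hw.c1.bound θ hθ _)
  -- `ψ c` and the constant part of `(w - c) / c` do not depend on the sample `e`, so they vanish
  -- against `φ`, which has integral zero.
  have e2 : M * ∫ e, ψ (w θ (e, v)) * φ e ∂q =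
      ∫ e, R e * φ e ∂q + c⁻¹ * ∫ e, w θ (e, v) * φ e ∂q := by
    have e3 : ∀ e, ψ (w θ (e, v)) * φ e =
        M⁻¹ * (R e * φ e + c⁻¹ * (w θ (e, v) * φ e)) + (ψ c - M⁻¹) * φ e := fun e => by
      simp only [hR]; field_simp; ring
    simp only [e3]
    have hs : Integrable (fun e => M⁻¹ * (R e * φ e + c⁻¹ * (w θ (e, v) * φ e))) q :=
      (hRi.add (hwi.const_mul _)).const_mul _
    rw [integral_add hs (hφi.const_mul _),
      integral_const_mul, integral_const_mul, integral_add hRi (hwi.const_mul _),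
      integral_const_mul, hφ0]
    field_simp
    ring
  -- The score bound enters here: ∫ |φ| ≤ K ∫ f = K, so neither the mass of `q` nor a sup bound of
  -- the density affects the rate.
  have hR2 : |∫ e, R e * φ e ∂q| ≤ c₂ * K := by
    calc |∫ e, R e * φ e ∂q| ≤ ∫ e, |R e * φ e| ∂q := abs_integral_le_integral_abs
      _ ≤ ∫ e, c₂ * K * f θ (e, v) ∂q := by
          refine integral_mono hRi.abs ((hf.integrable hθ v).const_mul _) fun e => ?_
          simp only []
          rw [abs_mul, mul_assoc]
          exact mul_le_mul (h2 e) (hf.score θ hθ _ i) (abs_nonneg _) hc₂0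
      _ = c₂ * K := by rw [integral_const_mul, hf.integral_eq_one θ hθ v, mul_one]
  rw [e2]
  refine le_trans (le_of_eq ?_) ((abs_add_le _ _).trans (add_le_add h1 hR2)) |>.trans (le_of_eq ?_)
  · congr 1
    rw [div_eq_inv_mul]
    ring
  · rw [hc₂]; field_simp

end ImportanceWeighting

/-! ### The objectives of the model in terms of weights and filter densities. -/

namespace ParamSSM

variable {p : ℕ} {X Y U W : Type*} [MeasurableSpace X] [MeasurableSpace Y] [MeasurableSpace U]
  [MeasurableSpace W] {S : ParamSSM p X Y U} {ε κ : ℝ}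

/-- A bound for the importance weights and their partial derivatives. -/
def weightBound (ε κ : ℝ) : ℝ :=
  2 * (2 * ((ε⁻¹ + κ) * (ε⁻¹ + κ)) * (ε⁻¹ + (ε⁻¹ + κ) / ε ^ 2))

/-- The importance weight as a function of state and auxiliary variable, for an observation
computed from a further variable. -/
def weightAt (S : ParamSSM p X Y U) (Yo : W → Y) : (Fin p → ℝ) → (X × U) × W → ℝ :=
  fun θ z => S.weight θ z.1.1 (Yo z.2) z.1.2

namespace Assumptions

/-- The reparameterisation is never differentiated by itself: the weight is built from three
functions whose composites with it are differentiable by assumption. -/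
theorem weightFamily (hS : S.Assumptions ε κ) (hε : 0 < ε) (hκ : 0 ≤ κ) {Yo : W → Y}
    (hY : Measurable Yo) :
    WeightFamily S.Θ (weightBound ε κ) (ε ^ 3) (ε⁻¹ ^ 3) (S.weightAt Yo) := by
  have hΘ := hS.isParameterSet
  have hi : 0 < ε⁻¹ := inv_pos.2 hε
  have hrep : ∀ θ ∈ S.Θ, Measurable fun z : (X × U) × W => S.rep θ z.1.1 (Yo z.2) z.1.2 :=
    fun θ hθ => (hS.measurable_rep θ hθ).comp (f := fun z : (X × U) × W => (z.1.1, Yo z.2, z.1.2))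
      (by fun_prop)
  have hb : ∀ {f : (Fin p → ℝ) → ℝ} {θ : Fin p → ℝ} {i : Fin p}, ‖relGrad S.Θ f θ‖ ≤ κ →
      |relGrad S.Θ f θ i| ≤ ε⁻¹ + κ := fun {f θ i} h => by
    have := (norm_le_pi_norm _ i).trans h
    rw [Real.norm_eq_abs] at this; linarith
  have hv : ∀ {x : ℝ}, ε ≤ x ∧ x ≤ ε⁻¹ → |x| ≤ ε⁻¹ + κ := fun {x} h => by
    rw [abs_of_pos (hε.trans_le h.1)]; linarith [h.2]
  have hm : C1Family S.Θ (ε⁻¹ + κ) (fun θ (z : (X × U) × W) =>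
      S.m θ z.1.1 (S.rep θ z.1.1 (Yo z.2) z.1.2)) :=
    ⟨fun θ hθ => (hS.density_m θ hθ).measurable.comp
      ((measurable_fst.comp measurable_fst).prodMk (hrep θ hθ)), fun z => hS.diff_m_rep _ _ _,
      fun θ hθ z => hv (hS.bounds_m θ hθ _ _), fun θ hθ z i => hb (hS.grad_m_rep θ hθ _ _ _)⟩
  have hg : C1Family S.Θ (ε⁻¹ + κ) (fun θ (z : (X × U) × W) =>
      S.g θ (S.rep θ z.1.1 (Yo z.2) z.1.2) (Yo z.2)) :=
    ⟨fun θ hθ => (hS.density_g θ hθ).measurable.comp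
      ((hrep θ hθ).prodMk (hY.comp measurable_snd)), fun z => hS.diff_g_rep _ _ _,
      fun θ hθ z => hv (hS.bounds_g θ hθ _ _), fun θ hθ z i => hb (hS.grad_g_rep θ hθ _ _ _)⟩
  have hr : C1Family S.Θ (ε⁻¹ + κ) (fun θ (z : (X × U) × W) =>
      S.r θ z.1.1 (Yo z.2) (S.rep θ z.1.1 (Yo z.2) z.1.2)) :=
    ⟨fun θ hθ => (hS.density_r θ hθ).measurable.comp (f := fun z : (X × U) × W =>
        ((z.1.1, Yo z.2), S.rep θ z.1.1 (Yo z.2) z.1.2))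
      (((measurable_fst.comp measurable_fst).prodMk (hY.comp measurable_snd)).prodMk (hrep θ hθ)),
      fun z => hS.diff_r_rep _ _ _,
      fun θ hθ z => hv (hS.bounds_r θ hθ _ _ _), fun θ hθ z i => hb (hS.grad_r_rep θ hθ _ _ _)⟩
  refine ⟨(hm.mul hg hΘ).mul (hr.inv hΘ hε fun θ hθ z => (hS.bounds_r θ hθ _ _ _).1) hΘ,
    fun θ hθ z => ?_, fun θ hθ z => ?_⟩
  all_goals
    have h1 := hS.bounds_m θ hθ z.1.1 (S.rep θ z.1.1 (Yo z.2) z.1.2)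
    have h2 := hS.bounds_g θ hθ (S.rep θ z.1.1 (Yo z.2) z.1.2) (Yo z.2)
    have h3 := hS.bounds_r θ hθ z.1.1 (Yo z.2) (S.rep θ z.1.1 (Yo z.2) z.1.2)
    have p1 := hε.trans_le h1.1
    have p2 := hε.trans_le h2.1
    have p3 := hε.trans_le h3.1
    simp only [weightAt, weight]
  · calc ε ^ 3 = ε * ε / ε⁻¹ := by field_simp
      _ ≤ _ := by gcongr <;> [exact h1.1; exact h2.1; exact h3.2]
  · calc _ ≤ ε⁻¹ * ε⁻¹ / ε := by gcongr <;> [exact h1.2; exact h2.2; exact h3.1]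
      _ = _ := by field_simp

/-- The importance weights are unbiased for the predictive likelihood. -/
theorem integral_weight (hS : S.Assumptions ε κ) (hε : 0 < ε) {θ : Fin p → ℝ} (hθ : θ ∈ S.Θ)
    (x : X) (y : Y) :
    ∫ u, S.weight θ x y u ∂S.nu = ∫ x', S.g θ x' y * S.m θ x x' ∂S.lamX := by
  have hrep : Measurable (S.rep θ x y) :=
    (hS.measurable_rep θ hθ).comp (f := fun u : U => (x, y, u)) (by fun_prop)
  have hr : Measurable fun x' => S.r θ x y x' :=
    (hS.density_r θ hθ).measurable.comp (f := fun x' : X => ((x, y), x')) (by fun_prop)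
  have hF : Measurable fun x' => S.m θ x x' * S.g θ x' y / S.r θ x y x' :=
    (((hS.density_m θ hθ).measurable.comp measurable_prodMk_left).mul
      ((hS.density_g θ hθ).measurable.comp measurable_prodMk_right)).div hr
  have hr0 : ∀ x', 0 < S.r θ x y x' := fun x' => hε.trans_le (hS.bounds_r θ hθ x y x').1
  have h := integral_map (μ := S.nu) hrep.aemeasurable hF.aestronglyMeasurable
  rw [hS.map_rep θ hθ, integral_measureOfDensity hr fun x' => (hr0 x').le] at h
  simp only [weight]
  rw [← h]
  refine integral_congr_ae (.of_forall fun x' => ?_)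
  have := (hr0 x').ne'
  simp only []
  field_simp

theorem c1Family_mul_lik (hS : S.Assumptions ε κ) (hε : 0 < ε) (hκ : 0 ≤ κ) :
    C1Family S.Θ (2 * ((ε⁻¹ + κ) * (ε⁻¹ + κ)))
      (fun θ (z : X × (X × Y)) => S.g θ z.1 z.2.2 * S.m θ z.2.1 z.1) :=
  ((hS.c1Family_g hε hκ).comp (ζ := fun z : X × (X × Y) => (z.1, z.2.2)) (by fun_prop)).mul
    ((hS.c1Family_m hε hκ).comp (ζ := fun z : X × (X × Y) => (z.2.1, z.1)) (by fun_prop))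
    hS.isParameterSet

theorem c1Family_weight (hS : S.Assumptions ε κ) (hε : 0 < ε) (hκ : 0 ≤ κ) :
    C1Family S.Θ (weightBound ε κ)
      (fun θ (z : U × (X × Y)) => S.weight θ z.2.1 z.2.2 z.1) :=
  (hS.weightFamily hε hκ (Yo := fun y : Y => y) measurable_id).c1.comp
    (ζ := fun z : U × (X × Y) => ((z.2.1, z.1), z.2.2)) (by fun_prop)

/-- Unbiasedness holds for every θ and may be differentiated on both sides. This matches
reparameterised gradients with gradients at fixed end point. -/
theorem integral_relGrad_weight (hS : S.Assumptions ε κ) (hε : 0 < ε) (hκ : 0 ≤ κ)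
    {θ : Fin p → ℝ} (hθ : θ ∈ S.Θ) (x : X) (y : Y) (i : Fin p) :
    ∫ u, relGrad S.Θ (fun θ => S.weight θ x y u) θ i ∂S.nu =
      ∫ x', relGrad S.Θ (fun θ => S.g θ x' y * S.m θ x x') θ i ∂S.lamX := by
  have := hS.finite_lamX
  have := hS.prob_nu
  have hΘ := hS.isParameterSet
  have h1 := (hS.c1Family_weight hε hκ).famGrad_integral hΘ hθ S.nu (x, y) i
  have h2 := (hS.c1Family_mul_lik hε hκ).famGrad_integral hΘ hθ S.lamX (x, y) i
  simp only [famGrad] at h1 h2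
  rw [← h1, ← h2, relGrad_congr (fun θ hθ => hS.integral_weight hε hθ x y) hθ]

theorem relGrad_lik_integral (hS : S.Assumptions ε κ) (hε : 0 < ε) (hκ : 0 ≤ κ)
    {θ : Fin p → ℝ} (hθ : θ ∈ S.Θ) (x : X) (y : Y) (i : Fin p) :
    (∫ x', relGrad S.Θ (fun θ => S.g θ x' y * S.m θ x x') θ ∂S.lamX) i =
      ∫ u, relGrad S.Θ (fun θ => S.weight θ x y u) θ i ∂S.nu := by
  have := hS.finite_lamX
  rw [hS.integral_relGrad_weight hε hκ hθ]
  exact eval_integral (fun j => ((hS.c1Family_mul_lik hε hκ).comp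
    (measurable_prodMk_right (y := (x, y)))).integrable_famGrad hS.isParameterSet hθ _ j) i

end Assumptions

/-- The auxiliary variable is independent of the state with a law free of θ, so the pair has the
same score as the state. -/
theorem DensityFamily.scoreFamily {K : ℝ} {μ : Measure X} [IsFiniteMeasure μ]
    {f : (Fin p → ℝ) → X × W → ℝ} (hf : S.DensityFamily ε K μ f) (hS : S.Assumptions ε κ)
    (hε : 0 < ε) (hK : 1 ≤ K) :
    ScoreFamily S.Θ (μ.prod S.nu) (K * ε⁻¹ ^ 5) K
      (fun θ (z : (X × U) × W) => f θ (z.1.1, z.2)) := by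
  have := hS.prob_nu
  exact ⟨(hf.c1Family hS.isParameterSet hε hK).comp
      (ζ := fun z : (X × U) × W => (z.1.1, z.2)) (by fun_prop),
    fun θ hθ z => hf.pos hε hθ _, fun θ hθ w => by
      rw [integral_fun_fst fun x => f θ (x, w)]; simp [hf.integral_eq_one θ hθ w],
    fun θ hθ z i => hf.abs_famGrad_le hS.isParameterSet hε hθ (z.1.1, z.2) i⟩

/-- The filter as a density for pairs of a state and an auxiliary variable. -/
def pairFilter (S : ParamSSM p X Y U) (t : ℕ) : (Fin p → ℝ) → (X × U) × (ℕ → Y) → ℝ :=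
  fun θ z => S.obsFilter t θ (z.1.1, z.2)

namespace Assumptions

theorem scoreFamily_pairFilter (hS : S.Assumptions ε κ) (hε : 0 < ε) (hε1 : ε < 1) (hκ : 1 ≤ κ)
    (t : ℕ) : ScoreFamily S.Θ ((S.filterBase t).prod S.nu) (4 * κ / ε ^ 3 * ε⁻¹ ^ 5)
      (4 * κ / ε ^ 3) (S.pairFilter t) := by
  have := hS.isFiniteMeasure_filterBase t
  have hK : 1 ≤ 4 * κ / ε ^ 3 := by
    rw [le_div_iff₀ (by positivity)]
    have : ε ^ 3 ≤ 1 := pow_le_one₀ hε.le hε1.le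
    linarith
  exact (hS.densityFamily_obsFilter hε hε1 (by linarith) t).scoreFamily hS hε hK

variable (hS : S.Assumptions ε κ) (hε : 0 < ε) (hε1 : ε < 1) (hκ : 1 ≤ κ) {θ : Fin p → ℝ}
  (hθ : θ ∈ S.Θ) (y : ℕ → Y) (t : ℕ)

include hS hε hε1 hκ hθ

theorem measurable_obsFilter : Measurable fun x => S.obsFilter t θ (x, y) := by
  obtain ⟨A, hA⟩ := (hS.densityFamily_obsFilter hε hε1 (by linarith) t).exists_c1
  exact (hA.measurable θ hθ).comp measurable_prodMk_right

/-- The factor `baseDensity` moves into the reference measure, leaving the bounded density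
`pairFilter`. -/
theorem sampleLaw_filterDensity :
    S.sampleLaw (S.filterDensity θ y t) = measureOfDensity ((S.filterBase t).prod S.nu)
      (fun e => S.pairFilter t θ (e, y)) := by
  have := hS.isFiniteMeasure_filterBase t
  have := hS.finite_lamX
  have := hS.prob_nu
  have hm := hS.measurable_obsFilter hε hε1 hκ hθ y t
  have h1 : measureOfDensity S.lamX (S.filterDensity θ y t) =
      measureOfDensity (S.filterBase t) (fun x => S.obsFilter t θ (x, y)) := by
    rw [filterBase_eq, measureOfDensity, measureOfDensity, measureOfDensity,
      ← withDensity_mul _ (hS.measurable_baseDensity t).ennreal_ofReal hm.ennreal_ofReal]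
    congr 1
    ext x
    rw [hS.filterDensity_eq hε hε1 (by linarith) hθ, Pi.mul_apply,
      ENNReal.ofReal_mul (hS.baseDensity_nonneg t x)]
  rw [sampleLaw, h1, measureOfDensity, prod_withDensity_left hm.ennreal_ofReal]
  rfl

theorem integral_mul_filterDensity (h : X → ℝ) :
    ∫ x, h x * S.filterDensity θ y t x ∂S.lamX =
      ∫ x, h x * S.obsFilter t θ (x, y) ∂(S.filterBase t) := by
  rw [hS.integral_filterBase]
  refine integral_congr_ae (.of_forall fun x => ?_)
  simp only []
  rw [hS.filterDensity_eq hε hε1 (by linarith) hθ]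
  ring

theorem integral_mul_tangentDensity (h : X → ℝ) (i : Fin p) :
    ∫ x, h x * S.tangentDensity θ y t x i ∂S.lamX =
      ∫ x, h x * famGrad S.Θ i (S.obsFilter t) θ (x, y) ∂(S.filterBase t) := by
  rw [hS.integral_filterBase]
  refine integral_congr_ae (.of_forall fun x => ?_)
  simp only []
  rw [hS.tangentDensity_eq hε hε1 (by linarith) hθ]
  ring

theorem integrable_mul_filterDensity {h : X → ℝ}
    (hh : Integrable (fun x => h x * S.obsFilter t θ (x, y)) (S.filterBase t)) :
    Integrable (fun x => h x * S.filterDensity θ y t x) S.lamX := by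
  rw [filterBase_eq, integrable_measureOfDensity (hS.measurable_baseDensity t)
    (hS.baseDensity_nonneg t)] at hh
  refine hh.congr (.of_forall fun x => ?_)
  simp only []
  rw [hS.filterDensity_eq hε hε1 (by linarith) hθ]
  ring

theorem integrable_mul_tangentDensity {h : X → ℝ} {i : Fin p}
    (hh : Integrable (fun x => h x * famGrad S.Θ i (S.obsFilter t) θ (x, y)) (S.filterBase t)) :
    Integrable (fun x => h x * S.tangentDensity θ y t x i) S.lamX := by
  rw [filterBase_eq, integrable_measureOfDensity (hS.measurable_baseDensity t)
    (hS.baseDensity_nonneg t)] at hh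
  refine hh.congr (.of_forall fun x => ?_)
  simp only []
  rw [hS.tangentDensity_eq hε hε1 (by linarith) hθ]
  ring

theorem predLik_filterDensity :
    S.predLik θ (y (t + 1)) (S.filterDensity θ y t) =
      marginalLik ((S.filterBase t).prod S.nu) (S.weightAt fun y : ℕ → Y => y (t + 1))
        (S.pairFilter t) θ y := by
  have := hS.isFiniteMeasure_filterBase t
  have := hS.prob_nu
  have hw := hS.weightFamily hε (by linarith) (measurable_pi_apply (t + 1) : Measurable fun y : ℕ → Y => y (t + 1))
  have hf := hS.scoreFamily_pairFilter hε hε1 hκ t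
  have hi := ((hw.c1.mul hf.c1 hS.isParameterSet).comp (measurable_prodMk_right (y := y))).integrable
    hθ ((S.filterBase t).prod S.nu)
  rw [predLik, hS.integral_mul_filterDensity hε hε1 hκ hθ, marginalLik, integral_prod _ hi]
  refine integral_congr_ae (.of_forall fun x => ?_)
  simp only [weightAt, pairFilter]
  rw [integral_mul_const, hS.integral_weight hε hθ]

theorem logPredLik_filterDensity :
    S.logPredLik θ (y (t + 1)) (S.filterDensity θ y t) =
      Real.log (marginalLik ((S.filterBase t).prod S.nu) (S.weightAt fun y : ℕ → Y => y (t + 1))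
        (S.pairFilter t) θ y) := by
  rw [logPredLik, hS.predLik_filterDensity hε hε1 hκ hθ]

theorem iwObjective_filterDensity (n : ℕ) :
    S.iwObjective n θ (y (t + 1)) (S.filterDensity θ y t) =
      iwBound ((S.filterBase t).prod S.nu) n (S.weightAt fun y : ℕ → Y => y (t + 1))
        (S.pairFilter t) θ y := by
  have := hS.isFiniteMeasure_filterBase t
  have := hS.prob_nu
  rw [iwObjective, hS.sampleLaw_filterDensity hε hε1 hκ hθ,
    integral_pi_density_eq (hS.scoreFamily_pairFilter hε hε1 hκ t) hθ]
  rfl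

/-- The product rule applied to ∫ w f gives the tangent term and the gradient term. Integrating the
auxiliary variable out of each turns weights into likelihoods. -/
theorem rmlGrad_filterDensity (i : Fin p) :
    S.rmlGrad θ (y (t + 1)) (S.filterDensity θ y t) (S.tangentDensity θ y t) i =
      famGrad S.Θ i (fun θ y => Real.log (marginalLik ((S.filterBase t).prod S.nu)
        (S.weightAt fun y : ℕ → Y => y (t + 1)) (S.pairFilter t) θ y)) θ y := by
  have := hS.isFiniteMeasure_filterBase t
  have := hS.prob_nu
  have hΘ := hS.isParameterSet
  have hw := hS.weightFamily hε (by linarith) (measurable_pi_apply (t + 1) : Measurable fun y : ℕ → Y => y (t + 1))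
  have hf := hS.scoreFamily_pairFilter hε hε1 hκ t
  rw [famGrad_log_marginalLik hw hf hΘ (by positivity) hθ, rmlGrad,
    hS.predLik_filterDensity hε hε1 hκ hθ]
  -- All coordinates are needed, because the coordinate of a vector-valued integral is computed by
  -- `eval_integral` only if every coordinate is integrable.
  have hi1 : ∀ j, Integrable (fun e : X × U => S.weightAt (fun y : ℕ → Y => y (t + 1)) θ (e, y) *
      famGrad S.Θ j (S.pairFilter t) θ (e, y)) ((S.filterBase t).prod S.nu) := fun j =>
    (hf.integrable_famGrad hΘ hθ y j).bdd_mul (c := weightBound ε κ)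
      ((hw.c1.measurable θ hθ).comp measurable_prodMk_right).aestronglyMeasurable
      (.of_forall fun e => hw.c1.bound θ hθ _)
  have hi2 : ∀ j, Integrable (fun e : X × U => famGrad S.Θ j (S.weightAt
      (fun y : ℕ → Y => y (t + 1))) θ (e, y) * S.pairFilter t θ (e, y))
      ((S.filterBase t).prod S.nu) := fun j =>
    (hf.integrable hθ y).bdd_mul (c := weightBound ε κ)
      ((hw.c1.measurable_famGrad hΘ hθ j).comp measurable_prodMk_right).aestronglyMeasurable
      (.of_forall fun e => hw.c1.grad θ hθ _ j)
  have e1 : ∀ j x, ∫ u, S.weightAt (fun y : ℕ → Y => y (t + 1)) θ ((x, u), y) *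
      famGrad S.Θ j (S.pairFilter t) θ ((x, u), y) ∂S.nu =
      (∫ x', S.g θ x' (y (t + 1)) * S.m θ x x' ∂S.lamX) *
        famGrad S.Θ j (S.obsFilter t) θ (x, y) := fun j x => by
    rw [← hS.integral_weight hε hθ, ← integral_mul_const]
    rfl
  have e2 : ∀ j x, ∫ u, famGrad S.Θ j (S.weightAt (fun y : ℕ → Y => y (t + 1))) θ ((x, u), y) *
      S.pairFilter t θ ((x, u), y) ∂S.nu =
      (∫ x', relGrad S.Θ (fun θ => S.g θ x' (y (t + 1)) * S.m θ x x') θ ∂S.lamX) j *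
        S.obsFilter t θ (x, y) := fun j x => by
    rw [hS.relGrad_lik_integral hε (by linarith) hθ, ← integral_mul_const]
    rfl
  have j1 : ∀ j, Integrable (fun x => (∫ x', S.g θ x' (y (t + 1)) * S.m θ x x' ∂S.lamX) *
        famGrad S.Θ j (S.obsFilter t) θ (x, y)) (S.filterBase t) := fun j => by
    simpa only [e1] using (hi1 j).integral_prod_left
  have j2 : ∀ j, Integrable (fun x =>
      (∫ x', relGrad S.Θ (fun θ => S.g θ x' (y (t + 1)) * S.m θ x x') θ ∂S.lamX) j *
        S.obsFilter t θ (x, y)) (S.filterBase t) := fun j => by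
    simpa only [e2] using (hi2 j).integral_prod_left
  have k1 := eval_integral (μ := S.lamX) (f := fun x =>
    (∫ x', S.g θ x' (y (t + 1)) * S.m θ x x' ∂S.lamX) • S.tangentDensity θ y t x)
    (fun j => hS.integrable_mul_tangentDensity hε hε1 hκ hθ y t (j1 j)) i
  have k2 := eval_integral (μ := S.lamX) (f := fun x => S.filterDensity θ y t x •
    (∫ x', relGrad S.Θ (fun θ => S.g θ x' (y (t + 1)) * S.m θ x x') θ ∂S.lamX))
    (fun j => (hS.integrable_mul_filterDensity hε hε1 hκ hθ y t (j2 j)).congr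
      (.of_forall fun x => by simp only [Pi.smul_apply, smul_eq_mul, mul_comm])) i
  rw [Pi.smul_apply, Pi.add_apply, k1, k2, smul_eq_mul, integral_prod _ (hi1 i),
    integral_prod _ (hi2 i)]
  simp only [e1, e2, Pi.smul_apply, smul_eq_mul]
  rw [hS.integral_mul_tangentDensity hε hε1 hκ hθ, ← hS.integral_mul_filterDensity hε hε1 hκ hθ]
  simp only [mul_comm (S.filterDensity θ y t _)]

/-- The two terms are exactly those of `famGrad_iwBound`, with the score integral carried out over
the auxiliary variable. In particular H^M is the gradient of the lower bound along the filter. -/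
theorem osiwaeGrad_filterDensity (n : ℕ) (i : Fin p) :
    S.osiwaeGrad (n + 1) θ (y (t + 1)) (S.filterDensity θ y t) (S.tangentDensity θ y t) i =
      famGrad S.Θ i (iwBound ((S.filterBase t).prod S.nu) (n + 1)
        (S.weightAt fun y : ℕ → Y => y (t + 1)) (S.pairFilter t)) θ y := by
  have := hS.isFiniteMeasure_filterBase t
  have := hS.prob_nu
  have hΘ := hS.isParameterSet
  have ha : 0 < ε ^ 3 := by positivity
  have hw := hS.weightFamily hε (by linarith) (measurable_pi_apply (t + 1) : Measurable fun y : ℕ → Y => y (t + 1))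
  have hf := hS.scoreFamily_pairFilter hε hε1 hκ t
  have hP : IsProbabilityMeasure (measureOfDensity ((S.filterBase t).prod S.nu)
      fun e => S.pairFilter t θ (e, y)) :=
    isProbabilityMeasure_measureOfDensity (hf.integrable hθ y) (fun e => (hf.pos θ hθ _).le)
      (hf.integral_eq_one θ hθ y)
  rw [famGrad_iwBound hw hf hΘ ha n hθ, osiwaeGrad, hS.sampleLaw_filterDensity hε hε1 hκ hθ]
  have hi := integrable_integral_log_insert hw hf hΘ ha n hθ y
  obtain ⟨C, hC⟩ := WeightFamily.exists_c1Family_logAverage (b := ε⁻¹ ^ 3) ha (weightBound ε κ) n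
  have hl := hC hΘ hw
  have k1 := eval_integral (μ := Measure.pi fun _ => measureOfDensity ((S.filterBase t).prod S.nu)
      fun e => S.pairFilter t θ (e, y)) (f := fun z : Fin (n + 1) → X × U =>
      (∑ i, S.weight θ (z i).1 (y (t + 1)) (z i).2)⁻¹ •
        ∑ i, relGrad S.Θ (fun θ => S.weight θ (z i).1 (y (t + 1)) (z i).2) θ)
    (fun j => ((hl.comp (measurable_prodMk_right (y := y))).integrable_famGrad hΘ hθ _ j).congr
      (.of_forall fun z => by
        refine (hw.famGrad_logAverage hΘ ha hθ (z, y) j).trans ?_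
        simp only [Pi.smul_apply, Finset.sum_apply, smul_eq_mul]
        rfl)) i
  have e2 : ∀ j x, ∫ u, (∫ z : Fin n → X × U, Real.log (((n + 1 : ℕ) : ℝ)⁻¹ *
      S.weightAt (fun y : ℕ → Y => y (t + 1)) θ ((x, u), y) +
        ((n + 1 : ℕ) : ℝ)⁻¹ * ∑ j, S.weightAt (fun y : ℕ → Y => y (t + 1)) θ (z j, y))
        ∂(Measure.pi fun _ => measureOfDensity ((S.filterBase t).prod S.nu)
          fun e => S.pairFilter t θ (e, y))) * famGrad S.Θ j (S.pairFilter t) θ ((x, u), y) ∂S.nu =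
      (∫ u, ∫ z : Fin n → X × U, Real.log (((n + 1 : ℕ) : ℝ)⁻¹ *
      S.weight θ x (y (t + 1)) u +
        ((n + 1 : ℕ) : ℝ)⁻¹ * ∑ j, S.weight θ (z j).1 (y (t + 1)) (z j).2)
        ∂(Measure.pi fun _ => measureOfDensity ((S.filterBase t).prod S.nu)
          fun e => S.pairFilter t θ (e, y)) ∂S.nu) * famGrad S.Θ j (S.obsFilter t) θ (x, y) :=
    fun j x => by rw [← integral_mul_const]; rfl
  have k2 := eval_integral (μ := S.lamX) (f := fun x =>
    (∫ u, ∫ z : Fin n → X × U, Real.log (((n + 1 : ℕ) : ℝ)⁻¹ *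
      S.weight θ x (y (t + 1)) u +
        ((n + 1 : ℕ) : ℝ)⁻¹ * ∑ j, S.weight θ (z j).1 (y (t + 1)) (z j).2)
        ∂(Measure.pi fun _ => measureOfDensity ((S.filterBase t).prod S.nu)
          fun e => S.pairFilter t θ (e, y)) ∂S.nu) • S.tangentDensity θ y t x)
    (fun j => hS.integrable_mul_tangentDensity hε hε1 hκ hθ y t (by
      simpa only [e2] using (hi j).integral_prod_left)) i
  rw [Pi.add_apply, k1, Pi.smul_apply]
  refine congrArg₂ (· + ·) ?_ ?_
  · refine integral_congr_ae (.of_forall fun z => ?_)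
    simp only [Pi.smul_apply, Finset.sum_apply, smul_eq_mul]
    rfl
  · rw [smul_eq_mul]
    congr 1
    refine k2.trans ?_
    rw [integral_prod _ (hi i)]
    simp only [e2, Pi.smul_apply, smul_eq_mul]
    rw [hS.integral_mul_tangentDensity hε hε1 hκ hθ]

end Assumptions

/-- The constant in the comparison of the gradients. -/
def gradBiasBound (ε κ : ℝ) : ℝ :=
  ((weightBound ε κ) ^ 2 + (ε⁻¹ ^ 3) ^ 2) / (ε ^ 3) ^ 2 +
    weightBound ε κ * (ε⁻¹ ^ 3) ^ 2 / (ε ^ 3) ^ 3 +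
      ((ε⁻¹ ^ 3) ^ 2 / (ε ^ 3) ^ 2 + (ε⁻¹ ^ 3) ^ 3 / (ε ^ 3) ^ 3) * (4 * κ / ε ^ 3)

theorem gradBiasBound_nonneg (hε : 0 < ε) (hκ : 0 ≤ κ) : 0 ≤ gradBiasBound ε κ := by
  simp only [gradBiasBound, weightBound]
  positivity

/-- Both sides are gradients of functions of the same weights and densities, so the general
comparison applies in each coordinate, which is enough for the maximum norm. -/
theorem Assumptions.norm_osiwaeGrad_sub_rmlGrad_le (hS : S.Assumptions ε κ) (hε : 0 < ε)
    (hε1 : ε < 1) (hκ : 1 ≤ κ) {θ : Fin p → ℝ} (hθ : θ ∈ S.Θ) (y : ℕ → Y) (t : ℕ) {M : ℕ}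
    (hM : 1 ≤ M) :
    ‖S.osiwaeGrad M θ (y (t + 1)) (S.filterDensity θ y t) (S.tangentDensity θ y t) -
      S.rmlGrad θ (y (t + 1)) (S.filterDensity θ y t) (S.tangentDensity θ y t)‖ ≤
      gradBiasBound ε κ / M := by
  have := hS.isFiniteMeasure_filterBase t
  have := hS.prob_nu
  have h0 := gradBiasBound_nonneg hε (show 0 ≤ κ by linarith)
  obtain ⟨n, rfl⟩ := Nat.exists_eq_add_of_le' hM
  rw [pi_norm_le_iff_of_nonneg (by positivity)]
  intro i
  rw [Pi.sub_apply, hS.osiwaeGrad_filterDensity hε hε1 hκ hθ,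
    hS.rmlGrad_filterDensity hε hε1 hκ hθ]
  exact abs_famGrad_iwBound_sub_le (hS.weightFamily hε (by linarith) (measurable_pi_apply (t + 1)))
    (hS.scoreFamily_pairFilter hε hε1 hκ t) hS.isParameterSet (by positivity) n hθ y i

end ParamSSM

/-! ### Almost sure limits of the objectives along the observations. -/

namespace IsMixingChain

variable {Ω Z : Type*} [MeasurableSpace Ω] [MeasurableSpace Z] {P : Measure Ω} {ξ : Ω → ℕ → Z}
  {K : ProbabilityTheory.Kernel Z Z}

theorem mono {ρ ρ' : ℝ} (h : IsMixingChain P ξ K ρ) (hρ : ρ ≤ ρ') : IsMixingChain P ξ K ρ' :=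
  ⟨h.measurable, h.step, fun V a hV ha z z' => (h.contract V a hV ha z z').trans
    (mul_le_mul_of_nonneg_right hρ ((abs_nonneg _).trans (ha z z)))⟩

end IsMixingChain

namespace ParamSSM

variable {p : ℕ} {X Y U : Type*} [MeasurableSpace X] [MeasurableSpace Y] [MeasurableSpace U]
  {S : ParamSSM p X Y U} {ε κ : ℝ}

theorem obsFilter_congr {t : ℕ} {θ : Fin p → ℝ} {y y' : ℕ → Y} (h : ∀ i ≤ t, y i = y' i) (x : X) :
    S.obsFilter t θ (x, y) = S.obsFilter t θ (x, y') := by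
  induction t generalizing x with
  | zero => simp only [obsFilter, h 0 le_rfl]
  | succ t ih =>
    have ih' := fun x => ih (fun i hi => h i (hi.trans t.le_succ)) x
    simp only [obsFilter, filterUpdate, updateNorm, predDensity, h (t + 1) le_rfl, ih']

theorem uniformFilter_congr {t : ℕ} {θ : Fin p → ℝ} {y y' : ℕ → Y} (h : ∀ i ≤ t, y i = y' i)
    (x : X) : S.uniformFilter t θ (x, y) = S.uniformFilter t θ (x, y') := by
  induction t generalizing x with
  | zero => simp only [uniformFilter]
  | succ t ih =>
    have ih' := fun x => ih (fun i hi => h i (hi.trans t.le_succ)) x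
    simp only [uniformFilter, filterUpdate, updateNorm, predDensity, h (t + 1) le_rfl, ih']

/-- The restarted filter as a density for pairs of a state and an auxiliary variable. -/
def pairUniformFilter (S : ParamSSM p X Y U) (t : ℕ) : (Fin p → ℝ) → (X × U) × (ℕ → Y) → ℝ :=
  fun θ z => S.uniformFilter t θ (z.1.1, z.2)

/-- Ergodic limits of smooth functionals of the weights and the filter. -/
theorem Assumptions.exists_objective_limit {Ω : Type*} [MeasurableSpace Ω] {P : Measure Ω}
    [IsProbabilityMeasure P] {ξ : Ω → ℕ → X × Y} {N : ProbabilityTheory.Kernel (X × Y) (X × Y)}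
    [ProbabilityTheory.IsMarkovKernel N] {ρ : ℝ} (hξ : IsMixingChain P ξ N ρ) (hρ : ρ < 1)
    (hS : S.Assumptions ε κ) (hε : 0 < ε) (hε1 : ε < 1) (hκ : 1 ≤ κ) (hne : S.Θ.Nonempty)
    (O : Measure (X × U) → (w f : (Fin p → ℝ) → (X × U) × (ℕ → Y) → ℝ) → (Fin p → ℝ) →
      (ℕ → Y) → ℝ)
    (hloc : ∀ {q : Measure (X × U)} {w w' f f' : (Fin p → ℝ) → (X × U) × (ℕ → Y) → ℝ}
      {θ : Fin p → ℝ} {y y' : ℕ → Y}, (∀ e, w θ (e, y) = w' θ (e, y')) →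
      (∀ e, f θ (e, y) = f' θ (e, y')) → O q w f θ y = O q w' f' θ y')
    (hc1 : ∃ A, ∀ {q : Measure (X × U)} [IsFiniteMeasure q]
      {w f : (Fin p → ℝ) → (X × U) × (ℕ → Y) → ℝ}, q.real Set.univ ≤ 1 + S.lamX.real Set.univ →
      WeightFamily S.Θ (weightBound ε κ) (ε ^ 3) (ε⁻¹ ^ 3) w →
      ScoreFamily S.Θ q (4 * κ / ε ^ 3 * ε⁻¹ ^ 5) (4 * κ / ε ^ 3) f → C1Family S.Θ A (O q w f))
    (hsub : ∃ C, 0 ≤ C ∧ ∀ {w f f' : (Fin p → ℝ) → (X × U) × (ℕ → Y) → ℝ} {η : ℝ}, 0 ≤ η →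
      WeightFamily S.Θ (weightBound ε κ) (ε ^ 3) (ε⁻¹ ^ 3) w →
      ScoreFamily S.Θ (S.lamX.prod S.nu) (4 * κ / ε ^ 3 * ε⁻¹ ^ 5) (4 * κ / ε ^ 3) f →
      ScoreFamily S.Θ (S.lamX.prod S.nu) (4 * κ / ε ^ 3 * ε⁻¹ ^ 5) (4 * κ / ε ^ 3) f' →
      C1Family S.Θ η (fun θ z => f θ z - f' θ z) →
      C1Family S.Θ (C * η)
        (fun θ y => O (S.lamX.prod S.nu) w f θ y - O (S.lamX.prod S.nu) w f' θ y)) :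
    ∃ l : (Fin p → ℝ) → ℝ, DifferentiableOn ℝ l S.Θ ∧
      (∀ θ ∈ S.Θ, ∀ᵐ ω ∂P, Tendsto (fun t : ℕ => (t : ℝ)⁻¹ * ∑ s ∈ Finset.range t,
        O ((S.filterBase s).prod S.nu) (S.weightAt fun y : ℕ → Y => y (s + 1)) (S.pairFilter s) θ
          (fun n => (ξ ω n).2)) atTop (𝓝 (l θ))) ∧
      ∀ θ ∈ S.Θ, ∀ i, Tendsto (fun t => ∫ ω, famGrad S.Θ i
        (O ((S.filterBase (t + 1)).prod S.nu) (S.weightAt fun y : ℕ → Y => y (t + 1 + 1))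
          (S.pairFilter (t + 1))) θ (fun n => (ξ ω n).2) ∂P) atTop (𝓝 (relGrad S.Θ l θ i)) := by
  have := hS.finite_lamX
  have := hS.prob_nu
  have hΘ := hS.isParameterSet
  have hκ0 : 0 ≤ κ := by linarith
  have hK : 1 ≤ 4 * κ / ε ^ 3 := by
    rw [le_div_iff₀ (by positivity)]
    have : ε ^ 3 ≤ 1 := pow_le_one₀ hε.le hε1.le
    linarith
  obtain ⟨A, hA⟩ := hc1
  obtain ⟨C, hC0, hC⟩ := hsub
  obtain ⟨C', r, hC'0, hr0, hr1, hforget⟩ := hS.exists_forgetting hε hε1 hκ hne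
  have hw : ∀ t : ℕ, WeightFamily S.Θ (weightBound ε κ) (ε ^ 3) (ε⁻¹ ^ 3)
      (S.weightAt fun y : ℕ → Y => y t) := fun t =>
    hS.weightFamily hε hκ0 (measurable_pi_apply t)
  have hf := hS.scoreFamily_pairFilter hε hε1 hκ
  have hu : ∀ n, ScoreFamily S.Θ (S.lamX.prod S.nu) (4 * κ / ε ^ 3 * ε⁻¹ ^ 5) (4 * κ / ε ^ 3)
      (S.pairUniformFilter n) := fun n =>
    (hS.densityFamily_uniformFilter hε hε1 hκ0 hne n).scoreFamily hS hε hK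
  have hus : ∀ k n, ScoreFamily S.Θ (S.lamX.prod S.nu) (4 * κ / ε ^ 3 * ε⁻¹ ^ 5) (4 * κ / ε ^ 3)
      (fun θ (z : (X × U) × (ℕ → Y)) => S.pairUniformFilter n θ (z.1, fun j => z.2 (j + k))) :=
    fun k n => ((hS.densityFamily_uniformFilter hε hε1 hκ0 hne n).comp
      (ζ := fun (y : ℕ → Y) j => y (j + k)) (by fun_prop)).scoreFamily hS hε hK
  -- The base measure has mass one at time zero and that of `S.lamX` afterwards. The sum bounds
  -- both.
  have hmass : ∀ t, ((S.filterBase t).prod S.nu).real Set.univ ≤ 1 + S.lamX.real Set.univ := by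
    intro t
    have hΛ : 0 ≤ S.lamX.real Set.univ := measureReal_nonneg
    rw [← Set.univ_prod_univ, measureReal_prod_prod, probReal_univ (μ := S.nu), mul_one]
    cases t with
    | zero =>
      have := hS.isProbabilityMeasure_m0
      have : (S.filterBase 0).real Set.univ = 1 := probReal_univ (μ := measureOfDensity S.lamX S.m0)
      linarith
    | succ t => simp only [filterBase]; linarith
  have hbase : ∀ k n : ℕ, S.filterBase (k + 1 + n) = S.lamX := fun k n => by
    rw [show k + 1 + n = (k + n) + 1 by omega]; rfl
  have hsnd : Measurable fun (z : ℕ → X × Y) (n : ℕ) => (z n).2 := by fun_prop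
  have hF : ∀ t, C1Family S.Θ A (O ((S.filterBase t).prod S.nu)
      (S.weightAt fun y : ℕ → Y => y (t + 1)) (S.pairFilter t)) := fun t => by
    have := hS.isFiniteMeasure_filterBase t
    exact hA (hmass t) (hw _) (hf t)
  have hG : ∀ n, C1Family S.Θ A (O (S.lamX.prod S.nu)
      (S.weightAt fun y : ℕ → Y => y (n + 1)) (S.pairUniformFilter n)) := fun n =>
    hA (hmass 1) (hw _) (hu n)
  -- Closeness of the filters gives closeness of the objectives. By `hloc` the objective of the
  -- shifted restarted filter is the restarted objective at the shifted path.
  have hdiff : ∀ k n : ℕ, C1Family S.Θ (C * (C' * r ^ n)) (fun θ (y : ℕ → Y) =>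
      O ((S.filterBase (k + 1 + n)).prod S.nu) (S.weightAt fun y : ℕ → Y => y (k + 1 + n + 1))
        (S.pairFilter (k + 1 + n)) θ y -
      O (S.lamX.prod S.nu) (S.weightAt fun y : ℕ → Y => y (n + 1)) (S.pairUniformFilter n) θ
        (fun j => y (j + (k + 1)))) := fun k n => by
    have hfk := hf (k + 1 + n)
    rw [hbase] at hfk
    have h := hC (by positivity) (hw (k + 1 + n + 1)) hfk (hus (k + 1) n)
      ((hforget k n).comp (ζ := fun z : (X × U) × (ℕ → Y) => (z.1.1, z.2)) (by fun_prop))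
    refine h.congr fun θ hθ y => ?_
    rw [hbase]
    congr 1
    refine hloc (fun e => ?_) fun e => rfl
    simp only [weightAt]
    rw [show n + 1 + (k + 1) = k + 1 + n + 1 by omega]
  have hτ : max r ρ < 1 := max_lt hr1 hρ
  -- Forgetting of the filter and mixing of the chain are given the common rate `max r ρ`.
  obtain ⟨l, hl1, hl2, hl3⟩ := exists_ergodic_limit (A := |A|) (c := C * C') hΘ
    (hξ.mono (le_max_right r ρ)) (abs_nonneg A) (by positivity) (hr0.trans_le (le_max_left _ _)) hτ
    (F := fun t θ z => O ((S.filterBase t).prod S.nu) (S.weightAt fun y : ℕ → Y => y (t + 1))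
      (S.pairFilter t) θ (fun n => (z n).2))
    (G := fun n θ z => O (S.lamX.prod S.nu) (S.weightAt fun y : ℕ → Y => y (n + 1))
      (S.pairUniformFilter n) θ (fun n => (z n).2))
    (fun t => ((hF t).mono (le_abs_self A)).comp hsnd)
    (fun n => ((hG n).mono (le_abs_self A)).comp hsnd)
    (fun t θ _ z z' hz => hloc
      (fun e => by simp only [weightAt]; rw [hz (t + 1) (Set.mem_Iic.2 le_rfl)])
      fun e => obsFilter_congr (fun i hi => congrArg Prod.snd (hz i (Set.mem_Iic.2 (hi.trans t.le_succ)))) _)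
    (fun n θ _ z z' hz => hloc
      (fun e => by simp only [weightAt]; rw [hz (n + 1) (Set.mem_Iic.2 le_rfl)])
      fun e => uniformFilter_congr
        (fun i hi => congrArg Prod.snd (hz i (Set.mem_Iic.2 (hi.trans n.le_succ)))) _)
    (fun k n => ((hdiff k n).mono (by
      rw [mul_assoc]
      have := le_max_left r ρ
      gcongr)).comp hsnd)
  exact ⟨l, hl1, hl2, hl3⟩

end ParamSSM

/-! ### Conclusion. -/

open ParamSSM in
theorem theorem3p3 (ε κ : ℝ) (hε : 0 < ε) (hε1 : ε < 1) (hκ : 1 ≤ κ) :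
    ∃ C : ℝ, ∀ (p : ℕ) (X Y U : Type*)
      [MeasurableSpace X] [MeasurableSpace Y] [MeasurableSpace U]
      (S : ParamSSM p X Y U), S.Assumptions ε κ →
      (∀ (y : ℕ → Y) (t : ℕ), ∀ θ ∈ S.Θ, ∀ M : ℕ, 1 ≤ M →
        ‖S.osiwaeGrad M θ (y (t + 1)) (S.filterDensity θ y t) (S.tangentDensity θ y t) -
          S.rmlGrad θ (y (t + 1)) (S.filterDensity θ y t) (S.tangentDensity θ y t)‖ ≤ C / M) ∧
      (∀ (Ω : Type*) [MeasurableSpace Ω] (P : Measure Ω) [IsProbabilityMeasure P]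
        (mtrue : X → X → ℝ) (gtrue : X → Y → ℝ) (Xs : ℕ → Ω → X) (Ys : ℕ → Ω → Y),
        IsTransitionDensity S.lamX mtrue → IsTransitionDensity S.lamY gtrue →
        (∀ x x', ε ≤ mtrue x x' ∧ mtrue x x' ≤ ε⁻¹) →
        IsSSM S.lamX S.lamY S.m0 mtrue gtrue P Xs Ys →
        ∃ (ℓ : (Fin p → ℝ) → ℝ) (ℓM : ℕ → (Fin p → ℝ) → ℝ),
          S.IsContrast P Ys ℓ ∧ DifferentiableOn ℝ ℓ S.Θ ∧
          ∀ M : ℕ, 1 ≤ M →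
            S.IsContrastLowerBound M P Ys (ℓM M) ∧ DifferentiableOn ℝ (ℓM M) S.Θ ∧
            ∀ θ ∈ S.Θ, ‖relGrad S.Θ (ℓM M) θ - relGrad S.Θ ℓ θ‖ ≤ C / M) := by
  refine ⟨gradBiasBound ε κ, fun p X Y U _ _ _ S hS => ⟨fun y t θ hθ M hM =>
    hS.norm_osiwaeGrad_sub_rmlGrad_le hε hε1 hκ hθ y t hM, ?_⟩⟩
  intro Ω _ P _ mtrue gtrue Xs Ys hm hg hmb hssm
  -- The mass bounds for `S.lamX` come from a transition density of the family, so they need a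
  -- parameter. For empty `Θ` all claims are void.
  rcases S.Θ.eq_empty_or_nonempty with hΘe | hne
  · exact ⟨0, 0, by simp [IsContrast, hΘe], by simp [hΘe],
      fun M _ => ⟨by simp [IsContrastLowerBound, hΘe], by simp [hΘe], by simp [hΘe]⟩⟩
  have := hS.finite_lamX
  have := hS.finite_lamY
  have := hS.prob_nu
  have hΘ := hS.isParameterSet
  have hκ0 : 0 ≤ κ := by linarith
  have ha : 0 < ε ^ 3 := by positivity
  have hC0 := gradBiasBound_nonneg hε hκ0
  have hAB : 0 ≤ weightBound ε κ * (4 * κ / ε ^ 3 * ε⁻¹ ^ 5) := by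
    simp only [weightBound]; positivity
  have hΛ := (hS.mass_lamX hε hne).1
  have hΛ0 := hε.trans_le hΛ
  have hmass : (S.lamX.prod S.nu).real Set.univ = S.lamX.real Set.univ := by
    rw [← Set.univ_prod_univ, measureReal_prod_prod, probReal_univ (μ := S.nu), mul_one]
  have hchain := hssm.isMixingChain hε hS.measurable_m0 hS.nonneg_m0 hm hg
    (fun x x' => (hmb x x').1) hΛ0
  have := isMarkovKernel_ssmKernel hm hg
  have hρ : 1 - ε * S.lamX.real Set.univ < 1 := by
    have : 0 < ε * S.lamX.real Set.univ := by positivity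
    linarith
  obtain ⟨ℓ, hℓ1, hℓ2, hℓ3⟩ := hS.exists_objective_limit hchain hρ hε hε1 hκ hne
    (fun q w f θ y => Real.log (marginalLik q w f θ y))
    (fun h1 h2 => by simp only [marginalLik, h1, h2])
    ⟨_, fun hq hw hf => c1Family_log_marginalLik hw hf hΘ ha hAB hq⟩
    ⟨((ε ^ 3)⁻¹ + 2 * (weightBound ε κ * (4 * κ / ε ^ 3 * ε⁻¹ ^ 5)) *
        (S.lamX.prod S.nu).real Set.univ / (ε ^ 3) ^ 2) *
        (2 * weightBound ε κ * (S.lamX.prod S.nu).real Set.univ), by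
      simp only [weightBound]; positivity, fun _ hw hf hf' h =>
      (c1Family_log_marginalLik_sub hw hf hf' hΘ ha h).mono (le_of_eq (by ring))⟩
  have hM : ∀ n : ℕ, ∃ l : (Fin p → ℝ) → ℝ, S.IsContrastLowerBound (n + 1) P Ys l ∧
      DifferentiableOn ℝ l S.Θ ∧
      ∀ θ ∈ S.Θ, ‖relGrad S.Θ l θ - relGrad S.Θ ℓ θ‖ ≤ gradBiasBound ε κ / (n + 1 : ℕ) := by
    intro n
    obtain ⟨C₁, h₁⟩ := exists_c1Family_iwBound ha (weightBound ε κ) (ε⁻¹ ^ 3)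
      (4 * κ / ε ^ 3 * ε⁻¹ ^ 5) (1 + S.lamX.real Set.univ) n
    obtain ⟨C₂, hC₂, h₂⟩ := exists_c1Family_iwBound_sub ha (weightBound ε κ) (ε⁻¹ ^ 3)
      (4 * κ / ε ^ 3 * ε⁻¹ ^ 5) (S.lamX.real Set.univ) n
    obtain ⟨l, hl1, hl2, hl3⟩ := hS.exists_objective_limit hchain hρ hε hε1 hκ hne
      (fun q w f => iwBound q (n + 1) w f)
      (fun h1 h2 => by simp only [iwBound, logAverage, h1, h2])
      ⟨C₁, fun hq hw hf => h₁ hΘ hq hw hf.c1⟩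
      ⟨C₂, hC₂, fun hη hw hf hf' h => h₂ hΘ hη hmass.le hw hf.c1 hf'.c1 h⟩
    refine ⟨l, fun θ hθ => ?_, hl1, fun θ hθ => ?_⟩
    · filter_upwards [hl2 θ hθ] with ω hω
      refine hω.congr fun t => ?_
      simp only [← hS.iwObjective_filterDensity hε hε1 hκ hθ]
    · rw [pi_norm_le_iff_of_nonneg (by positivity)]
      intro i
      rw [Pi.sub_apply, Real.norm_eq_abs]
      -- Both gradients are limits of expected gradients at finite times, so it suffices to bound
      -- each difference of expectations, which the pathwise estimate does.
      refine le_of_tendsto ((hl3 θ hθ i).sub (hℓ3 θ hθ i)).abs (.of_forall fun t => ?_)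
      have hw := hS.weightFamily hε hκ0
        (measurable_pi_apply (t + 1 + 1) : Measurable fun y : ℕ → Y => y (t + 1 + 1))
      have hf := hS.scoreFamily_pairFilter hε hε1 hκ (t + 1)
      have := hS.isFiniteMeasure_filterBase (t + 1)
      have hY : Measurable fun ω n => Ys n ω := measurable_pi_lambda _ hssm.measurable_obs
      have hq : ((S.filterBase (t + 1)).prod S.nu).real Set.univ ≤ S.lamX.real Set.univ := hmass.le
      have i1 : Integrable (fun ω => famGrad S.Θ i (iwBound ((S.filterBase (t + 1)).prod S.nu)
          (n + 1) (S.weightAt fun y : ℕ → Y => y (t + 1 + 1)) (S.pairFilter (t + 1))) θ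
            (fun n => Ys n ω)) P :=
        ((h₁ hΘ (hq.trans (by linarith)) hw hf.c1).comp hY).integrable_famGrad hΘ hθ P i
      have i2 : Integrable (fun ω => famGrad S.Θ i (fun θ y => Real.log
          (marginalLik ((S.filterBase (t + 1)).prod S.nu)
          (S.weightAt fun y : ℕ → Y => y (t + 1 + 1)) (S.pairFilter (t + 1)) θ y)) θ
            (fun n => Ys n ω)) P :=
        ((c1Family_log_marginalLik hw hf hΘ ha hAB hq).comp hY).integrable_famGrad hΘ hθ P i
      refine (congrArg abs (integral_sub i1 i2).symm).le.trans ?_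
      rw [← Real.norm_eq_abs]
      refine le_trans (norm_integral_le_of_norm_le_const (C := gradBiasBound ε κ / (n + 1 : ℕ))
        (.of_forall fun ω => ?_)) (le_of_eq (by rw [probReal_univ, mul_one]))
      exact abs_famGrad_iwBound_sub_le hw hf hΘ ha n hθ (fun k => Ys k ω) i
  choose L hL using hM
  -- The limits are indexed by `n` with sample size `n + 1`. The value at `M = 0` is irrelevant.
  refine ⟨ℓ, fun M => L (M - 1), fun θ hθ => ?_, hℓ1, fun M hM => ?_⟩
  · filter_upwards [hℓ2 θ hθ] with ω hω
    refine hω.congr fun t => ?_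
    simp only [← hS.logPredLik_filterDensity hε hε1 hκ hθ]
  · obtain ⟨n, rfl⟩ := Nat.exists_eq_add_of_le' hM
    exact hL n

end
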